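/- **Proposition.** Let $\mathbb{R}^3_+=\{x_3>0\}$, $E_3=(0,0,1)$, $\theta\in(0,\pi)$, and let $\Sigma$ be a compact smooth orientable surface with non-empty boundary. Let $F:\Sigma\to\overline{\mathbb{R}^3_+}$ be an immersion, $C^2$ up to the boundary and smooth in the interior, with $F(\mathrm{int}\,\Sigma)\subset\mathbb{R}^3_+$ and $F(\partial\Sigma)\subset\partial\mathbb{R}^3_+$, and let $\nu$ be a global continuous unit normal field along $F$. Along $\partial\Sigma$ let $\mu_\partial$ be the outward unit conormal of $\partial\Sigma$ in $\Sigma$, let $\tau=\nu\times\mu_\partial$ be the unit tangent of $\partial\Sigma$ (so that $(\tau,\nu,\mu_\partial)$ is positively oriented), and let $\bar\nu=\tau\times E_3$ be the corresponding unit normal in $\partial\mathbb{R}^3_+$. Assume that $F$ is $\theta$-capillary: $$\mu_\partial=\sin\theta\,(-E_3)+\cos\theta\,\bar\nu\quad\text{along }\partial\Sigma .$$ Let $\mathrm{wind}(x)=\frac1{2\pi}\int_{\partial\Sigma}\frac{\langle E_3\times(F-x),\tau\rangle}{|F-x|^2}\,ds$ be the winding number about $x\in\partial\mathbb{R}^3_+\setminus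 F(\partial\Sigma)$ of the boundary curves $F(\partial\Sigma)$, oriented by $\tau$, and assume $\mathrm{wind}(x)\ge0$ for all such $x$. Let $\mu_g$ be the area measure of $g=F^*g_{\rm euc}$, let $V=F_\sharp(\mu_g\otimes\delta_{T_p\Sigma})$ be the image varifold, with weight measure $\mu$, and let $W=\eta\otimes\delta_{T_x\partial\mathbb{R}^3_+}$, where $\eta=\mathrm{wind}(x)\,\mathcal{H}^2\llcorner\partial\mathbb{R}^3_+$. Then $(V,W)$ satisfies the contact angle condition $\theta$ with square-integrable generalized mean curvature. That is: $V$ and $W$ are rectifiable $2$-varifolds, supported on $\overline{\mathbb{R}^3_+}$ and on $\partial\mathbb{R}^3_+$ respectively; $\mathrm{spt}\,\mu$ is countably $2$-rectifiable; and there is a $\mu$-measurable vector field $\vec{\mathbf H}\in L^1(\mu)\cap L^2(\mu)$ with values in $\mathbb{R}^3$, such that $\vec{\mathbf H}(x)\in T_x\partial\mathbb{R}^3_+$ for $\mu$-a.e. $x\in\partial\mathbb{R}^3_+$ and, for every $X\in C^1_c(\mathbb{R}^3;\mathbb{R}^3)$ that is tangent to $\partial\mathbb{R}^3_+$ along $\partial\mathbb{R}^3_+$,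 $$\int \mathrm{div}_P X(x)\,dV(x,P)-\cos\theta\int_{\partial\mathbb{R}^3_+}\mathrm{div}_{\partial\mathbb{R}^3_+}X\,d\eta=-\int\vec{\mathbf H}\cdot X\,d\mu .$$ -/

import Mathlib

open MeasureTheory Filter Topology Set
open scoped Manifold ContDiff

noncomputable section

/-- Euclidean space `ℝ³`; the third coordinate of `x` is `x 2`. -/
abbrev E3 : Type := EuclideanSpace ℝ (Fin 3)

/-- Euclidean plane `ℝ²`, the model vector space of surfaces. -/
abbrev E2 : Type := EuclideanSpace ℝ (Fin 2)

/-- The vector `E₃ = (0, 0, 1)`. -/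
def vertical : E3 := EuclideanSpace.single 2 1

/-- The closed upper half-space. -/
def closedHalfSpace : Set E3 := {x | 0 ≤ x 2}

/-- The boundary plane of the upper half-space, as a set. -/
def boundaryPlane : Set E3 := {x | x 2 = 0}

/-- The cross product of `ℝ³`. -/
def cross (x y : E3) : E3 := WithLp.toLp 2 (crossProduct x.ofLp y.ofLp)

/-! ### Varifolds -/

/-- The Grassmannian `G(3,2)` of two-dimensional linear subspaces of `ℝ³`. -/
def Grass : Type := {P : Submodule ℝ E3 // Module.finrank ℝ P = 2}

/-- The topology of `G(3,2)`: planes are compared through the operator norm distance of their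
orthogonal projections. -/
instance instTopologicalSpaceGrass : TopologicalSpace Grass :=
  TopologicalSpace.induced (fun P : Grass => P.1.starProjection) inferInstance

instance instMeasurableSpaceGrass : MeasurableSpace Grass := borel Grass

instance instBorelSpaceGrass : BorelSpace Grass := ⟨rfl⟩

/-- A `2`-varifold in `ℝ³` is a (Radon) measure on `ℝ³ × G(3,2)`; this is its weight measure. -/
def varifoldWeight (V : Measure (E3 × Grass)) : Measure E3 := V.map Prod.fst

/-- `M` is countably `2`-rectifiable: up to an `ℋ²`-null set it is covered by countably many
Lipschitz images of `ℝ²`. Here `μHE[2]` is the Hausdorff measure `ℋ²`, normalized so that it agrees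
with Lebesgue measure on planes. -/
def IsCountablyTwoRectifiable (M : Set E3) : Prop :=
  ∃ f : ℕ → E2 → E3, (∀ j, ∃ K, LipschitzWith K (f j)) ∧
    (μHE[2] : Measure E3) (M \ ⋃ j, range (f j)) = 0

/-- The measure `ϑ ℋ² ⌞ M`. -/
def weightedArea (M : Set E3) (ϑ : E3 → ℝ) : Measure E3 :=
  ((μHE[2] : Measure E3).restrict M).withDensity (fun x => ENNReal.ofReal (ϑ x))

/-- `P` is the approximate tangent plane at `x` of `M` with respect to the multiplicity `ϑ`: the
blow-ups of `ϑ ℋ² ⌞ M` at `x` converge weakly to `ϑ(x) ℋ² ⌞ P`. -/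
def IsApproxTangentPlane (M : Set E3) (ϑ : E3 → ℝ) (x : E3) (P : Submodule ℝ E3) : Prop :=
  ∀ f : E3 → ℝ, Continuous f → HasCompactSupport f →
    Tendsto (fun r : ℝ => (r ^ 2)⁻¹ * ∫ y, f (r⁻¹ • (y - x)) ∂(weightedArea M ϑ)) (𝓝[>] 0)
      (𝓝 (ϑ x * ∫ y in (P : Set E3), f y ∂(μHE[2] : Measure E3)))

/-- Rectifiable `2`-varifolds `v(M, ϑ)`: `M` is countably `2`-rectifiable, `ϑ` is positive and
locally `ℋ²`-integrable on `M`, and `V` is `ϑ ℋ² ⌞ M` carried by the approximate tangent planes. -/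
def IsRectifiableVarifold (V : Measure (E3 × Grass)) : Prop :=
  IsLocallyFiniteMeasure V ∧
  ∃ (M : Set E3) (ϑ : E3 → ℝ) (T : E3 → Grass),
    MeasurableSet M ∧ IsCountablyTwoRectifiable M ∧ (∀ x ∈ M, 0 < ϑ x) ∧
    LocallyIntegrable ϑ ((μHE[2] : Measure E3).restrict M) ∧
    AEMeasurable T (weightedArea M ϑ) ∧
    (∀ᵐ x ∂((μHE[2] : Measure E3).restrict M), IsApproxTangentPlane M ϑ x (T x).1) ∧
    V = (weightedArea M ϑ).map (fun x => (x, T x))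

/-- The divergence at `x` of the vector field `X` along the linear subspace `P`, that is, the trace
of `P`-projection composed with `DX(x)`. -/
def divAlong (P : Submodule ℝ E3) (X : E3 → E3) (x : E3) : ℝ :=
  LinearMap.trace ℝ E3 ((P.starProjection ∘L fderiv ℝ X x : E3 →L[ℝ] E3) : E3 →ₗ[ℝ] E3)

/-- The boundary plane of the half-space as a linear subspace. -/
def planeSubmodule : Submodule ℝ E3 :=
  LinearMap.ker (EuclideanSpace.proj (2 : Fin 3) : E3 →L[ℝ] ℝ).toLinearMap

theorem finrank_planeSubmodule : Module.finrank ℝ planeSubmodule = 2 := by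
  have h := LinearMap.finrank_range_add_finrank_ker
    (EuclideanSpace.proj (2 : Fin 3) : E3 →L[ℝ] ℝ).toLinearMap
  have hs : LinearMap.range (EuclideanSpace.proj (2 : Fin 3) : E3 →L[ℝ] ℝ).toLinearMap = ⊤ := by
    rw [LinearMap.range_eq_top]
    intro c
    exact ⟨EuclideanSpace.single 2 c, by simp⟩
  rw [hs, finrank_top, Module.finrank_self, finrank_euclideanSpace_fin] at h
  change 1 + Module.finrank ℝ planeSubmodule = 3 at h
  omega

/-- The boundary plane of the half-space as a point of the Grassmannian. -/
def planeGrass : Grass := ⟨planeSubmodule, finrank_planeSubmodule⟩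

/-- The pair of rectifiable varifolds `(V, W)`, supported on the closed half-space and on its
boundary plane, satisfies the contact angle condition `θ` with generalized mean curvature `H`. -/
structure IsContactPair (θ : ℝ) (V W : Measure (E3 × Grass)) (H : E3 → E3) : Prop where
  rectifiable_left : IsRectifiableVarifold V
  rectifiable_right : IsRectifiableVarifold W
  support_left : (varifoldWeight V).support ⊆ closedHalfSpace
  support_right : (varifoldWeight W).support ⊆ boundaryPlane
  rectifiable_support : IsCountablyTwoRectifiable (varifoldWeight V).support
  integrable : MemLp H 1 (varifoldWeight V)
  tangential : ∀ᵐ x ∂(varifoldWeight V), x ∈ boundaryPlane → H x 2 = 0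
  first_variation : ∀ X : E3 → E3, ContDiff ℝ 1 X → HasCompactSupport X →
    (∀ x ∈ boundaryPlane, X x 2 = 0) →
    (∫ z, divAlong z.2.1 X z.1 ∂V)
        - Real.cos θ * ∫ x, divAlong planeSubmodule X x ∂(varifoldWeight W)
      = - ∫ x, inner ℝ (H x) (X x) ∂(varifoldWeight V)

/-! ### Immersed surfaces with boundary -/

section Surface

variable {S : Type*} [TopologicalSpace S] [ChartedSpace (EuclideanHalfSpace 2) S]

/-- The differential of `F` at `p`. The tangent space at `p` is `ℝ²` through the preferred chart at
`p`; if `p` is a boundary point, then the first basis vector points into the surface and the second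
one is tangent to the boundary. -/
def differential (F : S → E3) (p : S) : E2 →L[ℝ] E3 :=
  mfderiv (𝓡∂ 2) 𝓘(ℝ, E3) F p

/-- The partial derivative of `F` in direction `i` at the point `u` of the chart at `p₀`. -/
def chartPartial (F : S → E3) (p₀ : S) (u : E2) (i : Fin 2) : E3 :=
  fderivWithin ℝ (F ∘ (extChartAt (𝓡∂ 2) p₀).symm) (range (𝓡∂ 2)) u (EuclideanSpace.single i 1)

/-- The area measure of the pull-back metric `g = F^* g_euc`. In each chart it is `√(det gᵢⱼ) du`;
these local measures agree on overlaps, and their supremum is the measure they glue to. -/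
def areaMeasure [MeasurableSpace S] (F : S → E3) : Measure S :=
  ⨆ p₀ : S, ((volume.restrict (extChartAt (𝓡∂ 2) p₀).target).withDensity
      (fun u => ENNReal.ofReal √(Matrix.gram ℝ (chartPartial F p₀ u)).det)).map
    (extChartAt (𝓡∂ 2) p₀).symm

/-- The length measure on the boundary of the surface for the pull-back metric, glued in the same
way from the measures `|∂₂ F| dt` on the boundary lines `u = (0, t)` of the charts. -/
def boundaryLength [MeasurableSpace S] (F : S → E3) : Measure S :=
  ⨆ p₀ : S, ((volume.restrict {t : ℝ | !₂[0, t] ∈ (extChartAt (𝓡∂ 2) p₀).target}).withDensity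
      (fun t => ENNReal.ofReal ‖chartPartial F p₀ !₂[0, t] 1‖)).map
    (fun t => (extChartAt (𝓡∂ 2) p₀).symm !₂[0, t])

/-- The outward unit conormal `μ` of the boundary in the surface, at a boundary point `p`: the
normalization of minus the component orthogonal to the boundary of the inward vector `a`. -/
def conormal (F : S → E3) (p : S) : E3 :=
  let a := differential F p (EuclideanSpace.single 0 1)
  let b := differential F p (EuclideanSpace.single 1 1)
  let w := (inner ℝ b a / inner ℝ b b) • b - a
  ‖w‖⁻¹ • w

/-- The unit tangent `τ` of the boundary for which `(τ, ν, μ)` is a positively oriented basis. -/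
def boundaryTangent (F ν : S → E3) (p : S) : E3 := cross (ν p) (conormal F p)

/-- The unit normal `ν̄` of the boundary curve in the plane, for which `(ν̄, -E₃)` and `(ν, μ)` have
the same orientation in the plane orthogonal to `τ`. -/
def planarNormal (F ν : S → E3) (p : S) : E3 := cross (boundaryTangent F ν p) vertical

/-- `F` is a proper immersion of the surface into the closed half-space with global unit normal
field `ν`, and it is capillary with contact angle `θ`: `μ = sin θ (-E₃) + cos θ ν̄` along the
boundary. -/
structure IsCapillaryImmersion (θ : ℝ) (F ν : S → E3) : Prop where
  contMDiff : ContMDiff (𝓡∂ 2) 𝓘(ℝ, E3) 2 F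
  contMDiffOn_interior : ContMDiffOn (𝓡∂ 2) 𝓘(ℝ, E3) ∞ F ((𝓡∂ 2).interior S)
  immersion : ∀ p, Function.Injective (differential F p)
  interior_pos : ∀ p ∈ (𝓡∂ 2).interior S, 0 < F p 2
  boundary_zero : ∀ p ∈ (𝓡∂ 2).boundary S, F p 2 = 0
  normal_continuous : Continuous ν
  normal_unit : ∀ p, ‖ν p‖ = 1
  normal_orthogonal : ∀ p v, inner ℝ (ν p) (differential F p v) = 0
  contact_angle : ∀ p ∈ (𝓡∂ 2).boundary S,
    conormal F p = Real.sin θ • (-vertical) + Real.cos θ • planarNormal F ν p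

/-- The tangent plane `dF(T_pΣ)`. -/
def tangentPlane (F : S → E3) (hF : ∀ p, Function.Injective (differential F p)) (p : S) : Grass :=
  ⟨LinearMap.range (differential F p).toLinearMap, by
    have h := LinearMap.finrank_range_of_inj (f := (differential F p).toLinearMap) (hF p)
    rw [h, finrank_euclideanSpace_fin]⟩

/-- The image varifold `F_♯(μ_g ⊗ δ_{T_pΣ})` of the immersed surface. -/
def imageVarifold [MeasurableSpace S] (F : S → E3)
    (hF : ∀ p, Function.Injective (differential F p)) : Measure (E3 × Grass) :=
  (areaMeasure F).map (fun p => (F p, tangentPlane F hF p))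

/-- The winding number about `x` (a point of the boundary plane off the boundary curves) of the
boundary curves `F(∂Σ)`, oriented by `τ`: the total change of the polar angle about `x`, divided by
`2π`. For `v` in the plane, `cross vertical v` is `v` rotated by `π/2` counterclockwise. -/
def windingNumber [MeasurableSpace S] (F ν : S → E3) (x : E3) : ℝ :=
  (2 * Real.pi)⁻¹ * ∫ p, inner ℝ (cross vertical (F p - x)) (boundaryTangent F ν p) / ‖F p - x‖ ^ 2
    ∂(boundaryLength F)

/-- The measure `η = wind(x) ℋ²` on the boundary plane. -/
def windingMeasure [MeasurableSpace S] (F ν : S → E3) : Measure E3 :=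
  weightedArea boundaryPlane (windingNumber F ν)

/-- The varifold `W = η ⊗ δ_{T_x ∂ℝ³₊}`. -/
def windingVarifold [MeasurableSpace S] (F ν : S → E3) : Measure (E3 × Grass) :=
  (windingMeasure F ν).map (fun x => (x, planeGrass))

end Surface

end

set_option linter.unusedSectionVars false
noncomputable section

/-! ### The area formula for injective immersions -/

section AreaFormula

variable {V W : Type*} [NormedAddCommGroup V] [InnerProductSpace ℝ V] [FiniteDimensional ℝ V]
  [MeasurableSpace V] [BorelSpace V] [NormedAddCommGroup W] [InnerProductSpace ℝ W]
  [MeasurableSpace W] [BorelSpace W]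

/-! The first variation of the surface is minus the integral of the mean curvature vector paired
with `X`, plus the boundary flux of `X` against the conormal. If `X` is horizontal on the boundary
plane, the contact angle condition turns that flux into `cos θ` times the flux of `X` through the
planar boundary curves. The winding number has exactly this planar flux as its first variation: by
Green's formula, the integral of `wind · div X` over the plane is the integral of `⟨X, ν̄⟩` along
the curves. The term with `cos θ` therefore cancels the boundary term, and only the curvature
remains.

For the surface, a partition of unity reduces the first variation (`exists_first_variation`) to
charts, where it is the divergence theorem on a half-plane. Since `F` is `C²` up to the boundary,
the resulting curvature field is continuous on the compact surface. It lives upstairs, where several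
sheets may lie over one point; the adjoint of the `L²` isometry `X ↦ X ∘ F` carries it to a field
`H` in `L²` of the weight measure (`exists_memLp_two_map_inner`).

For the plane, identified with `ℂ`, the winding number is the imaginary part of the Cauchy integral
of the curves, up to `2π`. The Cauchy kernel is a fundamental solution (`integral_div_curl_cauchy`,
proved in polar coordinates), and the real part of the Cauchy integral vanishes off the curves
because it integrates the tangential derivative of `log |F - x|` over closed curves. These two facts
give Green's formula (`integral_div_winding`) without any topology of curves. Nonnegativity of the
winding number is what makes its measure carry the whole density.

Rectifiability of `V` rests on the area formula: the image of the area measure is `ℋ²` on the image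
of the interior, weighted with the number of preimages. Blow-ups converge to the tangent plane of
each sheet, and at almost every point all sheets share one plane, by a density point argument. For
`W`, the winding number is locally integrable and continuous off the curves, which gives the plane
as approximate tangent plane. Because `sin θ ≠ 0`, tangent and conormal of the boundary are explicit
functions of `ν`, hence continuous. -/

theorem euclideanHausdorffMeasure_image_le_of_dist_le {α X Y : Type*} [MetricSpace X]
    [MeasurableSpace X] [BorelSpace X] [MetricSpace Y] [MeasurableSpace Y] [BorelSpace Y]
    {s : Set α} {f : α → X} {g : α → Y} {K : NNReal} (d : ℕ)
    (h : ∀ x ∈ s, ∀ y ∈ s, dist (f x) (f y) ≤ K * dist (g x) (g y)) :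
    (μHE[d] : Measure X) (f '' s) ≤ (K : ENNReal) ^ d * (μHE[d] : Measure Y) (g '' s) := by
  classical
  rcases s.eq_empty_or_nonempty with rfl | ⟨x₀, hx₀⟩
  · simp
  have : Nonempty α := ⟨x₀⟩
  -- The bound makes `g x ↦ f x` well defined and `K`-Lipschitz on `g '' s`; `k` is this map,
  -- written with chosen preimages.
  set k : Y → X := fun y => f (Function.invFunOn g s y) with hk
  have hkg : ∀ x ∈ s, k (g x) = f x := by
    intro x hx
    have hmem : Function.invFunOn g s (g x) ∈ s := Function.invFunOn_mem ⟨x, hx, rfl⟩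
    have heq : g (Function.invFunOn g s (g x)) = g x := Function.invFunOn_eq ⟨x, hx, rfl⟩
    have := h _ hmem x hx
    rw [heq, dist_self, mul_zero] at this
    exact dist_le_zero.1 this
  have himg : f '' s = k '' (g '' s) := by
    rw [image_image]
    exact image_congr fun x hx => (hkg x hx).symm
  have hlip : LipschitzOnWith K k (g '' s) := by
    rw [lipschitzOnWith_iff_dist_le_mul]
    rintro _ ⟨x, hx, rfl⟩ _ ⟨y, hy, rfl⟩
    rw [hkg x hx, hkg y hy]
    exact h x hx y hy
  rw [himg, Measure.euclideanHausdorffMeasure_def, Measure.euclideanHausdorffMeasure_def,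
    Measure.smul_apply, Measure.smul_apply, mul_smul_comm]
  have := hlip.hausdorffMeasure_image_le (Nat.cast_nonneg d)
  rw [ENNReal.rpow_natCast] at this
  gcongr

theorem euclideanHausdorffMeasure_image_null_of_dist_le {X Y : Type*} [MetricSpace X]
    [MeasurableSpace X] [BorelSpace X] [MetricSpace Y] [MeasurableSpace Y] [BorelSpace Y]
    {s : Set Y} {f : Y → X} {K : NNReal} {d : ℕ}
    (h : ∀ x ∈ s, ∀ y ∈ s, dist (f x) (f y) ≤ K * dist x y)
    (hs : (μHE[d] : Measure Y) s = 0) : (μHE[d] : Measure X) (f '' s) = 0 := by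
  have := euclideanHausdorffMeasure_image_le_of_dist_le (g := id) d h
  rw [image_id, hs, mul_zero] at this
  exact le_antisymm this zero_le

theorem continuous_normDet : Continuous fun A : V →L[ℝ] W => (A : V →ₗ[ℝ] W).normDet := by
  have h : ∀ A : V →L[ℝ] W, (A : V →ₗ[ℝ] W).normDet =
      √(Matrix.gram ℝ fun i => A (stdOrthonormalBasis ℝ V i)).det := by
    intro A
    have := (A : V →ₗ[ℝ] W).normDet_sq_eq_det_gram (stdOrthonormalBasis ℝ V)
    simp only [RCLike.ofReal_real_eq_id, id_eq, ContinuousLinearMap.coe_coe] at this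
    rw [← this, Real.sqrt_sq (LinearMap.normDet_nonneg _)]
  simp_rw [h]
  refine Real.continuous_sqrt.comp (Continuous.matrix_det ?_)
  refine continuous_matrix fun i j => ?_
  simp only [Matrix.gram_apply]
  fun_prop

theorem normDet_pos_of_injective {A : V →L[ℝ] W} (hA : Function.Injective A) :
    0 < (A : V →ₗ[ℝ] W).normDet := by
  refine lt_of_le_of_ne (LinearMap.normDet_nonneg _) fun h => ?_
  exact (LinearMap.normDet_eq_zero_iff_ker_ne_bot.1 h.symm) (LinearMap.ker_eq_bot.2 hA)

/-- Near a point, an immersion distorts distances and areas almost like its differential. -/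
theorem eventually_dist_le_mul_of_hasStrictFDerivAt {G : V → W} {A : V →L[ℝ] W} {u : V}
    (hG : HasStrictFDerivAt G A u) (hA : Function.Injective A) {K : ℝ} (hK : 1 < K) :
    ∀ᶠ z in 𝓝 (u, u), dist (G z.1) (G z.2) ≤ K * dist (A z.1) (A z.2) ∧
      dist (A z.1) (A z.2) ≤ K * dist (G z.1) (G z.2) := by
  obtain ⟨C, hC0, hC⟩ := (A : V →ₗ[ℝ] W).exists_antilipschitzWith (LinearMap.ker_eq_bot.2 hA)
  have hK0 : 0 < K := by linarith
  have hC0' : (0 : ℝ) < C := hC0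
  -- Together with `|v| ≤ C |A v|`, this tolerance gives an error of at most `1 - 1/K` relative to
  -- the length of `A z.1 - A z.2`. The two ratios are then at most `2 - 1/K ≤ K` and `1 / (1/K) =
  -- K`.
  have hη : 0 < (K - 1) / K / C := div_pos (div_pos (by linarith) hK0) hC0'
  filter_upwards [hG.isLittleO.def hη] with z hz
  have h1 : ‖z.1 - z.2‖ ≤ C * ‖A z.1 - A z.2‖ := by
    have := hC.le_mul_dist z.1 z.2
    simpa [dist_eq_norm] using this
  rw [map_sub] at hz
  have h2 : ‖G z.1 - G z.2 - (A z.1 - A z.2)‖ ≤ (K - 1) / K * ‖A z.1 - A z.2‖ := by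
    refine hz.trans ?_
    calc (K - 1) / K / C * ‖z.1 - z.2‖ ≤ (K - 1) / K / C * (C * ‖A z.1 - A z.2‖) := by gcongr
      _ = _ := by field_simp
  simp only [dist_eq_norm]
  have h3 := norm_sub_norm_le (G z.1 - G z.2) (A z.1 - A z.2)
  have h4 := norm_sub_norm_le (A z.1 - A z.2) (G z.1 - G z.2)
  rw [norm_sub_rev (A z.1 - A z.2)] at h4
  have h5 : (K - 1) / K = 1 - 1 / K := by field_simp
  rw [h5] at h2
  have hN := norm_nonneg (A z.1 - A z.2)
  have h6 : (1 : ℝ) - 1 / K ≤ K - 1 := by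
    rw [← h5, div_le_iff₀ hK0]; nlinarith
  constructor
  · nlinarith
  · have : ‖A z.1 - A z.2‖ * (1 / K) ≤ ‖G z.1 - G z.2‖ := by nlinarith
    rw [mul_one_div, div_le_iff₀ hK0] at this
    linarith

/-- For a linear map the area formula is exact. Comparing `G` with its differential at `u` costs `K`
to the power of the dimension, and comparing the Jacobian with its value at `u` costs one more
factor `K`. -/
theorem exists_nhds_area_comparison {G : V → W} {G' : V → V →L[ℝ] W} {u : V}
    (hG : HasStrictFDerivAt G (G' u) u) (hA : Function.Injective (G' u))
    (hc : ContinuousAt G' u) {K : NNReal} (hK : 1 < K) :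
    ∃ N ∈ 𝓝 u, ∀ s ⊆ N, MeasurableSet s →
      (μHE[Module.finrank ℝ V] : Measure W) (G '' s) ≤ (K : ENNReal) ^ (Module.finrank ℝ V + 1) *
        ∫⁻ v in s, ENNReal.ofReal (G' v : V →ₗ[ℝ] W).normDet ∧
      ∫⁻ v in s, ENNReal.ofReal (G' v : V →ₗ[ℝ] W).normDet ≤
        (K : ENNReal) ^ (Module.finrank ℝ V + 1) *
          (μHE[Module.finrank ℝ V] : Measure W) (G '' s) := by
  set A := G' u with hAdef
  set J : ℝ := (A : V →ₗ[ℝ] W).normDet with hJ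
  have hJ0 : 0 < J := normDet_pos_of_injective hA
  have hK0 : (0 : ℝ) < K := by have : (1 : ℝ) < K := hK; linarith
  have hK1 : (1 : ℝ) < K := hK
  have h1 := eventually_dist_le_mul_of_hasStrictFDerivAt hG hA hK1
  rw [nhds_prod_eq, eventually_prod_self_iff'] at h1
  obtain ⟨N₁, hN₁, h1⟩ := h1
  have hcJ : ContinuousAt (fun v => (G' v : V →ₗ[ℝ] W).normDet) u :=
    continuous_normDet.continuousAt.comp hc
  have h2 : ∀ᶠ v in 𝓝 u, (G' v : V →ₗ[ℝ] W).normDet < K * J ∧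
      J / K < (G' v : V →ₗ[ℝ] W).normDet := by
    refine (hcJ.eventually_lt_const ?_).and (hcJ.eventually_const_lt ?_)
    · show J < K * J
      nlinarith
    · show J / K < J
      exact div_lt_self hJ0 hK1
  refine ⟨N₁ ∩ {v | _}, inter_mem hN₁ h2, fun s hs hsm => ?_⟩
  have hlin : (μHE[Module.finrank ℝ V] : Measure W) (A '' s) = ENNReal.ofReal J * volume s :=
    LinearMap.euclideanHausdorffMeasure_image_eq_normDet_mul_volume (A : V →ₗ[ℝ] W) s
  have hKK : ENNReal.ofReal (K : ℝ) = K := ENNReal.ofReal_coe_nnreal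
  constructor
  · have ha : (μHE[Module.finrank ℝ V] : Measure W) (G '' s) ≤ (K : ENNReal) ^ _ *
        (μHE[Module.finrank ℝ V] : Measure W) (A '' s) :=
      euclideanHausdorffMeasure_image_le_of_dist_le _ fun x hx y hy =>
        (h1 x (hs hx).1 y (hs hy).1).1
    have hb : ENNReal.ofReal J * volume s ≤
        K * ∫⁻ v in s, ENNReal.ofReal (G' v : V →ₗ[ℝ] W).normDet := by
      rw [← setLIntegral_const, ← lintegral_const_mul' _ _ ENNReal.coe_ne_top]
      refine setLIntegral_mono' hsm fun v hv => ?_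
      rw [← hKK, ← ENNReal.ofReal_mul hK0.le]
      refine ENNReal.ofReal_le_ofReal ?_
      have := (hs hv).2.2
      rw [div_lt_iff₀ hK0] at this
      linarith
    rw [hlin] at ha
    calc _ ≤ _ := ha
      _ ≤ (K : ENNReal) ^ _ * (K * ∫⁻ v in s, ENNReal.ofReal (G' v : V →ₗ[ℝ] W).normDet) := by
        gcongr
      _ = _ := by rw [← mul_assoc, pow_succ]
  · have ha : (μHE[Module.finrank ℝ V] : Measure W) (A '' s) ≤ (K : ENNReal) ^ _ *
        (μHE[Module.finrank ℝ V] : Measure W) (G '' s) :=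
      euclideanHausdorffMeasure_image_le_of_dist_le _ fun x hx y hy =>
        (h1 x (hs hx).1 y (hs hy).1).2
    have hb : ∫⁻ v in s, ENNReal.ofReal (G' v : V →ₗ[ℝ] W).normDet ≤
        K * (ENNReal.ofReal J * volume s) := by
      rw [← setLIntegral_const, ← lintegral_const_mul' _ _ ENNReal.coe_ne_top]
      refine setLIntegral_mono' hsm fun v hv => ?_
      rw [← hKK, ← ENNReal.ofReal_mul hK0.le]
      exact ENNReal.ofReal_le_ofReal (hs hv).2.1.le
    rw [hlin] at ha
    calc _ ≤ _ := hb
      _ ≤ K * ((K : ENNReal) ^ Module.finrank ℝ V *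
          (μHE[Module.finrank ℝ V] : Measure W) (G '' s)) := by gcongr
      _ = _ := by rw [← mul_assoc, pow_succ']

/-- The area formula for an injective immersion defined on an open set. -/
theorem euclideanHausdorffMeasure_image_eq_lintegral_normDet [CompleteSpace W]
    {G : V → W} {G' : V → V →L[ℝ] W} {U s : Set V} (hU : IsOpen U)
    (hG : ∀ u ∈ U, HasFDerivAt G (G' u) u) (hc : ContinuousOn G' U)
    (hinj : ∀ u ∈ U, Function.Injective (G' u)) (hsU : s ⊆ U) (hs : MeasurableSet s)
    (hGs : InjOn G s) :
    (μHE[Module.finrank ℝ V] : Measure W) (G '' s) =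
      ∫⁻ v in s, ENNReal.ofReal (G' v : V →ₗ[ℝ] W).normDet := by
  have hGc : ContinuousOn G U := fun u hu => (hG u hu).continuousAt.continuousWithinAt
  -- Both inequalities are countably additive: a Lindelöf cover by good neighbourhoods is made
  -- disjoint, and injectivity keeps the images disjoint. Afterwards `K` tends to `1`.
  have key : ∀ K : NNReal, 1 < K →
      (μHE[Module.finrank ℝ V] : Measure W) (G '' s) ≤ (K : ENNReal) ^ (Module.finrank ℝ V + 1) *
        ∫⁻ v in s, ENNReal.ofReal (G' v : V →ₗ[ℝ] W).normDet ∧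
      ∫⁻ v in s, ENNReal.ofReal (G' v : V →ₗ[ℝ] W).normDet ≤
        (K : ENNReal) ^ (Module.finrank ℝ V + 1) *
          (μHE[Module.finrank ℝ V] : Measure W) (G '' s) := by
    intro K hK
    have hstrict : ∀ u ∈ U, HasStrictFDerivAt G (G' u) u := fun u hu =>
      hasStrictFDerivAt_of_hasFDerivAt_of_continuousAt
        (Filter.eventually_of_mem (hU.mem_nhds hu) hG) (hc.continuousAt (hU.mem_nhds hu))
    have hloc : ∀ u : U, ∃ N : Set V, IsOpen N ∧ u.1 ∈ N ∧ ∀ t ⊆ N, MeasurableSet t →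
        (μHE[Module.finrank ℝ V] : Measure W) (G '' t) ≤
          (K : ENNReal) ^ (Module.finrank ℝ V + 1) *
            ∫⁻ v in t, ENNReal.ofReal (G' v : V →ₗ[ℝ] W).normDet ∧
        ∫⁻ v in t, ENNReal.ofReal (G' v : V →ₗ[ℝ] W).normDet ≤
          (K : ENNReal) ^ (Module.finrank ℝ V + 1) *
            (μHE[Module.finrank ℝ V] : Measure W) (G '' t) := by
      rintro ⟨u, hu⟩
      obtain ⟨N, hN, h⟩ := exists_nhds_area_comparison (hstrict u hu) (hinj u hu)
        (hc.continuousAt (hU.mem_nhds hu)) hK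
      obtain ⟨N', hN', hN'o, huN'⟩ := mem_nhds_iff.1 hN
      exact ⟨N', hN'o, huN', fun t ht => h t (ht.trans hN')⟩
    choose N hNo huN hN using hloc
    obtain ⟨T, hTc, hT⟩ := TopologicalSpace.isOpen_iUnion_countable N hNo
    rcases T.eq_empty_or_nonempty with hTe | hTne
    · have hse : s = ∅ := by
        rw [eq_empty_iff_forall_notMem]
        intro u hu
        have : u ∈ ⋃ i, N i := mem_iUnion.2 ⟨⟨u, hsU hu⟩, huN _⟩
        rw [← hT, hTe] at this
        simp at this
      simp [hse]
    obtain ⟨e, he⟩ := hTc.exists_eq_range hTne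
    set D : ℕ → Set V := fun n => s ∩ disjointed (fun n => N (e n)) n with hD
    have hDm : ∀ n, MeasurableSet (D n) := fun n =>
      hs.inter (MeasurableSet.disjointed (fun n => (hNo _).measurableSet) n)
    have hDN : ∀ n, D n ⊆ N (e n) := fun n =>
      inter_subset_right.trans (disjointed_subset _ n)
    have hDdisj : Pairwise (Function.onFun Disjoint D) := fun i j hij =>
      (disjoint_disjointed (fun n => N (e n)) hij).mono inter_subset_right inter_subset_right
    have hDU : ⋃ n, D n = s := by
      rw [← inter_iUnion, iUnion_disjointed]
      refine inter_eq_left.2 fun u hu => ?_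
      have : u ∈ ⋃ i, N i := mem_iUnion.2 ⟨⟨u, hsU hu⟩, huN _⟩
      rw [← hT, he, biUnion_range] at this
      exact this
    have himg : (μHE[Module.finrank ℝ V] : Measure W) (G '' s) =
        ∑' n, (μHE[Module.finrank ℝ V] : Measure W) (G '' (D n)) := by
      conv_lhs => rw [← hDU, image_iUnion]
      refine measure_iUnion ?_ ?_
      · intro i j hij
        exact (disjoint_image_image fun x hx y hy hxy => (hDdisj hij).ne_of_mem hx hy
          (hGs hx.1 hy.1 hxy))
      · exact fun n => (hDm n).image_of_continuousOn_injOn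
          (hGc.mono (inter_subset_left.trans hsU)) (hGs.mono inter_subset_left)
    have hint : ∫⁻ v in s, ENNReal.ofReal (G' v : V →ₗ[ℝ] W).normDet =
        ∑' n, ∫⁻ v in D n, ENNReal.ofReal (G' v : V →ₗ[ℝ] W).normDet := by
      conv_lhs => rw [← hDU]
      exact lintegral_iUnion hDm hDdisj _
    rw [himg, hint, ← ENNReal.tsum_mul_left, ← ENNReal.tsum_mul_left]
    exact ⟨ENNReal.tsum_le_tsum fun n => (hN _ _ (hDN n) (hDm n)).1,
      ENNReal.tsum_le_tsum fun n => (hN _ _ (hDN n) (hDm n)).2⟩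
  have hlim : ∀ x : ENNReal, Tendsto (fun K : NNReal => (K : ENNReal) ^ (Module.finrank ℝ V + 1) * x)
      (𝓝[>] 1) (𝓝 x) := by
    intro x
    have h1 : Tendsto (fun K : NNReal => (K : ENNReal) ^ (Module.finrank ℝ V + 1)) (𝓝[>] 1)
        (𝓝 1) := by
      have : Continuous fun K : NNReal => (K : ENNReal) ^ (Module.finrank ℝ V + 1) := by
        exact_mod_cast ENNReal.continuous_coe.comp (continuous_pow (Module.finrank ℝ V + 1))
      have h := this.tendsto 1
      simp only [ENNReal.coe_one, one_pow] at h
      exact h.mono_left nhdsWithin_le_nhds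
    have := ENNReal.Tendsto.mul_const (b := x) h1 (Or.inl one_ne_zero)
    rwa [one_mul] at this
  have : (𝓝[>] (1 : NNReal)).NeBot := nhdsGT_neBot 1
  exact le_antisymm
    (ge_of_tendsto (hlim _) (eventually_nhdsWithin_of_forall fun K hK => (key K hK).1))
    (ge_of_tendsto (hlim _) (eventually_nhdsWithin_of_forall fun K hK => (key K hK).2))

end AreaFormula


/-! ### The divergence theorem on a half-plane -/

/-- The point of the Euclidean plane with given coordinates. -/
def planePoint : ℝ × ℝ →L[ℝ] E2 :=
  (ContinuousLinearMap.fst ℝ ℝ ℝ).smulRight (EuclideanSpace.single 0 1) +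
    (ContinuousLinearMap.snd ℝ ℝ ℝ).smulRight (EuclideanSpace.single 1 1)

theorem planePoint_apply (p : ℝ × ℝ) : planePoint p = !₂[p.1, p.2] := by
  ext i
  fin_cases i <;> simp [planePoint]

theorem planePoint_eq : (planePoint : ℝ × ℝ → E2) =
    (MeasurableEquiv.finTwoArrow.symm.trans (MeasurableEquiv.toLp 2 (Fin 2 → ℝ))) := by
  funext p
  ext i
  fin_cases i <;> simp [planePoint_apply]

theorem measurePreserving_planePoint : MeasurePreserving planePoint := by
  rw [planePoint_eq]
  exact (EuclideanSpace.volume_preserving_symm_measurableEquiv_toLp (Fin 2)).symm.comp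
    ((volume_preserving_finTwoArrow ℝ).symm)

theorem measurableEmbedding_planePoint : MeasurableEmbedding planePoint := by
  rw [planePoint_eq]
  exact MeasurableEquiv.measurableEmbedding _

/-- The divergence theorem on the half-plane `0 ≤ u 0` for compactly supported fields. -/
theorem integral_halfPlane_divergence {w₀ w₁ d : E2 → ℝ} {K : Set E2} (hK : IsCompact K)
    (hc₀ : ContinuousOn w₀ {u | 0 ≤ u 0}) (hc₁ : ContinuousOn w₁ {u | 0 ≤ u 0})
    (hd₀ : ∀ u : E2, 0 < u 0 → DifferentiableAt ℝ w₀ u)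
    (hd₁ : ∀ u : E2, 0 < u 0 → DifferentiableAt ℝ w₁ u)
    (hd : ∀ u : E2, 0 < u 0 → d u = fderiv ℝ w₀ u (EuclideanSpace.single 0 1) +
      fderiv ℝ w₁ u (EuclideanSpace.single 1 1))
    (hi : IntegrableOn d {u | 0 ≤ u 0})
    (hw₀ : ∀ u ∉ K, w₀ u = 0) (hw₁ : ∀ u ∉ K, w₁ u = 0) :
    ∫ u in {u : E2 | 0 ≤ u 0}, d u = - ∫ t : ℝ, w₀ !₂[0, t] := by
  classical
  obtain ⟨R, hR0, hR⟩ := hK.isBounded.exists_pos_norm_lt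
  have hKx : ∀ x y : ℝ, R ≤ |x| ∨ R ≤ |y| → planePoint (x, y) ∉ K := by
    intro x y h hmem
    have h1 := hR _ hmem
    have hx : |x| ≤ ‖planePoint (x, y)‖ := by
      simpa [planePoint_apply] using PiLp.norm_apply_le (planePoint (x, y)) 0
    have hy : |y| ≤ ‖planePoint (x, y)‖ := by
      simpa [planePoint_apply] using PiLp.norm_apply_le (planePoint (x, y)) 1
    rcases h with h | h <;> linarith
  have hfd : ∀ {w : E2 → ℝ}, (∀ u ∉ K, w u = 0) → ∀ u ∉ K, fderiv ℝ w u = 0 := by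
    intro w hw u hu
    have : w =ᶠ[𝓝 u] fun _ => 0 :=
      Filter.eventually_of_mem (hK.isClosed.isOpen_compl.mem_nhds hu) hw
    rw [this.fderiv_eq, fderiv_fun_const]; rfl
  -- Derivatives are available only where the first coordinate is positive, so they are replaced by
  -- zero elsewhere; on the closed half-plane this changes the integrand only on a null line.
  set D : ℝ × ℝ → ℝ := fun p => if 0 < p.1 then d (planePoint p) else 0 with hD
  set f' : ℝ × ℝ → ℝ × ℝ →L[ℝ] ℝ := fun p =>
    if 0 < p.1 then (fderiv ℝ w₀ (planePoint p)) ∘L planePoint else 0 with hf'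
  set g' : ℝ × ℝ → ℝ × ℝ →L[ℝ] ℝ := fun p =>
    if 0 < p.1 then (fderiv ℝ w₁ (planePoint p)) ∘L planePoint else 0 with hg'
  have e0 : planePoint (1, 0) = EuclideanSpace.single 0 1 := by
    ext i; fin_cases i <;> simp [planePoint]
  have e1 : planePoint (0, 1) = EuclideanSpace.single 1 1 := by
    ext i; fin_cases i <;> simp [planePoint]
  have hcoord : ∀ p : ℝ × ℝ, planePoint p 0 = p.1 := fun p => by simp [planePoint_apply]
  have hDf : ∀ p, f' p (1, 0) + g' p (0, 1) = D p := by
    intro p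
    by_cases hp : 0 < p.1
    · simp only [hf', hg', hD, hp, if_true, ContinuousLinearMap.comp_apply, e0, e1]
      exact (hd _ (by rwa [hcoord])).symm
    · simp [hf', hg', hD, hp]
  have hpre : planePoint ⁻¹' {u | 0 ≤ u 0} = {p : ℝ × ℝ | 0 ≤ p.1} := by
    ext p; simp [planePoint_apply]
  have hmeas : MeasurableSet {p : ℝ × ℝ | 0 ≤ p.1} := measurableSet_le measurable_const measurable_fst
  have hDae : ∀ᵐ p ∂(volume.restrict {p : ℝ × ℝ | 0 ≤ p.1}), d (planePoint p) = D p := by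
    have hnull : (volume : Measure (ℝ × ℝ)) {p | p.1 = 0} = 0 := by
      have : {p : ℝ × ℝ | p.1 = 0} = {0} ×ˢ univ := by ext p; simp
      rw [this, Measure.volume_eq_prod, Measure.prod_prod]
      simp
    have hne : ∀ᵐ p : ℝ × ℝ, p.1 ≠ 0 := by
      rw [ae_iff]; simpa using hnull
    filter_upwards [ae_restrict_mem hmeas, ae_restrict_of_ae hne] with p hp hp'
    have : 0 < p.1 := lt_of_le_of_ne hp (Ne.symm hp')
    simp [hD, this]
  have hID : IntegrableOn D {p : ℝ × ℝ | 0 ≤ p.1} := by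
    have h1 : IntegrableOn (d ∘ planePoint) (planePoint ⁻¹' {u | 0 ≤ u 0}) :=
      (measurePreserving_planePoint.integrableOn_comp_preimage
        measurableEmbedding_planePoint).2 hi
    rw [hpre] at h1
    exact Integrable.congr h1 hDae
  have hle : ((0 : ℝ), -R) ≤ (R, R) := ⟨hR0.le, by linarith [hR0]⟩
  have hsub : Icc ((0 : ℝ), -R) (R, R) ⊆ {p : ℝ × ℝ | 0 ≤ p.1} := fun p hp => hp.1.1
  have hmaps : MapsTo planePoint (Icc ((0 : ℝ), -R) (R, R)) {u | 0 ≤ u 0} := by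
    intro p hp
    show 0 ≤ planePoint p 0
    rw [hcoord]; exact hsub hp
  have hdiff : ∀ {w : E2 → ℝ}, (∀ u : E2, 0 < u 0 → DifferentiableAt ℝ w u) →
      ∀ p : ℝ × ℝ, 0 < p.1 → HasFDerivAt (w ∘ planePoint)
        ((fderiv ℝ w (planePoint p)) ∘L planePoint) p := by
    intro w hw p hp
    exact ((hw (planePoint p) (by rwa [hcoord])).hasFDerivAt).comp p planePoint.hasFDerivAt
  -- On the rectangle `[0, R] × [-R, R]` three edges miss `K`. The remaining edge lies on the
  -- boundary line and enters with a minus sign, its outward normal being the negative first basis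
  -- vector.
  have key := integral_divergence_prod_Icc_of_hasFDerivAt_of_le (w₀ ∘ planePoint)
    (w₁ ∘ planePoint) f' g' ((0 : ℝ), -R) (R, R) hle
    (hc₀.comp planePoint.continuous.continuousOn hmaps)
    (hc₁.comp planePoint.continuous.continuousOn hmaps)
    (fun p hp => by
      have hp1 : 0 < p.1 := hp.1.1
      simpa only [hf', hp1, if_true] using hdiff hd₀ p hp1)
    (fun p hp => by
      have hp1 : 0 < p.1 := hp.1.1
      simpa only [hg', hp1, if_true] using hdiff hd₁ p hp1)
    (by simp_rw [hDf]; exact hID.mono_set hsub)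
  simp_rw [hDf] at key
  have z1 : ∀ x : ℝ, (w₁ ∘ planePoint) (x, R) = 0 := fun x =>
    hw₁ _ (hKx x R (Or.inr (le_abs_self R)))
  have z2 : ∀ x : ℝ, (w₁ ∘ planePoint) (x, -R) = 0 := fun x =>
    hw₁ _ (hKx x (-R) (Or.inr (by rw [abs_neg]; exact le_abs_self R)))
  have z3 : ∀ y : ℝ, (w₀ ∘ planePoint) (R, y) = 0 := fun y =>
    hw₀ _ (hKx R y (Or.inl (le_abs_self R)))
  simp only [z1, z2, z3, intervalIntegral.integral_zero, sub_zero, zero_add, zero_sub] at key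
  have hbd : ∫ y in (-R)..R, (w₀ ∘ planePoint) (0, y) = ∫ t : ℝ, w₀ !₂[0, t] := by
    rw [intervalIntegral.integral_eq_integral_of_support_subset]
    · simp [planePoint_apply]
    · intro y hy
      by_contra hcon
      refine hy (hw₀ _ (hKx 0 y (Or.inr ?_)))
      rw [mem_Ioc, not_and_or, not_lt, not_le] at hcon
      rcases hcon with h | h
      · rw [abs_of_nonpos (by linarith)]; linarith
      · exact h.le.trans (le_abs_self y)
  rw [hbd] at key
  rw [← key, ← measurePreserving_planePoint.setIntegral_preimage_emb
    measurableEmbedding_planePoint, hpre, integral_congr_ae hDae]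
  refine setIntegral_eq_of_subset_of_forall_sdiff_eq_zero hmeas hsub ?_
  intro p hp
  by_cases hp1 : 0 < p.1
  · have hpK : planePoint p ∉ K := by
      refine hKx p.1 p.2 ?_
      by_contra hcon
      push Not at hcon
      refine hp.2 ⟨⟨hp1.le, ?_⟩, ⟨?_, ?_⟩⟩
      · exact (abs_lt.1 hcon.2).1.le
      · exact (abs_lt.1 hcon.1).2.le
      · exact (abs_lt.1 hcon.2).2.le
    have h1 := hd (planePoint p) (by rwa [hcoord])
    rw [hfd hw₀ _ hpK, hfd hw₁ _ hpK] at h1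
    simpa [hD, hp1] using h1
  · simp [hD, hp1]

/-! ### Polar coordinates -/

theorem integrableOn_of_continuous_of_eq_zero {k : ℝ × ℝ → ℝ} (hk : Continuous k) {R : ℝ}
    (h : ∀ p : ℝ × ℝ, R < p.1 → k p = 0) :
    IntegrableOn k (Ioi (0 : ℝ) ×ˢ Ioo (-Real.pi) Real.pi) := by
  have h1 : IntegrableOn k (Icc 0 R ×ˢ Icc (-Real.pi) Real.pi) :=
    hk.continuousOn.integrableOn_compact (isCompact_Icc.prod isCompact_Icc)
  refine h1.of_forall_sdiff_eq_zero (measurableSet_Ioi.prod measurableSet_Ioo) ?_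
  rintro ⟨r, φ⟩ ⟨⟨hr, hφ⟩, hn⟩
  refine h _ ?_
  by_contra hcon
  exact hn ⟨⟨le_of_lt hr, not_lt.1 hcon⟩, Ioo_subset_Icc_self hφ⟩

/-- The point of the unit circle with angle `φ`. -/
def circlePoint (φ : ℝ) : ℂ := Real.cos φ + Real.sin φ * Complex.I

theorem norm_circlePoint (φ : ℝ) : ‖circlePoint φ‖ = 1 := by
  rw [circlePoint, Complex.ofReal_cos, Complex.ofReal_sin]
  exact Complex.norm_cos_add_sin_mul_I φ

theorem continuous_circlePoint : Continuous circlePoint := by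
  unfold circlePoint
  fun_prop

theorem hasDerivAt_circlePoint (φ : ℝ) :
    HasDerivAt circlePoint (Complex.I * circlePoint φ) φ := by
  have h1 : HasDerivAt (fun φ : ℝ => (Real.cos φ : ℂ)) (-(Real.sin φ : ℂ)) φ := by
    simpa using (Real.hasDerivAt_cos φ).ofReal_comp
  have h2 : HasDerivAt (fun φ : ℝ => (Real.sin φ : ℂ)) (Real.cos φ : ℂ) φ :=
    (Real.hasDerivAt_sin φ).ofReal_comp
  have := h1.add (h2.mul_const Complex.I)
  convert! this using 1
  unfold circlePoint
  linear_combination (Real.sin φ : ℂ) * Complex.I_mul_I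

theorem exists_radius_fderiv_eq_zero {f : ℂ → ℝ} (hf' : HasCompactSupport f) (w : ℂ) :
    ∃ R, ∀ z, R < ‖z - w‖ → f z = 0 ∧ fderiv ℝ f z = 0 := by
  obtain ⟨R, hR⟩ := hf'.isCompact.isBounded.subset_closedBall w
  refine ⟨R, fun z hz => ?_⟩
  have hzt : z ∉ tsupport f := fun hmem => by
    have := hR hmem
    rw [mem_closedBall_iff_norm] at this
    linarith
  exact ⟨image_eq_zero_of_notMem_tsupport hzt,
    image_eq_zero_of_notMem_tsupport fun h => hzt (tsupport_fderiv_subset ℝ h)⟩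

/-- The Jacobian `r` and the factor `r` of `z - w` together cancel the singular denominator. The
value `c = 1` gives the radial derivative, `c = I` the angular one. -/
theorem integral_fderiv_mul_eq_polar {f : ℂ → ℝ} (w c : ℂ) :
    ∫ z, fderiv ℝ f z (c * (z - w)) / ‖z - w‖ ^ 2 =
      ∫ p in Ioi (0 : ℝ) ×ˢ Ioo (-Real.pi) Real.pi,
        fderiv ℝ f (p.1 * circlePoint p.2 + w) (c * circlePoint p.2) := by
  have h1 : ∫ z, fderiv ℝ f z (c * (z - w)) / ‖z - w‖ ^ 2 =
      ∫ z, fderiv ℝ f (z + w) (c * z) / ‖z‖ ^ 2 := by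
    rw [← integral_add_right_eq_self _ w]
    simp
  rw [h1, ← Complex.integral_comp_polarCoord_symm]
  refine setIntegral_congr_fun (measurableSet_Ioi.prod measurableSet_Ioo) ?_
  rintro ⟨r, φ⟩ ⟨hr, -⟩
  have hr' : (0 : ℝ) < r := hr
  have h2 : Complex.polarCoord.symm (r, φ) = r * circlePoint φ := by
    rw [Complex.polarCoord_symm_apply]; rfl
  have h3 : c * (r * circlePoint φ) = r • (c * circlePoint φ) := by
    rw [Complex.real_smul]; ring
  simp only [h2, h3, map_smul, norm_mul, norm_circlePoint, smul_eq_mul, Complex.norm_real,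
    Real.norm_eq_abs, abs_of_pos hr']
  field_simp

/-- On each ray from `w` the integrand is the derivative of `f` along the ray and integrates to `-f
w`; the `2π` comes from the rays. -/
theorem integral_fderiv_radial {f : ℂ → ℝ} (hf : ContDiff ℝ 1 f) (hf' : HasCompactSupport f)
    (w : ℂ) : ∫ z, fderiv ℝ f z (z - w) / ‖z - w‖ ^ 2 = -(2 * Real.pi) * f w := by
  obtain ⟨R, hR⟩ := exists_radius_fderiv_eq_zero hf' w
  have h0 := integral_fderiv_mul_eq_polar (f := f) w 1
  simp only [one_mul] at h0
  rw [h0]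
  have hk : Continuous fun p : ℝ × ℝ => fderiv ℝ f (p.1 * circlePoint p.2 + w)
      (circlePoint p.2) := by
    have := hf.continuous_fderiv one_ne_zero
    have hc := continuous_circlePoint
    fun_prop
  have hint := integrableOn_of_continuous_of_eq_zero hk (R := |R|) (fun p hp => by
    rw [(hR _ _).2]
    · rfl
    · simp only [add_sub_cancel_right, norm_mul, norm_circlePoint, Complex.norm_real, mul_one,
        Real.norm_eq_abs]
      exact (le_abs_self R).trans_lt (hp.trans_le (le_abs_self _)))
  rw [IntegrableOn, Measure.volume_eq_prod, ← Measure.prod_restrict] at hint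
  rw [Measure.volume_eq_prod, ← Measure.prod_restrict, integral_prod_symm _ hint]
  have hinner : ∀ φ : ℝ, ∫ r in Ioi (0 : ℝ), fderiv ℝ f (r * circlePoint φ + w)
      (circlePoint φ) = - f w := by
    intro φ
    set h : ℝ → ℝ := fun r => f (r * circlePoint φ + w) with hh
    have hlin : ContDiff ℝ 1 fun r : ℝ => (r : ℂ) * circlePoint φ + w := by
      have : ContDiff ℝ 1 fun r : ℝ => (r : ℂ) := Complex.ofRealCLM.contDiff
      fun_prop
    have hder : ∀ r : ℝ, deriv h r = fderiv ℝ f (r * circlePoint φ + w) (circlePoint φ) := by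
      intro r
      have h1 : HasDerivAt (fun r : ℝ => (r : ℂ) * circlePoint φ + w) (circlePoint φ) r := by
        have := ((Complex.ofRealCLM.hasDerivAt (x := r)).mul_const (circlePoint φ)).add_const w
        simpa using this
      exact (((hf.differentiable one_ne_zero) _).hasFDerivAt.comp_hasDerivAt r h1).deriv
    have hcs : HasCompactSupport h := by
      refine HasCompactSupport.intro (isCompact_Icc (a := -|R|) (b := |R|)) fun r hr => ?_
      refine (hR _ ?_).1
      simp only [add_sub_cancel_right, norm_mul, norm_circlePoint, Complex.norm_real, mul_one,
        Real.norm_eq_abs]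
      rw [mem_Icc, ← abs_le, not_le] at hr
      exact (le_abs_self R).trans_lt hr
    have := HasCompactSupport.integral_Ioi_deriv_eq (hf.comp hlin) hcs 0
    change ∫ r in Ioi (0 : ℝ), deriv h r = - h 0 at this
    simp only [hder] at this
    simpa [hh] using this
  simp only [hinner]
  rw [integral_const]
  simp only [MeasurableSet.univ, measureReal_restrict_apply, univ_inter, Real.volume_real_Ioo,
    smul_eq_mul]
  rw [max_eq_left (by linarith [Real.pi_pos])]
  ring

/-- On each circle about `w` the integrand is `r⁻¹` times the angular derivative of a periodic
function. -/
theorem integral_fderiv_angular {f : ℂ → ℝ} (hf : ContDiff ℝ 1 f) (hf' : HasCompactSupport f)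
    (w : ℂ) : ∫ z, fderiv ℝ f z (Complex.I * (z - w)) / ‖z - w‖ ^ 2 = 0 := by
  obtain ⟨R, hR⟩ := exists_radius_fderiv_eq_zero hf' w
  rw [integral_fderiv_mul_eq_polar (f := f) w Complex.I]
  have hk : Continuous fun p : ℝ × ℝ => fderiv ℝ f (p.1 * circlePoint p.2 + w)
      (Complex.I * circlePoint p.2) := by
    have := hf.continuous_fderiv one_ne_zero
    have hc := continuous_circlePoint
    fun_prop
  have hint := integrableOn_of_continuous_of_eq_zero hk (R := |R|) (fun p hp => by
    rw [(hR _ _).2]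
    · rfl
    · simp only [add_sub_cancel_right, norm_mul, norm_circlePoint, Complex.norm_real, mul_one,
        Real.norm_eq_abs]
      exact (le_abs_self R).trans_lt (hp.trans_le (le_abs_self _)))
  rw [IntegrableOn, Measure.volume_eq_prod, ← Measure.prod_restrict] at hint
  rw [Measure.volume_eq_prod, ← Measure.prod_restrict, integral_prod _ hint]
  refine setIntegral_eq_zero_of_forall_eq_zero fun r hr => ?_
  have hr' : (0 : ℝ) < r := hr
  have hder : ∀ φ : ℝ, HasDerivAt (fun φ : ℝ => r⁻¹ * f (r * circlePoint φ + w))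
      (fderiv ℝ f (r * circlePoint φ + w) (Complex.I * circlePoint φ)) φ := by
    intro φ
    have h1 : HasDerivAt (fun φ : ℝ => (r : ℂ) * circlePoint φ + w)
        (r * (Complex.I * circlePoint φ)) φ :=
      ((hasDerivAt_circlePoint φ).const_mul (r : ℂ)).add_const w
    have h2 := (((hf.differentiable one_ne_zero) _).hasFDerivAt.comp_hasDerivAt φ h1).const_mul r⁻¹
    convert! h2 using 1
    have h3 : (r : ℂ) * (Complex.I * circlePoint φ) = r • (Complex.I * circlePoint φ) :=
      (Complex.real_smul).symm
    rw [h3, map_smul, smul_eq_mul]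
    field_simp
  have hπ : -Real.pi ≤ Real.pi := by linarith [Real.pi_pos]
  show ∫ φ in Ioo (-Real.pi) Real.pi, fderiv ℝ f (r * circlePoint φ + w)
    (Complex.I * circlePoint φ) = 0
  rw [← integral_Ioc_eq_integral_Ioo, ← intervalIntegral.integral_of_le hπ,
    intervalIntegral.integral_eq_sub_of_hasDerivAt (fun φ _ => hder φ)
      ((hk.comp (Continuous.prodMk_right r)).intervalIntegrable _ _)]
  simp [circlePoint]

/-! ### The kernel `1 / |z|` in the plane -/

theorem lintegral_inv_norm_ball_lt_top :
    ∫⁻ z in Metric.ball (0 : ℂ) 1, ENNReal.ofReal ‖z‖⁻¹ < ⊤ := by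
  have hm : Measurable fun z : ℂ => ‖z‖⁻¹ := measurable_norm.inv
  have h : IntegrableOn (fun z : ℂ => ‖z‖⁻¹) (Metric.ball 0 1) := by
    refine integrableOn_ball_of_norm_le_rpow (C := 1) (α := 1) ?_ ?_ ?_ hm.aestronglyMeasurable
    · rw [Complex.finrank_real_complex]; norm_num
    · rw [Complex.finrank_real_complex]; norm_num
    · refine Filter.Eventually.of_forall fun z => ?_
      rw [Real.rpow_neg_one, one_mul, norm_inv, norm_norm]
  have := h.2
  rw [hasFiniteIntegral_iff_norm] at this
  simpa [norm_inv] using this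

/-- Splitting at distance one from `w` gives a bound that does not depend on `w`. This uniformity
makes the Cauchy kernel integrable against the product with any finite measure on the curves. -/
theorem lintegral_inv_norm_sub_le (A : Set ℂ) (w : ℂ) :
    ∫⁻ z in A, ENNReal.ofReal ‖z - w‖⁻¹ ≤
      (∫⁻ z in Metric.ball (0 : ℂ) 1, ENNReal.ofReal ‖z‖⁻¹) + volume A := by
  have h1 : ∀ z : ℂ, ENNReal.ofReal ‖z - w‖⁻¹ ≤
      (Metric.ball (0 : ℂ) 1).indicator (fun z => ENNReal.ofReal ‖z‖⁻¹) (z - w) + 1 := by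
    intro z
    by_cases hz : z - w ∈ Metric.ball (0 : ℂ) 1
    · rw [indicator_of_mem hz]; exact le_self_add
    · rw [indicator_of_notMem hz, zero_add]
      rw [mem_ball_zero_iff, not_lt] at hz
      exact ENNReal.ofReal_le_one.2 (inv_le_one_of_one_le₀ hz)
  calc ∫⁻ z in A, ENNReal.ofReal ‖z - w‖⁻¹
      ≤ ∫⁻ z in A, ((Metric.ball (0 : ℂ) 1).indicator (fun z => ENNReal.ofReal ‖z‖⁻¹) (z - w) + 1) :=
        lintegral_mono fun z => h1 z
    _ = (∫⁻ z in A, (Metric.ball (0 : ℂ) 1).indicator (fun z => ENNReal.ofReal ‖z‖⁻¹) (z - w)) +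
        volume A := by
        rw [lintegral_add_right _ measurable_const]; simp
    _ ≤ (∫⁻ z, (Metric.ball (0 : ℂ) 1).indicator (fun z => ENNReal.ofReal ‖z‖⁻¹) (z - w)) +
        volume A := by gcongr; exact Measure.restrict_le_self
    _ = _ := by
        rw [lintegral_sub_right_eq_self (fun z => (Metric.ball (0 : ℂ) 1).indicator
          (fun z => ENNReal.ofReal ‖z‖⁻¹) z) w, lintegral_indicator measurableSet_ball]


/-! ### Capillary immersions in charts -/

theorem range_halfPlaneModel : range (𝓡∂ 2) = {u : E2 | 0 ≤ u 0} :=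
  range_euclideanHalfSpace 2

theorem uniqueDiffOn_range_halfPlaneModel : UniqueDiffOn ℝ (range (𝓡∂ 2)) :=
  ModelWithCorners.uniqueDiffOn (𝓡∂ 2)

section Chart

variable {S : Type*} [TopologicalSpace S] [ChartedSpace (EuclideanHalfSpace 2) S]

/-- The expression of a map in the extended chart at `p`. -/
abbrev chartMap {W : Type*} (f : S → W) (p : S) : E2 → W := f ∘ (extChartAt (𝓡∂ 2) p).symm

/-- The image of the extended chart at `p`. -/
abbrev chartTarget (p : S) : Set E2 := (extChartAt (𝓡∂ 2) p).target

theorem exists_isOpen_chartTarget (p : S) :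
    ∃ O : Set E2, IsOpen O ∧ chartTarget p = O ∩ range (𝓡∂ 2) :=
  ⟨_, (chartAt (EuclideanHalfSpace 2) p).open_target.preimage (𝓡∂ 2).continuous_symm,
    extChartAt_target (I := 𝓡∂ 2) p⟩

theorem chartTarget_subset (p : S) : chartTarget p ⊆ range (𝓡∂ 2) :=
  extChartAt_target_subset_range p

theorem measurableSet_range_halfPlaneModel : MeasurableSet (range (𝓡∂ 2)) :=
  (𝓡∂ 2).isClosed_range.measurableSet

theorem measurableSet_chartTarget (p : S) : MeasurableSet (chartTarget p) := by
  obtain ⟨O, hO, h⟩ := exists_isOpen_chartTarget p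
  rw [h]
  exact hO.measurableSet.inter measurableSet_range_halfPlaneModel

theorem nonneg_of_mem_chartTarget {p : S} {u : E2} (hu : u ∈ chartTarget p) : 0 ≤ u 0 := by
  have := chartTarget_subset p hu
  rwa [range_halfPlaneModel] at this

theorem fderivWithin_chartTarget {W : Type*} [NormedAddCommGroup W] [NormedSpace ℝ W]
    {p : S} {u : E2} (hu : u ∈ chartTarget p) (g : E2 → W) :
    fderivWithin ℝ g (chartTarget p) u = fderivWithin ℝ g (range (𝓡∂ 2)) u := by
  obtain ⟨O, hO, h⟩ := exists_isOpen_chartTarget p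
  rw [h, inter_comm]
  rw [h] at hu
  exact fderivWithin_inter (hO.mem_nhds hu.1)

theorem isOpen_pos_chartTarget (p : S) : IsOpen {u | u ∈ chartTarget p ∧ 0 < u 0} := by
  obtain ⟨O, hO, h⟩ := exists_isOpen_chartTarget p
  have : {u | u ∈ chartTarget p ∧ 0 < u 0} = O ∩ {u : E2 | 0 < u 0} := by
    ext u
    simp only [h, range_halfPlaneModel, mem_ofPred_eq, mem_inter_iff]
    constructor
    · exact fun hu => ⟨hu.1.1, hu.2⟩
    · exact fun hu => ⟨⟨hu.1, hu.2.le⟩, hu.2⟩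
  rw [this]
  exact hO.inter (isOpen_lt continuous_const (by fun_prop))

theorem range_mem_nhds_of_pos {u : E2} (hu : 0 < u 0) : range (𝓡∂ 2) ∈ 𝓝 u := by
  rw [range_halfPlaneModel]
  have : IsOpen {u : E2 | 0 < u 0} := isOpen_lt continuous_const (by fun_prop)
  exact Filter.mem_of_superset (this.mem_nhds hu) fun v (hv : 0 < v 0) => hv.le

theorem volume_coord_zero_eq_zero : volume {u : E2 | u 0 = 0} = 0 := by
  rw [← measurePreserving_planePoint.measure_preimage_emb measurableEmbedding_planePoint]
  have : planePoint ⁻¹' {u | u 0 = 0} = {0} ×ˢ univ := by ext p; simp [planePoint_apply]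
  rw [this, Measure.volume_eq_prod, Measure.prod_prod]
  simp

variable [IsManifold (𝓡∂ 2) ∞ S]

/-- Being an interior point can be tested in any chart of the atlas, here the one at `p` instead of
the preferred chart at the point in question. -/
theorem symm_mem_boundary_iff {p : S} {u : E2} (hu : u ∈ chartTarget p) :
    (extChartAt (𝓡∂ 2) p).symm u ∈ (𝓡∂ 2).boundary S ↔ u 0 = 0 := by
  have hsrc : (extChartAt (𝓡∂ 2) p).symm u ∈ (chartAt (EuclideanHalfSpace 2) p).source := by
    have := (extChartAt (𝓡∂ 2) p).map_target hu
    rwa [extChartAt_source] at this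
  have h := (𝓡∂ 2).isInteriorPoint_iff_of_mem_atlas (n := ∞) (by simp)
    (chart_mem_atlas (EuclideanHalfSpace 2) p) hsrc
  have h1 : ((chartAt (EuclideanHalfSpace 2) p).extend (𝓡∂ 2))
      ((extChartAt (𝓡∂ 2) p).symm u) = u := (extChartAt (𝓡∂ 2) p).right_inv hu
  rw [h1] at h
  have h2 : u ∈ interior (((chartAt (EuclideanHalfSpace 2) p).extend (𝓡∂ 2)).target) ↔ 0 < u 0 := by
    constructor
    · intro hmem
      have := OpenPartialHomeomorph.interior_extend_target_subset_interior_range _ hmem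
      rwa [range_halfPlaneModel, interior_halfSpace] at this
    · intro hpos
      exact mem_interior.2 ⟨_, fun v hv => hv.1, isOpen_pos_chartTarget p, ⟨hu, hpos⟩⟩
  have h3 : (extChartAt (𝓡∂ 2) p).symm u ∈ (𝓡∂ 2).boundary S ↔
      ¬ (𝓡∂ 2).IsInteriorPoint ((extChartAt (𝓡∂ 2) p).symm u) :=
    ModelWithCorners.isBoundaryPoint_iff_not_isInteriorPoint _
  rw [h3, h, h2, not_lt]
  exact ⟨fun h => le_antisymm h (nonneg_of_mem_chartTarget hu), fun h => h.le⟩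

theorem symm_mem_interior_iff {p : S} {u : E2} (hu : u ∈ chartTarget p) :
    (extChartAt (𝓡∂ 2) p).symm u ∈ (𝓡∂ 2).interior S ↔ 0 < u 0 := by
  rw [← (𝓡∂ 2).compl_boundary, mem_compl_iff, symm_mem_boundary_iff hu]
  exact ⟨fun h => lt_of_le_of_ne (nonneg_of_mem_chartTarget hu) (Ne.symm h), fun h => h.ne'⟩

/-- The differential of the inverse of the chart at `p`. -/
def chartDifferential (p : S) (u : E2) : E2 →L[ℝ] E2 :=
  mfderivWithin 𝓘(ℝ, E2) (𝓡∂ 2) (extChartAt (𝓡∂ 2) p).symm (range (𝓡∂ 2)) u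

theorem chartDifferential_bijective {p : S} {u : E2} (hu : u ∈ chartTarget p) :
    Function.Bijective (chartDifferential p u) := by
  have : IsManifold (𝓡∂ 2) 1 S := IsManifold.of_le (n := ∞) (by norm_num)
  obtain ⟨e, he⟩ := isInvertible_mfderivWithin_extChartAt_symm (I := 𝓡∂ 2) hu
  have he' : ⇑(chartDifferential p u) = e := by
    unfold chartDifferential
    rw [← he]; rfl
  rw [he']
  exact e.bijective

theorem fderivWithin_chartMap {W : Type*} [NormedAddCommGroup W] [NormedSpace ℝ W] {f : S → W}
    {p : S} {u : E2} (hu : u ∈ chartTarget p)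
    (hf : MDifferentiableAt (𝓡∂ 2) 𝓘(ℝ, W) f ((extChartAt (𝓡∂ 2) p).symm u)) :
    fderivWithin ℝ (chartMap f p) (range (𝓡∂ 2)) u =
      (mfderiv (𝓡∂ 2) 𝓘(ℝ, W) f ((extChartAt (𝓡∂ 2) p).symm u) : E2 →L[ℝ] W) ∘L
        chartDifferential p u := by
  have : IsManifold (𝓡∂ 2) 1 S := IsManifold.of_le (n := ∞) (by norm_num)
  rw [← mfderivWithin_eq_fderivWithin]
  exact mfderiv_comp_mfderivWithin u hf (mdifferentiableWithinAt_extChartAt_symm hu)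
    (uniqueDiffOn_range_halfPlaneModel u (chartTarget_subset p hu)).uniqueMDiffWithinAt

theorem contDiffOn_chartMap {W : Type*} [NormedAddCommGroup W] [NormedSpace ℝ W] {f : S → W}
    {n : ℕ∞} (hf : ContMDiff (𝓡∂ 2) 𝓘(ℝ, W) n f) (p : S) :
    ContDiffOn ℝ n (chartMap f p) (chartTarget p) := by
  have : IsManifold (𝓡∂ 2) n S := IsManifold.of_le (n := ∞) (by exact_mod_cast le_top)
  rw [← contMDiffOn_iff_contDiffOn]
  exact hf.comp_contMDiffOn (contMDiffOn_extChartAt_symm p)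

theorem uniqueDiffOn_chartTarget (p : S) : UniqueDiffOn ℝ (chartTarget p) :=
  uniqueDiffOn_extChartAt_target p

theorem contDiffOn_fderivWithin_chartMap {W : Type*} [NormedAddCommGroup W] [NormedSpace ℝ W]
    {f : S → W} {n : ℕ} (hf : ContMDiff (𝓡∂ 2) 𝓘(ℝ, W) (n + 1 : ℕ) f) (p : S) :
    ContDiffOn ℝ n (fun u => fderivWithin ℝ (chartMap f p) (range (𝓡∂ 2)) u)
      (chartTarget p) := by
  have h := (contDiffOn_chartMap (n := (n + 1 : ℕ)) (by exact_mod_cast hf) p).fderivWithin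
    (m := n) (uniqueDiffOn_chartTarget p) (by norm_cast)
  exact h.congr fun u hu => (fderivWithin_chartTarget hu _).symm

theorem hasFDerivWithinAt_chartMap {W : Type*} [NormedAddCommGroup W] [NormedSpace ℝ W]
    {f : S → W} (hf : ContMDiff (𝓡∂ 2) 𝓘(ℝ, W) 1 f) {p : S} {u : E2} (hu : u ∈ chartTarget p) :
    HasFDerivWithinAt (chartMap f p) (fderivWithin ℝ (chartMap f p) (range (𝓡∂ 2)) u)
      (range (𝓡∂ 2)) u := by
  have h := ((contDiffOn_chartMap (n := 1) hf p).differentiableOn one_ne_zero) u hu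
  have h2 : DifferentiableWithinAt ℝ (chartMap f p) (range (𝓡∂ 2)) u :=
    h.mono_of_mem_nhdsWithin (extChartAt_target_mem_nhdsWithin_of_mem hu)
  exact h2.hasFDerivWithinAt

theorem hasFDerivAt_chartMap {W : Type*} [NormedAddCommGroup W] [NormedSpace ℝ W]
    {f : S → W} (hf : ContMDiff (𝓡∂ 2) 𝓘(ℝ, W) 1 f) {p : S} {u : E2} (hu : u ∈ chartTarget p)
    (hpos : 0 < u 0) :
    HasFDerivAt (chartMap f p) (fderivWithin ℝ (chartMap f p) (range (𝓡∂ 2)) u) u :=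
  (hasFDerivWithinAt_chartMap hf hu).hasFDerivAt (range_mem_nhds_of_pos hpos)

theorem fderivWithin_chartMap_injective {F : S → E3} (hF : ContMDiff (𝓡∂ 2) 𝓘(ℝ, E3) 1 F)
    (hi : ∀ p, Function.Injective (differential F p)) {p : S} {u : E2} (hu : u ∈ chartTarget p) :
    Function.Injective (fderivWithin ℝ (chartMap F p) (range (𝓡∂ 2)) u) := by
  rw [fderivWithin_chartMap hu (hF.mdifferentiableAt one_ne_zero)]
  exact (hi _).comp (chartDifferential_bijective hu).1

theorem range_fderivWithin_chartMap {F : S → E3} (hF : ContMDiff (𝓡∂ 2) 𝓘(ℝ, E3) 1 F)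
    (hi : ∀ p, Function.Injective (differential F p)) {p : S} {u : E2} (hu : u ∈ chartTarget p) :
    LinearMap.range (fderivWithin ℝ (chartMap F p) (range (𝓡∂ 2)) u).toLinearMap =
      (tangentPlane F hi ((extChartAt (𝓡∂ 2) p).symm u)).1 := by
  rw [fderivWithin_chartMap hu (hF.mdifferentiableAt one_ne_zero)]
  change LinearMap.range ((differential F _).toLinearMap ∘ₗ (chartDifferential p u).toLinearMap) = _
  rw [LinearMap.range_comp_of_range_eq_top]
  · rfl
  · exact LinearMap.range_eq_top.2 (chartDifferential_bijective hu).2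

/-- Around every point of an immersed surface there is a chart in which the immersion is
bi-Lipschitz. -/
theorem exists_biLipschitz_patch {F : S → E3} (hF : ContMDiff (𝓡∂ 2) 𝓘(ℝ, E3) 1 F)
    (hi : ∀ p, Function.Injective (differential F p)) (p : S) :
    ∃ r > 0, ∃ C : NNReal, Metric.ball (extChartAt (𝓡∂ 2) p p) r ∩ range (𝓡∂ 2) ⊆ chartTarget p ∧
      ∀ u ∈ Metric.ball (extChartAt (𝓡∂ 2) p p) r ∩ range (𝓡∂ 2),
      ∀ v ∈ Metric.ball (extChartAt (𝓡∂ 2) p p) r ∩ range (𝓡∂ 2),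
        dist (chartMap F p u) (chartMap F p v) ≤ C * dist u v ∧
        dist u v ≤ C * dist (chartMap F p u) (chartMap F p v) := by
  set u₀ := extChartAt (𝓡∂ 2) p p with hu₀
  have hu₀t : u₀ ∈ chartTarget p := mem_extChartAt_target p
  set A := fderivWithin ℝ (chartMap F p) (range (𝓡∂ 2)) u₀ with hA
  obtain ⟨C, hC0, hC⟩ := (A : E2 →ₗ[ℝ] E3).exists_antilipschitzWith
    (LinearMap.ker_eq_bot.2 (fderivWithin_chartMap_injective hF hi hu₀t))
  have hC0' : (0 : ℝ) < C := hC0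
  have hcont : ContinuousWithinAt (fun u => fderivWithin ℝ (chartMap F p) (range (𝓡∂ 2)) u)
      (range (𝓡∂ 2)) u₀ :=
    ((contDiffOn_fderivWithin_chartMap (n := 0) (by simpa using hF) p).continuousOn u₀
      hu₀t).mono_of_mem_nhdsWithin (extChartAt_target_mem_nhdsWithin_of_mem hu₀t)
  have hε : (0 : ℝ) < (2 * C)⁻¹ := by positivity
  have hev : ∀ᶠ u in 𝓝[range (𝓡∂ 2)] u₀,
      ‖fderivWithin ℝ (chartMap F p) (range (𝓡∂ 2)) u - A‖ ≤ (2 * (C : ℝ))⁻¹ ∧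
        u ∈ chartTarget p := by
    have h1 := (hcont.sub (continuousWithinAt_const (b := A))).norm
    have h2 := h1.eventually_lt_const (u := (2 * (C : ℝ))⁻¹) (by simpa [hA] using hC0)
    filter_upwards [h2, extChartAt_target_mem_nhdsWithin_of_mem hu₀t] with u h3 h4
    exact ⟨h3.le, h4⟩
  obtain ⟨r, hr, hrs⟩ := Metric.mem_nhdsWithin_iff.1 hev
  -- On the convex half-disc the differential stays within `1/(2C)` of `A`, so by the mean value
  -- inequality the increments of the chart map differ from those of `A` by at most `|u - v|/(2C)`.
  -- This is half of the lower bound `|u - v|/C` for `A`, whence the constants `2C` and `‖A‖ +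
  -- 1/(2C)`.
  refine ⟨r, hr, max (2 * C) (‖A‖₊ + (2 * C)⁻¹), fun u hu => (hrs hu).2, ?_⟩
  have hconv : Convex ℝ (Metric.ball u₀ r ∩ range (𝓡∂ 2)) :=
    (convex_ball _ _).inter (𝓡∂ 2).convex_range
  have hmv : ∀ u ∈ Metric.ball u₀ r ∩ range (𝓡∂ 2), ∀ v ∈ Metric.ball u₀ r ∩ range (𝓡∂ 2),
      ‖chartMap F p u - chartMap F p v - A (u - v)‖ ≤ (2 * (C : ℝ))⁻¹ * ‖u - v‖ :=
    fun u hu v hv => hconv.norm_image_sub_le_of_norm_hasFDerivWithin_le'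
      (fun x hx => (hasFDerivWithinAt_chartMap hF (hrs hx).2).mono inter_subset_right)
      (fun x hx => (hrs hx).1) hv hu
  intro u hu v hv
  have h1 := hmv u hu v hv
  have h2 : ‖u - v‖ ≤ C * ‖A (u - v)‖ := by
    have := hC.le_mul_dist u v
    simpa [dist_eq_norm] using this
  have h3 := A.le_opNorm (u - v)
  have h4 : ‖A (u - v)‖ ≤ ‖chartMap F p u - chartMap F p v‖ + (2 * (C : ℝ))⁻¹ * ‖u - v‖ := by
    have := norm_sub_norm_le (A (u - v)) (chartMap F p u - chartMap F p v)
    rw [norm_sub_rev (A (u - v))] at this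
    linarith
  have h5 : ‖chartMap F p u - chartMap F p v‖ ≤ ‖A (u - v)‖ + (2 * (C : ℝ))⁻¹ * ‖u - v‖ := by
    have := norm_sub_norm_le (chartMap F p u - chartMap F p v) (A (u - v))
    linarith
  simp only [dist_eq_norm]
  have hd := norm_nonneg (u - v)
  constructor
  · calc ‖chartMap F p u - chartMap F p v‖ ≤ (‖A‖ + (2 * (C : ℝ))⁻¹) * ‖u - v‖ := by
          rw [add_mul]; linarith
      _ ≤ _ := by
          gcongr
          have := le_max_right (2 * C) (‖A‖₊ + (2 * C)⁻¹)
          exact_mod_cast this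
  · have h6 : ‖u - v‖ ≤ C * ‖chartMap F p u - chartMap F p v‖ + 1 / 2 * ‖u - v‖ := by
      calc ‖u - v‖ ≤ C * ‖A (u - v)‖ := h2
        _ ≤ C * (‖chartMap F p u - chartMap F p v‖ + (2 * (C : ℝ))⁻¹ * ‖u - v‖) := by gcongr
        _ = _ := by field_simp
    calc ‖u - v‖ ≤ 2 * C * ‖chartMap F p u - chartMap F p v‖ := by linarith
      _ ≤ _ := by
          gcongr
          have := le_max_left (2 * C) (‖A‖₊ + (2 * C)⁻¹)
          exact_mod_cast this

end Chart


/-! ### Linear algebra of capillary frames -/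

theorem inner_E3 (x y : E3) : inner ℝ x y = x 0 * y 0 + x 1 * y 1 + x 2 * y 2 := by
  simp [PiLp.inner_apply, Fin.sum_univ_three, mul_comm]

theorem cross_apply_zero (x y : E3) : cross x y 0 = x 1 * y 2 - x 2 * y 1 := by
  simp [cross, crossProduct]

theorem cross_apply_one (x y : E3) : cross x y 1 = x 2 * y 0 - x 0 * y 2 := by
  simp [cross, crossProduct]

theorem cross_apply_two (x y : E3) : cross x y 2 = x 0 * y 1 - x 1 * y 0 := by
  simp [cross, crossProduct]

theorem vertical_apply_zero : vertical 0 = 0 := by simp [vertical]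

theorem vertical_apply_one : vertical 1 = 0 := by simp [vertical]

theorem vertical_apply_two : vertical 2 = 1 := by simp [vertical]

theorem E3.ext_coord {x y : E3} (h0 : x 0 = y 0) (h1 : x 1 = y 1) (h2 : x 2 = y 2) : x = y := by
  ext i
  fin_cases i
  exacts [h0, h1, h2]

theorem continuous_cross : Continuous fun z : E3 × E3 => cross z.1 z.2 := by
  have h : (fun z : E3 × E3 => cross z.1 z.2) = fun z => WithLp.toLp 2
      ![z.1 1 * z.2 2 - z.1 2 * z.2 1, z.1 2 * z.2 0 - z.1 0 * z.2 2,
        z.1 0 * z.2 1 - z.1 1 * z.2 0] := by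
    funext z
    refine E3.ext_coord ?_ ?_ ?_
    · simp [cross_apply_zero]
    · simp [cross_apply_one]
    · simp [cross_apply_two]
  rw [h]
  refine (PiLp.continuous_toLp 2 _).comp (continuous_pi fun i => ?_)
  fin_cases i <;> simp <;> fun_prop

/-- The contact angle condition determines the conormal from the normal. -/
theorem contact_angle_frame {s c : ℝ} (hs : s ≠ 0) (hsc : s ^ 2 + c ^ 2 = 1) {n m : E3}
    (hn : inner ℝ n n = 1) (hnm : inner ℝ n m = 0)
    (h : m = s • (-vertical) + c • cross (cross n m) vertical) :
    n 2 = c ∧ m = s⁻¹ • (c • n - vertical) := by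
  have h0 := congrArg (fun v : E3 => v 0) h
  have h1 := congrArg (fun v : E3 => v 1) h
  have h2 := congrArg (fun v : E3 => v 2) h
  simp only [PiLp.add_apply, PiLp.smul_apply, PiLp.neg_apply, cross_apply_zero, cross_apply_one,
    cross_apply_two, vertical_apply_zero, vertical_apply_one, vertical_apply_two, smul_eq_mul] at h0 h1 h2
  rw [inner_E3] at hn hnm
  ring_nf at h0 h1 h2
  have e2 : m 2 = - s := by linarith
  have e0 : m 0 = c * (n 2 * m 0 + s * n 0) := by rw [e2] at h0; linear_combination h0
  have e1 : m 1 = c * (n 2 * m 1 + s * n 1) := by rw [e2] at h1; linear_combination h1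
  -- Pair the horizontal parts of `m` and `n`: since `n ⊥ m`, `|n| = 1` and `m 2 = -s`, the two
  -- horizontal equations combine to `s n₂ = c s (n₂² + (1 - n₂²)) = c s`.
  have hn2 : n 2 = c := by
    have : s * (n 2 - c) = 0 := by
      linear_combination (1 - c * n 2) * (-hnm) + n 0 * e0 + n 1 * e1 + n 2 * e2 + c * s * hn +
        (- c * n 2 ^ 2) * e2
    rcases mul_eq_zero.1 this with h | h
    · exact absurd h hs
    · linarith
  refine ⟨hn2, E3.ext_coord ?_ ?_ ?_⟩
  · simp only [PiLp.smul_apply, PiLp.sub_apply, smul_eq_mul, vertical_apply_zero]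
    rw [hn2] at e0
    field_simp
    have : s * (s * m 0 - c * n 0) = 0 := by linear_combination e0 + m 0 * hsc
    rcases mul_eq_zero.1 this with h | h
    · exact absurd h hs
    · linarith
  · simp only [PiLp.smul_apply, PiLp.sub_apply, smul_eq_mul, vertical_apply_one]
    rw [hn2] at e1
    field_simp
    have : s * (s * m 1 - c * n 1) = 0 := by linear_combination e1 + m 1 * hsc
    rcases mul_eq_zero.1 this with h | h
    · exact absurd h hs
    · linarith
  · simp only [PiLp.smul_apply, PiLp.sub_apply, smul_eq_mul, vertical_apply_two]
    rw [e2, hn2]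
    field_simp
    linear_combination -hsc

/-- A vector orthogonal to `n`, expanded in the frame given by the contact angle. -/
theorem eq_of_orthogonal_capillary_frame {s c : ℝ} (hs : s ≠ 0) (hsc : s ^ 2 + c ^ 2 = 1)
    {n a : E3} (hn : inner ℝ n n = 1) (hn2 : n 2 = c) (ha : inner ℝ n a = 0) :
    a = (inner ℝ a (s⁻¹ • cross vertical n) : ℝ) • (s⁻¹ • cross vertical n) -
      (a 2 / s) • (s⁻¹ • (c • n - vertical)) := by
  rw [inner_E3] at hn ha ⊢
  rw [hn2] at hn ha
  refine E3.ext_coord ?_ ?_ ?_ <;>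
  simp only [PiLp.smul_apply, PiLp.sub_apply, smul_eq_mul, vertical_apply_two, vertical_apply_zero,
    vertical_apply_one, cross_apply_zero, cross_apply_one, cross_apply_two, hn2] <;>
  field_simp
  · linear_combination a 0 * hsc - a 0 * hn + n 0 * ha
  · linear_combination a 1 * hsc - a 1 * hn + n 1 * ha
  · linear_combination a 2 * hsc

theorem inner_capillary_frame {s c : ℝ} (hs : s ≠ 0) (hsc : s ^ 2 + c ^ 2 = 1)
    {n : E3} (hn : inner ℝ n n = 1) (hn2 : n 2 = c) :
    inner ℝ (s⁻¹ • cross vertical n) (s⁻¹ • cross vertical n) = (1 : ℝ) ∧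
    inner ℝ (s⁻¹ • (c • n - vertical)) (s⁻¹ • (c • n - vertical)) = (1 : ℝ) ∧
    inner ℝ (s⁻¹ • cross vertical n) (s⁻¹ • (c • n - vertical)) = (0 : ℝ) := by
  simp only [inner_E3] at *
  rw [hn2] at hn
  simp only [PiLp.smul_apply, PiLp.sub_apply, smul_eq_mul, vertical_apply_two, vertical_apply_zero,
    vertical_apply_one, cross_apply_zero, cross_apply_one, cross_apply_two, hn2]
  refine ⟨?_, ?_, ?_⟩
  · field_simp
    linear_combination hn - hsc
  · field_simp
    linear_combination c ^ 2 * hn - hsc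
  · field_simp
    ring

/-- The outward conormal in terms of a basis of the tangent plane adapted to the boundary. -/
theorem capillary_conormal_formula {s c : ℝ} (hs : 0 < s) (hsc : s ^ 2 + c ^ 2 = 1)
    {n a b : E3} (hn : inner ℝ n n = 1) (hn2 : n 2 = c) (ha : inner ℝ n a = 0)
    (hb : inner ℝ n b = 0) (ha2 : 0 ≤ a 2) (hb2 : b 2 = 0) :
    (inner ℝ b b : ℝ) • a - (inner ℝ a b : ℝ) • b =
      -((√(inner ℝ a a * inner ℝ b b - inner ℝ a b ^ 2) * ‖b‖) • (s⁻¹ • (c • n - vertical))) ∧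
    b = (inner ℝ b (s⁻¹ • cross vertical n) : ℝ) • (s⁻¹ • cross vertical n) ∧
    ‖b‖ = |(inner ℝ b (s⁻¹ • cross vertical n) : ℝ)| := by
  obtain ⟨ht, hm, htm⟩ := inner_capillary_frame hs.ne' hsc hn hn2
  have ea := eq_of_orthogonal_capillary_frame hs.ne' hsc hn hn2 ha
  have eb := eq_of_orthogonal_capillary_frame hs.ne' hsc hn hn2 hb
  rw [hb2, zero_div, zero_smul, sub_zero] at eb
  set t : E3 := s⁻¹ • cross vertical n with htdef
  set m : E3 := s⁻¹ • (c • n - vertical) with hmdef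
  set α : ℝ := inner ℝ a t with hα
  set β : ℝ := inner ℝ b t with hβ
  set γ : ℝ := a 2 / s with hγ
  have hγ0 : 0 ≤ γ := div_nonneg ha2 hs.le
  clear_value t m α β γ
  have hmt : inner ℝ m t = (0 : ℝ) := by rw [real_inner_comm]; exact htm
  have hbb : inner ℝ b b = β ^ 2 := by
    rw [eb, inner_smul_left, inner_smul_right, ht]; simp; ring
  have hab : inner ℝ a b = α * β := by
    rw [ea, eb, inner_smul_right, inner_sub_left, inner_smul_left, inner_smul_left, ht, hmt]
    simp; ring
  have haa : inner ℝ a a = α ^ 2 + γ ^ 2 := by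
    rw [ea]
    simp only [inner_sub_left, inner_sub_right, inner_smul_left, inner_smul_right, ht, hm, htm, hmt]
    simp; ring
  have hnb : ‖b‖ = |β| := by
    rw [← Real.sqrt_sq_eq_abs, ← hbb, real_inner_self_eq_norm_sq, Real.sqrt_sq (norm_nonneg _)]
  refine ⟨?_, eb, hnb⟩
  -- In the orthonormal frame `t`, `m` one has `b = β t` and `a = α t - γ m`. Since `a` does not
  -- point downwards, `γ ≥ 0`; this sign identifies the root of the Gram determinant with `|β| γ`
  -- and makes `m` point outwards.
  have hD : inner ℝ a a * inner ℝ b b - inner ℝ a b ^ 2 = (|β| * γ) ^ 2 := by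
    have h : (|β| * γ) ^ 2 = β ^ 2 * γ ^ 2 := by rw [mul_pow, sq_abs]
    rw [haa, hbb, hab, h]; ring
  rw [hD, Real.sqrt_sq (by positivity), hnb, hbb, hab, ea, eb]
  have hbeta : |β| * γ * |β| = β ^ 2 * γ := by
    rw [mul_right_comm, ← sq, sq_abs]
  rw [hbeta]
  module

theorem det_gram_fin_two (v : Fin 2 → E3) : (Matrix.gram ℝ v).det =
    inner ℝ (v 0) (v 0) * inner ℝ (v 1) (v 1) - inner ℝ (v 0) (v 1) ^ 2 := by
  rw [Matrix.det_fin_two]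
  simp only [Matrix.gram_apply]
  rw [real_inner_comm (v 0) (v 1)]
  ring

/-- The orthogonal projection onto a plane in terms of a basis. -/
theorem starProjection_eq_of_basis {a b : E3} {P : Submodule ℝ E3}
    (ha : a ∈ P) (hb : b ∈ P) (hP : ∀ v ∈ P, ∃ x y : ℝ, v = x • a + y • b) {D : ℝ}
    (hD : D = inner ℝ a a * inner ℝ b b - inner ℝ a b ^ 2) (hD0 : D ≠ 0) (v : E3) :
    P.starProjection v =
      (D⁻¹ * inner ℝ ((inner ℝ b b : ℝ) • a - (inner ℝ a b : ℝ) • b) v) • a +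
      (D⁻¹ * inner ℝ ((inner ℝ a a : ℝ) • b - (inner ℝ a b : ℝ) • a) v) • b := by
  refine Submodule.eq_starProjection_of_mem_orthogonal
    (P.add_mem (P.smul_mem _ ha) (P.smul_mem _ hb)) ?_
  rw [Submodule.mem_orthogonal]
  intro w hw
  obtain ⟨x, y, rfl⟩ := hP w hw
  have hba : inner ℝ b a = (inner ℝ a b : ℝ) := real_inner_comm _ _
  simp only [inner_add_left, inner_sub_left, inner_smul_left, inner_sub_right, inner_add_right,
    inner_smul_right, conj_trivial, hba]
  rw [hD] at hD0
  rw [hD]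
  field_simp
  ring

/-- In a basis of the plane, the projection composed with `DX` is a sum of two rank-one maps, whose
traces can be read off. -/
theorem divAlong_eq_of_basis {a b : E3} {P : Submodule ℝ E3}
    (ha : a ∈ P) (hb : b ∈ P) (hP : ∀ v ∈ P, ∃ x y : ℝ, v = x • a + y • b) {D : ℝ}
    (hD : D = inner ℝ a a * inner ℝ b b - inner ℝ a b ^ 2) (hD0 : D ≠ 0) (X : E3 → E3) (x : E3) :
    divAlong P X x =
      D⁻¹ * inner ℝ ((inner ℝ b b : ℝ) • a - (inner ℝ a b : ℝ) • b) (fderiv ℝ X x a) +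
      D⁻¹ * inner ℝ ((inner ℝ a a : ℝ) • b - (inner ℝ a b : ℝ) • a) (fderiv ℝ X x b) := by
  set N₀ : E3 := (inner ℝ b b : ℝ) • a - (inner ℝ a b : ℝ) • b with hN₀
  set N₁ : E3 := (inner ℝ a a : ℝ) • b - (inner ℝ a b : ℝ) • a with hN₁
  have h : ((P.starProjection ∘L fderiv ℝ X x : E3 →L[ℝ] E3) : E3 →ₗ[ℝ] E3) =
      ((D⁻¹ • (innerSL ℝ N₀ ∘L fderiv ℝ X x) : E3 →L[ℝ] ℝ) : E3 →ₗ[ℝ] ℝ).smulRight a +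
      ((D⁻¹ • (innerSL ℝ N₁ ∘L fderiv ℝ X x) : E3 →L[ℝ] ℝ) : E3 →ₗ[ℝ] ℝ).smulRight b := by
    ext1 v
    simp only [ContinuousLinearMap.coe_coe, ContinuousLinearMap.comp_apply, LinearMap.add_apply,
      LinearMap.smulRight_apply]
    rw [starProjection_eq_of_basis ha hb hP hD hD0]
    rfl
  rw [divAlong, h, map_add, LinearMap.trace_smulRight, LinearMap.trace_smulRight]
  simp

/-! ### Normal, conormal and tangent of a capillary immersion. -/

section Capillary

variable {S : Type*} [TopologicalSpace S] [ChartedSpace (EuclideanHalfSpace 2) S]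
  {θ : ℝ} {F ν : S → E3}

theorem IsCapillaryImmersion.inner_normal_self (hF : IsCapillaryImmersion θ F ν) (p : S) :
    inner ℝ (ν p) (ν p) = (1 : ℝ) := by
  rw [real_inner_self_eq_norm_sq, hF.normal_unit, one_pow]

theorem IsCapillaryImmersion.inner_normal_conormal (hF : IsCapillaryImmersion θ F ν) (p : S) :
    inner ℝ (ν p) (conormal F p) = (0 : ℝ) := by
  simp only [conormal, inner_smul_right, inner_sub_right, hF.normal_orthogonal, mul_zero, sub_zero]

/-- Along the boundary the whole frame becomes a function of `ν`. The formula for the conormal makes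
sense, and is continuous, on all of `S`, unlike the definition through differentials in preferred
charts. -/
theorem IsCapillaryImmersion.normal_two_and_conormal (hF : IsCapillaryImmersion θ F ν)
    (hθ : θ ∈ Set.Ioo 0 Real.pi) {p : S} (hp : p ∈ (𝓡∂ 2).boundary S) :
    ν p 2 = Real.cos θ ∧
      conormal F p = (Real.sin θ)⁻¹ • (Real.cos θ • ν p - vertical) := by
  have h2 := hF.inner_normal_conormal p
  exact contact_angle_frame (Real.sin_pos_of_mem_Ioo hθ).ne' (Real.sin_sq_add_cos_sq θ)
    (hF.inner_normal_self p) h2 (hF.contact_angle p hp)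

/-- The boundary tangent as a continuous function on the whole surface. -/
def capillaryTangent (θ : ℝ) (ν : S → E3) (p : S) : E3 := (Real.sin θ)⁻¹ • cross vertical (ν p)

/-- The conormal as a continuous function on the whole surface. -/
def capillaryConormal (θ : ℝ) (ν : S → E3) (p : S) : E3 :=
  (Real.sin θ)⁻¹ • (Real.cos θ • ν p - vertical)

theorem IsCapillaryImmersion.boundaryTangent_eq (hF : IsCapillaryImmersion θ F ν)
    (hθ : θ ∈ Set.Ioo 0 Real.pi) {p : S} (hp : p ∈ (𝓡∂ 2).boundary S) :
    boundaryTangent F ν p = capillaryTangent θ ν p := by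
  rw [boundaryTangent, (hF.normal_two_and_conormal hθ hp).2, capillaryTangent]
  refine E3.ext_coord ?_ ?_ ?_ <;>
  simp only [PiLp.smul_apply, PiLp.sub_apply, smul_eq_mul, vertical_apply_two, vertical_apply_zero,
    vertical_apply_one, cross_apply_zero, cross_apply_one, cross_apply_two] <;> ring

theorem continuous_capillaryTangent (hν : Continuous ν) : Continuous (capillaryTangent θ ν) :=
  (continuous_cross.comp (continuous_const.prodMk hν)).const_smul (Real.sin θ)⁻¹

theorem continuous_capillaryConormal (hν : Continuous ν) : Continuous (capillaryConormal θ ν) :=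
  ((hν.const_smul (Real.cos θ)).sub continuous_const).const_smul (Real.sin θ)⁻¹

theorem IsCapillaryImmersion.tangentPlane_eq (hF : IsCapillaryImmersion θ F ν) (p : S) :
    (tangentPlane F hF.immersion p).1 = (Submodule.span ℝ {ν p})ᗮ := by
  have hν0 : ν p ≠ 0 := by
    rw [← norm_ne_zero_iff, hF.normal_unit]; exact one_ne_zero
  refine Submodule.eq_of_le_of_finrank_eq ?_ ?_
  · rintro _ ⟨v, rfl⟩
    rw [Submodule.mem_orthogonal_singleton_iff_inner_right]
    exact hF.normal_orthogonal p v
  · rw [(tangentPlane F hF.immersion p).2]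
    have h1 := Submodule.finrank_add_finrank_orthogonal (Submodule.span ℝ {ν p})
    rw [finrank_span_singleton hν0, finrank_euclideanSpace_fin] at h1
    omega

theorem IsCapillaryImmersion.starProjection_tangentPlane (hF : IsCapillaryImmersion θ F ν) (p : S) :
    (tangentPlane F hF.immersion p).1.starProjection =
      ContinuousLinearMap.id ℝ E3 - (innerSL ℝ (ν p)).smulRight (ν p) := by
  rw [hF.tangentPlane_eq p]
  ext1 v
  rw [Submodule.starProjection_orthogonal_val, Submodule.starProjection_unit_singleton ℝ
    (hF.normal_unit p)]
  simp

/-- The differential refers to the preferred chart at each point and need not vary continuously. The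
orthogonal projection onto its range is `id - ν ⊗ ν`, which does, and the topology of `Grass` only
sees projections. -/
theorem IsCapillaryImmersion.continuous_tangentPlane (hF : IsCapillaryImmersion θ F ν) :
    Continuous (tangentPlane F hF.immersion) := by
  rw [continuous_induced_rng]
  have : ((fun P : Grass => P.1.starProjection) ∘ tangentPlane F hF.immersion) = fun p =>
      ContinuousLinearMap.id ℝ E3 - (innerSL ℝ (ν p)).smulRight (ν p) := by
    funext p
    exact hF.starProjection_tangentPlane p
  rw [this]
  have hν := hF.normal_continuous
  fun_prop

theorem IsCapillaryImmersion.contMDiff_one (hF : IsCapillaryImmersion θ F ν) :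
    ContMDiff (𝓡∂ 2) 𝓘(ℝ, E3) 1 F := hF.contMDiff.of_le (by norm_num)

theorem IsCapillaryImmersion.nonneg (hF : IsCapillaryImmersion θ F ν) (p : S) : 0 ≤ F p 2 := by
  by_cases hp : p ∈ (𝓡∂ 2).boundary S
  · exact (hF.boundary_zero p hp).ge
  · rw [← mem_compl_iff, (𝓡∂ 2).compl_boundary] at hp
    exact (hF.interior_pos p hp).le

theorem IsCapillaryImmersion.mem_boundaryPlane_iff (hF : IsCapillaryImmersion θ F ν) (p : S) :
    F p ∈ boundaryPlane ↔ p ∈ (𝓡∂ 2).boundary S := by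
  refine ⟨fun h => ?_, hF.boundary_zero p⟩
  by_contra hp
  rw [← mem_compl_iff, (𝓡∂ 2).compl_boundary] at hp
  exact (hF.interior_pos p hp).ne' h

variable [IsManifold (𝓡∂ 2) ∞ S]

theorem IsCapillaryImmersion.inner_normal_chartPartial (hF : IsCapillaryImmersion θ F ν) {p : S}
    {u : E2} (hu : u ∈ chartTarget p) (i : Fin 2) :
    inner ℝ (ν ((extChartAt (𝓡∂ 2) p).symm u)) (chartPartial F p u i) = (0 : ℝ) := by
  have h := fderivWithin_chartMap hu (hF.contMDiff_one.mdifferentiableAt one_ne_zero)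
  change inner ℝ _ (fderivWithin ℝ (chartMap F p) (range (𝓡∂ 2)) u (EuclideanSpace.single i 1)) = _
  rw [h]
  exact hF.normal_orthogonal _ _

/-- At a boundary point, the first coordinate direction points upwards and the second one is
horizontal. -/
theorem IsCapillaryImmersion.chartPartial_two (hF : IsCapillaryImmersion θ F ν) {p : S}
    {u : E2} (hu : u ∈ chartTarget p) (hu0 : u 0 = 0) :
    0 ≤ chartPartial F p u 0 2 ∧ chartPartial F p u 1 2 = 0 := by
  set g : E2 → ℝ := fun v => chartMap F p v 2 with hg
  have hd : HasFDerivWithinAt g ((EuclideanSpace.proj (2 : Fin 3) : E3 →L[ℝ] ℝ) ∘L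
      fderivWithin ℝ (chartMap F p) (range (𝓡∂ 2)) u) (range (𝓡∂ 2)) u :=
    (EuclideanSpace.proj (2 : Fin 3) : E3 →L[ℝ] ℝ).hasFDerivAt.comp_hasFDerivWithinAt u
      (hasFDerivWithinAt_chartMap hF.contMDiff_one hu)
  have hgu : g u = 0 := hF.boundary_zero _ ((symm_mem_boundary_iff hu).2 hu0)
  -- The height is nonnegative on the surface and vanishes at the boundary point, so this is a
  -- minimum on the half-plane. Its derivative is nonnegative along the inward direction and along
  -- both boundary directions, hence zero along the boundary.
  have hmin : IsLocalMinOn g (range (𝓡∂ 2)) u := by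
    refine Filter.Eventually.of_forall fun v => ?_
    rw [hgu]
    exact hF.nonneg _
  have hcone : ∀ y : E2, 0 ≤ y 0 → y ∈ posTangentConeAt (range (𝓡∂ 2)) u := by
    intro y hy
    refine mem_posTangentConeAt_of_segment_subset ?_
    refine (𝓡∂ 2).convex_range.segment_subset (chartTarget_subset p hu) ?_
    rw [range_halfPlaneModel]
    show 0 ≤ u 0 + y 0
    rw [hu0, zero_add]; exact hy
  have h0 := hmin.hasFDerivWithinAt_nonneg hd (hcone (EuclideanSpace.single 0 1) (by simp))
  have h1 := hmin.hasFDerivWithinAt_nonneg hd (hcone (EuclideanSpace.single 1 1) (by simp))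
  have h2 := hmin.hasFDerivWithinAt_nonneg hd (hcone (-EuclideanSpace.single 1 1) (by simp))
  refine ⟨h0, le_antisymm ?_ h1⟩
  rw [map_neg] at h2
  exact neg_nonneg.1 h2

theorem chartPartial_gram_det_pos (hF : IsCapillaryImmersion θ F ν) {p : S} {u : E2}
    (hu : u ∈ chartTarget p) : 0 < (Matrix.gram ℝ (chartPartial F p u)).det := by
  have h := (fderivWithin ℝ (chartMap F p) (range (𝓡∂ 2)) u :
    E2 →ₗ[ℝ] E3).normDet_sq_eq_det_gram (EuclideanSpace.basisFun (Fin 2) ℝ)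
  have h2 := normDet_pos_of_injective
    (fderivWithin_chartMap_injective hF.contMDiff_one hF.immersion hu)
  simp only [RCLike.ofReal_real_eq_id, id_eq, EuclideanSpace.basisFun_apply] at h
  change _ = (Matrix.gram ℝ (chartPartial F p u)).det at h
  rw [← h]
  positivity

theorem sqrt_gram_det_eq_normDet (F : S → E3) (p : S) (u : E2) :
    √(Matrix.gram ℝ (chartPartial F p u)).det =
      (fderivWithin ℝ (chartMap F p) (range (𝓡∂ 2)) u : E2 →ₗ[ℝ] E3).normDet := by
  have h := (fderivWithin ℝ (chartMap F p) (range (𝓡∂ 2)) u :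
    E2 →ₗ[ℝ] E3).normDet_sq_eq_det_gram (EuclideanSpace.basisFun (Fin 2) ℝ)
  simp only [RCLike.ofReal_real_eq_id, id_eq, EuclideanSpace.basisFun_apply] at h
  change _ = (Matrix.gram ℝ (chartPartial F p u)).det at h
  rw [← h, Real.sqrt_sq (LinearMap.normDet_nonneg _)]

theorem IsCapillaryImmersion.mem_tangentPlane_iff (hF : IsCapillaryImmersion θ F ν) {p : S}
    {u : E2} (hu : u ∈ chartTarget p) (v : E3) :
    v ∈ (tangentPlane F hF.immersion ((extChartAt (𝓡∂ 2) p).symm u)).1 ↔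
      ∃ x y : ℝ, v = x • chartPartial F p u 0 + y • chartPartial F p u 1 := by
  rw [← range_fderivWithin_chartMap hF.contMDiff_one hF.immersion hu]
  constructor
  · rintro ⟨z, rfl⟩
    refine ⟨z 0, z 1, ?_⟩
    have hz : z = z 0 • EuclideanSpace.single 0 1 + z 1 • EuclideanSpace.single 1 1 := by
      ext i; fin_cases i <;> simp
    conv_lhs => rw [hz]
    simp only [ContinuousLinearMap.coe_coe, map_add, map_smul]
    rfl
  · rintro ⟨x, y, rfl⟩
    refine ⟨x • EuclideanSpace.single 0 1 + y • EuclideanSpace.single 1 1, ?_⟩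
    simp only [ContinuousLinearMap.coe_coe, map_add, map_smul]
    rfl

end Capillary


/-! ### Measures glued from charts -/

theorem map_withDensity_restrict_apply {α β : Type*} [MeasurableSpace α] [MeasurableSpace β]
    (μ : Measure α) [SFinite μ] {T : Set α} (hT : MeasurableSet T) {ψ : α → β}
    (hψ : AEMeasurable ψ (μ.restrict T)) (d : α → ENNReal) {A : Set β} (hA : MeasurableSet A) :
    (((μ.restrict T).withDensity d).map ψ) A = ∫⁻ u in ψ ⁻¹' A ∩ T, d u ∂μ := by
  rw [Measure.map_apply_of_aemeasurable
    (hψ.mono_ac (withDensity_absolutelyContinuous _ _)) hA, withDensity_apply' _ _,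
    Measure.restrict_restrict' hT]

/-- Measures on open pieces that agree on overlaps glue to their supremum. -/
theorem iSup_restrict_eq_of_agree {ι X : Type*} [MeasurableSpace X] {μ : ι → Measure X}
    {U : ι → Set X} (hU : ∀ i, MeasurableSet (U i)) (hsupp : ∀ i, μ i (U i)ᶜ = 0)
    (hagree : ∀ i j, ∀ A, MeasurableSet A → A ⊆ U i → A ⊆ U j → μ i A = μ j A)
    {e : ℕ → ι} (he : ⋃ n, U (e n) = univ) (i : ι) : (⨆ i, μ i).restrict (U i) = μ i := by
  set B : ℕ → Set X := disjointed fun n => U (e n) with hB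
  have hBm : ∀ n, MeasurableSet (B n) := MeasurableSet.disjointed fun n => hU (e n)
  have hBd : Pairwise (Function.onFun Disjoint B) := disjoint_disjointed _
  have hBU : ∀ n, B n ⊆ U (e n) := disjointed_subset _
  have hBuniv : ⋃ n, B n = univ := by rw [hB, iUnion_disjointed, he]
  -- The glued measure is assembled over a countable disjoint partition subordinate to the cover;
  -- every `μ i` is its restriction to `U i`, so it bounds the supremum from above.
  set m : Measure X := Measure.sum fun n => (μ (e n)).restrict (B n) with hm
  have hdec : ∀ i A, MeasurableSet A → A ⊆ U i → μ i A = m A := by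
    intro i A hA hAU
    rw [hm, Measure.sum_apply _ hA]
    conv_lhs => rw [← inter_univ A, ← hBuniv, inter_iUnion]
    rw [measure_iUnion (fun a b hab => (hBd hab).mono inter_subset_right inter_subset_right)
      fun n => hA.inter (hBm n)]
    refine tsum_congr fun n => ?_
    rw [Measure.restrict_apply hA]
    exact hagree _ _ _ (hA.inter (hBm n)) (inter_subset_left.trans hAU)
      (inter_subset_right.trans (hBU n))
  have hres : ∀ i A, MeasurableSet A → μ i A = m (A ∩ U i) := by
    intro i A hA
    rw [← hdec i _ (hA.inter (hU i)) inter_subset_right]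
    refine le_antisymm ?_ (measure_mono inter_subset_left)
    calc μ i A ≤ μ i (A ∩ U i ∪ (U i)ᶜ) := measure_mono fun x hx => by
          by_cases h : x ∈ U i
          exacts [Or.inl ⟨hx, h⟩, Or.inr h]
      _ ≤ μ i (A ∩ U i) + μ i (U i)ᶜ := measure_union_le _ _
      _ = _ := by rw [hsupp, add_zero]
  have hle : ⨆ i, μ i ≤ m := by
    refine iSup_le fun i => Measure.le_iff.2 fun A hA => ?_
    rw [hres i A hA]
    exact measure_mono inter_subset_left
  refine le_antisymm ?_ ?_
  · refine Measure.le_iff.2 fun A hA => ?_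
    rw [Measure.restrict_apply hA, hres i A hA]
    exact hle _
  · refine Measure.le_iff.2 fun A hA => ?_
    rw [Measure.restrict_apply hA, hres i A hA, ← hdec i _ (hA.inter (hU i)) inter_subset_right]
    exact le_iSup μ i _

theorem measurableSet_preimage_inter_of_continuousOn {α β : Type*} [TopologicalSpace α]
    [MeasurableSpace α] [OpensMeasurableSpace α] [TopologicalSpace β] [MeasurableSpace β]
    [BorelSpace β] {T : Set α} (hT : MeasurableSet T) {ψ : α → β} (hψ : ContinuousOn ψ T)
    {A : Set β} (hA : MeasurableSet A) : MeasurableSet (ψ ⁻¹' A ∩ T) := by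
  have h1 : Measurable (T.domRestrict ψ) := (continuousOn_iff_continuous_domRestrict.1 hψ).measurable
  have h2 := hT.subtype_image (h1 hA)
  have : ψ ⁻¹' A ∩ T = Subtype.val '' (T.domRestrict ψ ⁻¹' A) := by
    ext x
    simp [and_comm]
  rwa [this]

theorem aemeasurable_restrict_of_continuousOn {α β : Type*} [TopologicalSpace α]
    [MeasurableSpace α] [OpensMeasurableSpace α] [TopologicalSpace β] [MeasurableSpace β]
    [BorelSpace β] {μ : Measure α} {T : Set α} (hT : MeasurableSet T) {ψ : α → β}
    (hψ : ContinuousOn ψ T) : AEMeasurable ψ (μ.restrict T) := by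
  have h1 : Measurable (T.domRestrict ψ) := (continuousOn_iff_continuous_domRestrict.1 hψ).measurable
  have h2 := (MeasurableEmbedding.subtype_coe hT).aemeasurable_map_iff
    (μ := μ.comap Subtype.val) (g := ψ)
  rw [map_comap_subtype_coe hT] at h2
  exact h2.2 h1.aemeasurable

/-- The inclusion of the boundary line in the half-plane. -/
def boundaryLine : ℝ →L[ℝ] E2 :=
  ContinuousLinearMap.toSpanSingleton ℝ (EuclideanSpace.single 1 1 : E2)

theorem boundaryLine_apply (t : ℝ) : boundaryLine t = !₂[0, t] := by
  ext i
  fin_cases i <;> simp [boundaryLine]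

theorem normDet_toSpanSingleton (v : E3) :
    (ContinuousLinearMap.toSpanSingleton ℝ v : ℝ →ₗ[ℝ] E3).normDet = ‖v‖ := by
  have h := (ContinuousLinearMap.toSpanSingleton ℝ v : ℝ →ₗ[ℝ] E3).normDet_sq_eq_det_gram
    (OrthonormalBasis.singleton Unit ℝ)
  simp only [RCLike.ofReal_real_eq_id, id_eq, Matrix.det_unique, Matrix.gram_apply,
    OrthonormalBasis.singleton_apply] at h
  simp only [ContinuousLinearMap.coe_coe, ContinuousLinearMap.toSpanSingleton_apply, one_smul,
    real_inner_self_eq_norm_sq] at h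
  exact (sq_eq_sq₀ (LinearMap.normDet_nonneg _) (norm_nonneg _)).1 h

/-! ### Area and boundary length of an immersed surface in charts. -/

section Glue

variable {S : Type*} [TopologicalSpace S] [ChartedSpace (EuclideanHalfSpace 2) S]
  [IsManifold (𝓡∂ 2) ∞ S] {F : S → E3}

/-- By compactness finitely many bi-Lipschitz patches suffice. They are enumerated by `ℕ`, possibly
with repetitions, so that they can be made disjoint by `disjointed`. -/
theorem exists_patch_sequence [CompactSpace S] [Nonempty S] (hF : ContMDiff (𝓡∂ 2) 𝓘(ℝ, E3) 1 F)
    (hi : ∀ p, Function.Injective (differential F p)) :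
    ∃ (e : ℕ → S) (Q : ℕ → Set S), (∀ n, IsOpen (Q n)) ∧
      (∀ n, Q n ⊆ (extChartAt (𝓡∂ 2) (e n)).source) ∧ (⋃ n, Q n = univ) ∧
      ∀ n, ∃ C : NNReal, ∀ x ∈ Q n, ∀ y ∈ Q n,
        dist (F x) (F y) ≤ C * dist (extChartAt (𝓡∂ 2) (e n) x) (extChartAt (𝓡∂ 2) (e n) y) ∧
        dist (extChartAt (𝓡∂ 2) (e n) x) (extChartAt (𝓡∂ 2) (e n) y) ≤ C * dist (F x) (F y) := by
  choose r hr C hsub hC using fun p => exists_biLipschitz_patch hF hi p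
  set P : S → Set S := fun p => (extChartAt (𝓡∂ 2) p).source ∩
    extChartAt (𝓡∂ 2) p ⁻¹' Metric.ball (extChartAt (𝓡∂ 2) p p) (r p) with hP
  have hPo : ∀ p, IsOpen (P p) := fun p => by
    rw [hP]
    simp only [extChartAt_source]
    exact isOpen_extChartAt_preimage p Metric.isOpen_ball
  have hPp : ∀ p, p ∈ P p := fun p => ⟨mem_extChartAt_source p, Metric.mem_ball_self (hr p)⟩
  obtain ⟨t, ht⟩ := isCompact_univ.elim_finite_subcover P hPo
    fun p _ => mem_iUnion.2 ⟨p, hPp p⟩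
  have htne : (t : Set S).Nonempty := by
    obtain ⟨x⟩ := ‹Nonempty S›
    have := ht (mem_univ x)
    simp only [mem_iUnion] at this
    obtain ⟨i, hi, -⟩ := this
    exact ⟨i, hi⟩
  obtain ⟨e, he⟩ := t.countable_toSet.exists_eq_range htne
  refine ⟨e, fun n => P (e n), fun n => hPo _, fun n => inter_subset_left, ?_, ?_⟩
  · refine eq_univ_of_univ_subset fun x hx => ?_
    have := ht hx
    simp only [mem_iUnion] at this
    obtain ⟨i, hi, hxi⟩ := this
    have hi' : i ∈ range e := he ▸ hi
    obtain ⟨n, rfl⟩ := hi'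
    exact mem_iUnion.2 ⟨n, hxi⟩
  · intro n
    refine ⟨C (e n), fun x hx y hy => ?_⟩
    have h := hC (e n) (extChartAt (𝓡∂ 2) (e n) x)
      ⟨hx.2, chartTarget_subset _ ((extChartAt (𝓡∂ 2) (e n)).map_source hx.1)⟩
      (extChartAt (𝓡∂ 2) (e n) y)
      ⟨hy.2, chartTarget_subset _ ((extChartAt (𝓡∂ 2) (e n)).map_source hy.1)⟩
    simp only [chartMap, Function.comp_apply, (extChartAt (𝓡∂ 2) (e n)).left_inv hx.1,
      (extChartAt (𝓡∂ 2) (e n)).left_inv hy.1] at h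
    exact h

theorem injOn_of_dist_le {α β γ : Type*} [MetricSpace β] [MetricSpace γ] {Q : Set α} {f : α → β}
    {φ : α → γ} (hφ : InjOn φ Q) {C : NNReal}
    (h : ∀ x ∈ Q, ∀ y ∈ Q, dist (φ x) (φ y) ≤ C * dist (f x) (f y)) : InjOn f Q := by
  intro x hx y hy hxy
  refine hφ hx hy (dist_le_zero.1 ?_)
  have := h x hx y hy
  rwa [hxy, dist_self, mul_zero] at this

theorem image_chartMap_preimage (f : S → E3) {p : S} {A : Set S}
    (hA : A ⊆ (extChartAt (𝓡∂ 2) p).source) :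
    chartMap f p '' ((extChartAt (𝓡∂ 2) p).symm ⁻¹' A ∩ chartTarget p) = f '' A := by
  ext y
  constructor
  · rintro ⟨u, ⟨hu, -⟩, rfl⟩
    exact ⟨_, hu, rfl⟩
  · rintro ⟨x, hx, rfl⟩
    have h1 := (extChartAt (𝓡∂ 2) p).left_inv (hA hx)
    refine ⟨extChartAt (𝓡∂ 2) p x, ⟨?_, (extChartAt (𝓡∂ 2) p).map_source (hA hx)⟩, ?_⟩
    · rw [mem_preimage, h1]; exact hx
    · rw [chartMap, Function.comp_apply, h1]

theorem continuousOn_chart_symm (p : S) :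
    ContinuousOn (extChartAt (𝓡∂ 2) p).symm (chartTarget p) := continuousOn_extChartAt_symm p

theorem injOn_chartMap {f : S → E3} {p : S} {A : Set S} (hfA : InjOn f A) :
    InjOn (chartMap f p) ((extChartAt (𝓡∂ 2) p).symm ⁻¹' A ∩ chartTarget p) := by
  intro u hu v hv huv
  exact (extChartAt (𝓡∂ 2) p).symm.injOn hu.2 hv.2 (hfA hu.1 hv.1 huv)

/-- The parameter interval of the boundary in the chart at `p`. -/
abbrev boundaryParameters (p : S) : Set ℝ := {t : ℝ | !₂[0, t] ∈ chartTarget p}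

theorem isOpen_boundaryParameters (p : S) : IsOpen (boundaryParameters p) := by
  obtain ⟨O, hO, h⟩ := exists_isOpen_chartTarget p
  have : boundaryParameters p = boundaryLine ⁻¹' O := by
    ext t
    simp only [boundaryParameters, h, mem_ofPred_eq, mem_preimage, boundaryLine_apply, mem_inter_iff,
      range_halfPlaneModel]
    simp
  rw [this]
  exact hO.preimage boundaryLine.continuous

theorem continuousOn_boundary_symm (p : S) :
    ContinuousOn (fun t : ℝ => (extChartAt (𝓡∂ 2) p).symm !₂[0, t]) (boundaryParameters p) := by
  simp_rw [← boundaryLine_apply]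
  refine (continuousOn_chart_symm p).comp boundaryLine.continuous.continuousOn fun t ht => ?_
  rw [boundaryLine_apply]; exact ht

/-- The boundary line stays inside the half-plane, so the one-sided differential there still gives a
two-sided derivative in `t`. -/
theorem hasDerivAt_boundary_chartMap {W : Type*} [NormedAddCommGroup W] [NormedSpace ℝ W]
    {f : S → W} (hf : ContMDiff (𝓡∂ 2) 𝓘(ℝ, W) 1 f) {p : S} {t : ℝ}
    (ht : t ∈ boundaryParameters p) :
    HasDerivAt (fun t : ℝ => chartMap f p !₂[0, t])
      (fderivWithin ℝ (chartMap f p) (range (𝓡∂ 2)) !₂[0, t] (EuclideanSpace.single 1 1)) t := by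
  have h1 : HasFDerivWithinAt (chartMap f p) (fderivWithin ℝ (chartMap f p) (range (𝓡∂ 2)) !₂[0, t])
      (range (𝓡∂ 2)) (boundaryLine t) := by
    rw [boundaryLine_apply]; exact hasFDerivWithinAt_chartMap hf ht
  have h2 : HasDerivWithinAt (fun t : ℝ => boundaryLine t) (boundaryLine 1) univ t :=
    boundaryLine.hasDerivAt.hasDerivWithinAt
  have h3 := h1.comp_hasDerivWithinAt t h2 (fun s _ => by
    rw [range_halfPlaneModel]
    show 0 ≤ boundaryLine s 0
    rw [boundaryLine_apply]; simp)
  rw [hasDerivWithinAt_univ] at h3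
  have h4 : boundaryLine 1 = EuclideanSpace.single 1 1 := by simp [boundaryLine]
  rw [h4] at h3
  simpa [Function.comp_def, boundaryLine_apply] using h3

variable [MeasurableSpace S] [BorelSpace S]

/-- The area measure in the chart at `p`. -/
def chartArea (F : S → E3) (p : S) : Measure S :=
  ((volume.restrict (extChartAt (𝓡∂ 2) p).target).withDensity
      (fun u => ENNReal.ofReal √(Matrix.gram ℝ (chartPartial F p u)).det)).map
    (extChartAt (𝓡∂ 2) p).symm

/-- The boundary length measure in the chart at `p`. -/
def chartLength (F : S → E3) (p : S) : Measure S :=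
  ((volume.restrict {t : ℝ | !₂[0, t] ∈ (extChartAt (𝓡∂ 2) p).target}).withDensity
      (fun t => ENNReal.ofReal ‖chartPartial F p !₂[0, t] 1‖)).map
    (fun t => (extChartAt (𝓡∂ 2) p).symm !₂[0, t])

theorem chartArea_apply (F : S → E3) (p : S) {A : Set S} (hA : MeasurableSet A) :
    chartArea F p A = ∫⁻ u in (extChartAt (𝓡∂ 2) p).symm ⁻¹' A ∩ chartTarget p,
      ENNReal.ofReal √(Matrix.gram ℝ (chartPartial F p u)).det :=
  map_withDensity_restrict_apply _ (measurableSet_chartTarget p)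
    (aemeasurable_restrict_of_continuousOn (measurableSet_chartTarget p)
      (continuousOn_chart_symm p)) _ hA

theorem chartLength_apply (F : S → E3) (p : S) {A : Set S} (hA : MeasurableSet A) :
    chartLength F p A =
      ∫⁻ t in (fun t : ℝ => (extChartAt (𝓡∂ 2) p).symm !₂[0, t]) ⁻¹' A ∩ boundaryParameters p,
      ENNReal.ofReal ‖chartPartial F p !₂[0, t] 1‖ :=
  map_withDensity_restrict_apply _ (isOpen_boundaryParameters p).measurableSet
    (aemeasurable_restrict_of_continuousOn (isOpen_boundaryParameters p).measurableSet
      (continuousOn_boundary_symm p)) _ hA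

theorem measurableSet_manifoldBoundary : MeasurableSet ((𝓡∂ 2).boundary S) :=
  ((𝓡∂ 2).isClosed_boundary (n := ∞) (by simp)).measurableSet

theorem measurableSet_manifoldInterior : MeasurableSet ((𝓡∂ 2).interior S) :=
  ((𝓡∂ 2).isOpen_interior (n := ∞) (by simp)).measurableSet

theorem measurableSet_chart_source (p : S) : MeasurableSet (extChartAt (𝓡∂ 2) p).source :=
  (isOpen_extChartAt_source p).measurableSet

theorem chartArea_boundary (F : S → E3) (p : S) : chartArea F p ((𝓡∂ 2).boundary S) = 0 := by
  rw [chartArea_apply F p measurableSet_manifoldBoundary]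
  refine setLIntegral_measure_zero _ _ (measure_mono_null ?_ volume_coord_zero_eq_zero)
  rintro u ⟨hu, hut⟩
  exact (symm_mem_boundary_iff hut).1 hu

theorem chartArea_compl_source (F : S → E3) (p : S) :
    chartArea F p ((extChartAt (𝓡∂ 2) p).source)ᶜ = 0 := by
  rw [chartArea_apply F p (measurableSet_chart_source p).compl]
  have : (extChartAt (𝓡∂ 2) p).symm ⁻¹' ((extChartAt (𝓡∂ 2) p).source)ᶜ ∩ chartTarget p = ∅ := by
    ext u
    simp only [mem_inter_iff, mem_preimage, mem_compl_iff, mem_empty_iff_false, iff_false, not_and]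
    exact fun h hu => h ((extChartAt (𝓡∂ 2) p).map_target hu)
  rw [this]
  simp

theorem chartLength_compl_source (F : S → E3) (p : S) :
    chartLength F p ((extChartAt (𝓡∂ 2) p).source)ᶜ = 0 := by
  rw [chartLength_apply F p (measurableSet_chart_source p).compl]
  have : (fun t : ℝ => (extChartAt (𝓡∂ 2) p).symm !₂[0, t]) ⁻¹'
      ((extChartAt (𝓡∂ 2) p).source)ᶜ ∩ boundaryParameters p = ∅ := by
    ext u
    simp only [mem_inter_iff, mem_preimage, mem_compl_iff, mem_empty_iff_false, iff_false, not_and]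
    exact fun h hu => h ((extChartAt (𝓡∂ 2) p).map_target hu)
  rw [this]
  simp

theorem chartLength_interior (F : S → E3) (p : S) : chartLength F p ((𝓡∂ 2).interior S) = 0 := by
  rw [chartLength_apply F p measurableSet_manifoldInterior]
  have : (fun t : ℝ => (extChartAt (𝓡∂ 2) p).symm !₂[0, t]) ⁻¹'
      ((𝓡∂ 2).interior S) ∩ boundaryParameters p = ∅ := by
    ext t
    simp only [mem_inter_iff, mem_preimage, mem_empty_iff_false, iff_false, not_and]
    intro h hu
    rw [symm_mem_interior_iff hu] at h
    simp at h
  rw [this]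
  simp

/-- The Hausdorff measure of the image does not involve the chart, so this yields agreement of the
chart measures on overlaps without a change of variables. Staying in the interior provides the open
domain for the area formula. -/
theorem chartArea_eq_hausdorff (hF : ContMDiff (𝓡∂ 2) 𝓘(ℝ, E3) 1 F)
    (hi : ∀ p, Function.Injective (differential F p)) {p : S} {A : Set S} (hA : MeasurableSet A)
    (hAs : A ⊆ (extChartAt (𝓡∂ 2) p).source) (hAi : A ⊆ (𝓡∂ 2).interior S) (hFA : InjOn F A) :
    chartArea F p A = (μHE[2] : Measure E3) (F '' A) := by
  rw [chartArea_apply F p hA, ← image_chartMap_preimage F hAs]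
  have h := euclideanHausdorffMeasure_image_eq_lintegral_normDet (G := chartMap F p)
    (G' := fun u => fderivWithin ℝ (chartMap F p) (range (𝓡∂ 2)) u)
    (s := (extChartAt (𝓡∂ 2) p).symm ⁻¹' A ∩ chartTarget p) (isOpen_pos_chartTarget p)
    (fun u hu => hasFDerivAt_chartMap hF hu.1 hu.2)
    ((contDiffOn_fderivWithin_chartMap (n := 0) (by simpa using hF) p).continuousOn.mono
      fun u hu => hu.1)
    (fun u hu => fderivWithin_chartMap_injective hF hi hu.1)
    (fun u hu => ⟨hu.2, (symm_mem_interior_iff hu.2).1 (hAi hu.1)⟩)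
    (measurableSet_preimage_inter_of_continuousOn (measurableSet_chartTarget p)
      (continuousOn_chart_symm p) hA) (injOn_chartMap hFA)
  rw [finrank_euclideanSpace_fin] at h
  rw [h]
  simp_rw [sqrt_gram_det_eq_normDet]

/-- The area formula for the boundary line again removes the dependence on the chart. The dimension
one appears as `Module.finrank ℝ ℝ`, the form in which that formula delivers it. -/
theorem chartLength_eq_hausdorff (hF : ContMDiff (𝓡∂ 2) 𝓘(ℝ, E3) 1 F)
    (hi : ∀ p, Function.Injective (differential F p)) {p : S} {A : Set S} (hA : MeasurableSet A)
    (hAs : A ⊆ (extChartAt (𝓡∂ 2) p).source) (hAb : A ⊆ (𝓡∂ 2).boundary S) (hFA : InjOn F A) :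
    chartLength F p A = (μHE[Module.finrank ℝ ℝ] : Measure E3) (F '' A) := by
  have himg : F '' A = (fun t : ℝ => chartMap F p !₂[0, t]) ''
      ((fun t : ℝ => (extChartAt (𝓡∂ 2) p).symm !₂[0, t]) ⁻¹' A ∩ boundaryParameters p) := by
    ext y
    constructor
    · rintro ⟨x, hx, rfl⟩
      set u := extChartAt (𝓡∂ 2) p x with hu
      have hut : u ∈ chartTarget p := (extChartAt (𝓡∂ 2) p).map_source (hAs hx)
      have hux : (extChartAt (𝓡∂ 2) p).symm u = x := (extChartAt (𝓡∂ 2) p).left_inv (hAs hx)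
      have hu0 : u 0 = 0 := (symm_mem_boundary_iff hut).1 (by rw [hux]; exact hAb hx)
      have hu' : u = !₂[0, u 1] := by
        ext i; fin_cases i <;> simp [hu0]
      refine ⟨u 1, ⟨?_, ?_⟩, ?_⟩
      · rw [mem_preimage, ← hu', hux]; exact hx
      · show !₂[0, u 1] ∈ chartTarget p
        rw [← hu']; exact hut
      · show chartMap F p !₂[0, u 1] = F x
        rw [← hu', chartMap, Function.comp_apply, hux]
    · rintro ⟨t, ⟨ht, -⟩, rfl⟩
      exact ⟨_, ht, rfl⟩
  rw [chartLength_apply F p hA, himg]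
  have h := euclideanHausdorffMeasure_image_eq_lintegral_normDet
    (G := fun t : ℝ => chartMap F p !₂[0, t])
    (G' := fun t => ContinuousLinearMap.toSpanSingleton ℝ (chartPartial F p !₂[0, t] 1))
    (s := (fun t : ℝ => (extChartAt (𝓡∂ 2) p).symm !₂[0, t]) ⁻¹' A ∩ boundaryParameters p)
    (isOpen_boundaryParameters p)
    (fun t ht => (hasDerivAt_boundary_chartMap hF ht).hasFDerivAt)
    (by
      have h1 : ContinuousOn (fun t : ℝ => fderivWithin ℝ (chartMap F p) (range (𝓡∂ 2))
          (boundaryLine t)) (boundaryParameters p) :=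
        (contDiffOn_fderivWithin_chartMap (n := 0) (by simpa using hF) p).continuousOn.comp
          boundaryLine.continuous.continuousOn fun t ht => by rw [boundaryLine_apply]; exact ht
      simp_rw [boundaryLine_apply] at h1
      have h2 := h1.clm_apply (continuousOn_const (c := (EuclideanSpace.single 1 1 : E2)))
      exact (ContinuousLinearMap.toSpanSingletonCLE (𝕜 := ℝ)
        (E := E3)).continuous.comp_continuousOn h2)
    (fun t ht => by
      intro x y hxy
      have hne : chartPartial F p !₂[0, t] 1 ≠ 0 := by
        intro h0
        have h1 := fderivWithin_chartMap_injective hF hi ht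
          (a₁ := EuclideanSpace.single 1 1) (a₂ := 0) (by rw [map_zero]; exact h0)
        have := congrArg (fun v : E2 => v 1) h1
        simp at this
      exact smul_left_injective ℝ hne hxy)
    inter_subset_right
    (measurableSet_preimage_inter_of_continuousOn (isOpen_boundaryParameters p).measurableSet
      (continuousOn_boundary_symm p) hA)
    (fun s hs t ht hst => by
      have h1 := (extChartAt (𝓡∂ 2) p).symm.injOn hs.2 ht.2 (hFA hs.1 ht.1 hst)
      simpa using congrArg (fun v : E2 => v 1) h1)
  rw [h]
  simp_rw [normDet_toSpanSingleton]

variable [CompactSpace S]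

/-- An immersion is injective on each bi-Lipschitz patch, and disjoint pieces of patches exhaust
`A`. -/
theorem eq_of_eq_on_injOn (hF : ContMDiff (𝓡∂ 2) 𝓘(ℝ, E3) 1 F)
    (hi : ∀ p, Function.Injective (differential F p)) {μ₁ μ₂ : Measure S} {A : Set S}
    (hA : MeasurableSet A) (h : ∀ B ⊆ A, MeasurableSet B → InjOn F B → μ₁ B = μ₂ B) :
    μ₁ A = μ₂ A := by
  rcases A.eq_empty_or_nonempty with rfl | ⟨x, -⟩
  · simp
  have : Nonempty S := ⟨x⟩
  obtain ⟨e, Q, hQo, hQs, hQ, hQC⟩ := exists_patch_sequence hF hi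
  have hinj : ∀ n, InjOn F (Q n) := fun n => by
    obtain ⟨C, hC⟩ := hQC n
    exact injOn_of_dist_le ((extChartAt (𝓡∂ 2) (e n)).injOn.mono (hQs n))
      fun x hx y hy => (hC x hx y hy).2
  have hm : ∀ n, MeasurableSet (A ∩ disjointed Q n) := fun n =>
    hA.inter (MeasurableSet.disjointed (fun n => (hQo n).measurableSet) n)
  have hdec : ∀ μ : Measure S, μ A = ∑' n, μ (A ∩ disjointed Q n) := by
    intro μ
    rw [← measure_iUnion (fun a b hab => (disjoint_disjointed Q hab).mono inter_subset_right
      inter_subset_right) hm, ← inter_iUnion, iUnion_disjointed, hQ, inter_univ]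
  rw [hdec μ₁, hdec μ₂]
  exact tsum_congr fun n => h _ inter_subset_left (hm n)
    ((hinj n).mono (inter_subset_right.trans (disjointed_subset Q n)))

theorem measure_eq_interior_add_boundary (μ : Measure S) (A : Set S) :
    μ A = μ (A ∩ (𝓡∂ 2).interior S) + μ (A ∩ (𝓡∂ 2).boundary S) := by
  rw [← (𝓡∂ 2).compl_interior, ← sdiff_eq, measure_inter_add_sdiff _ measurableSet_manifoldInterior]

theorem exists_chart_sequence [Nonempty S] :
    ∃ e : ℕ → S, ⋃ n, (extChartAt (𝓡∂ 2) (e n)).source = univ := by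
  obtain ⟨t, ht⟩ := isCompact_univ.elim_finite_subcover
    (fun p : S => (extChartAt (𝓡∂ 2) p).source) (fun p => isOpen_extChartAt_source p)
    fun p _ => mem_iUnion.2 ⟨p, mem_extChartAt_source p⟩
  have htne : (t : Set S).Nonempty := by
    obtain ⟨x⟩ := ‹Nonempty S›
    have := ht (mem_univ x)
    simp only [mem_iUnion] at this
    obtain ⟨i, hi, -⟩ := this
    exact ⟨i, hi⟩
  obtain ⟨e, he⟩ := t.countable_toSet.exists_eq_range htne
  refine ⟨e, eq_univ_of_univ_subset fun x hx => ?_⟩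
  have := ht hx
  simp only [mem_iUnion] at this
  obtain ⟨i, hi, hxi⟩ := this
  have hi' : i ∈ range e := he ▸ hi
  obtain ⟨n, rfl⟩ := hi'
  exact mem_iUnion.2 ⟨n, hxi⟩

/-- The gluing condition holds because chart areas ignore the boundary and, in the interior, agree
with Hausdorff measure wherever `F` is injective. -/
theorem areaMeasure_restrict [Nonempty S] (hF : ContMDiff (𝓡∂ 2) 𝓘(ℝ, E3) 1 F)
    (hi : ∀ p, Function.Injective (differential F p)) (p : S) :
    (areaMeasure F).restrict (extChartAt (𝓡∂ 2) p).source = chartArea F p := by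
  obtain ⟨e, he⟩ := exists_chart_sequence (S := S)
  refine iSup_restrict_eq_of_agree (μ := chartArea F) measurableSet_chart_source
    (chartArea_compl_source F) ?_ he p
  intro i j A hA hAi hAj
  have hb : ∀ p : S, chartArea F p A = chartArea F p (A ∩ (𝓡∂ 2).interior S) := by
    intro p
    rw [measure_eq_interior_add_boundary _ A,
      measure_mono_null inter_subset_right (chartArea_boundary F p), add_zero]
  rw [hb i, hb j]
  refine eq_of_eq_on_injOn hF hi (hA.inter measurableSet_manifoldInterior) fun B hB hBm hBi => ?_
  have h1 := hB.trans inter_subset_left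
  have h2 := hB.trans inter_subset_right
  rw [chartArea_eq_hausdorff hF hi hBm (h1.trans hAi) h2 hBi,
    chartArea_eq_hausdorff hF hi hBm (h1.trans hAj) h2 hBi]

theorem boundaryLength_restrict [Nonempty S] (hF : ContMDiff (𝓡∂ 2) 𝓘(ℝ, E3) 1 F)
    (hi : ∀ p, Function.Injective (differential F p)) (p : S) :
    (boundaryLength F).restrict (extChartAt (𝓡∂ 2) p).source = chartLength F p := by
  obtain ⟨e, he⟩ := exists_chart_sequence (S := S)
  refine iSup_restrict_eq_of_agree (μ := chartLength F) measurableSet_chart_source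
    (chartLength_compl_source F) ?_ he p
  intro i j A hA hAi hAj
  have hb : ∀ p : S, chartLength F p A = chartLength F p (A ∩ (𝓡∂ 2).boundary S) := by
    intro p
    rw [measure_eq_interior_add_boundary _ A,
      measure_mono_null inter_subset_right (chartLength_interior F p), zero_add]
  rw [hb i, hb j]
  refine eq_of_eq_on_injOn hF hi (hA.inter measurableSet_manifoldBoundary) fun B hB hBm hBi => ?_
  have h1 := hB.trans inter_subset_left
  have h2 := hB.trans inter_subset_right
  rw [chartLength_eq_hausdorff hF hi hBm (h1.trans hAi) h2 hBi,
    chartLength_eq_hausdorff hF hi hBm (h1.trans hAj) h2 hBi]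

theorem measure_eq_zero_of_charts [Nonempty S] {μ : Measure S} {A : Set S} (hA : MeasurableSet A)
    (h : ∀ p : S, μ.restrict (extChartAt (𝓡∂ 2) p).source A = 0) : μ A = 0 := by
  obtain ⟨e, he⟩ := exists_chart_sequence (S := S)
  have : A = ⋃ n, A ∩ (extChartAt (𝓡∂ 2) (e n)).source := by
    rw [← inter_iUnion, he, inter_univ]
  rw [this, measure_iUnion_null_iff]
  intro n
  rw [← Measure.restrict_apply hA]
  exact h _

theorem areaMeasure_boundary [Nonempty S] (hF : ContMDiff (𝓡∂ 2) 𝓘(ℝ, E3) 1 F)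
    (hi : ∀ p, Function.Injective (differential F p)) :
    areaMeasure F ((𝓡∂ 2).boundary S) = 0 :=
  measure_eq_zero_of_charts measurableSet_manifoldBoundary fun p => by
    rw [areaMeasure_restrict hF hi, chartArea_boundary]

theorem boundaryLength_interior [Nonempty S] (hF : ContMDiff (𝓡∂ 2) 𝓘(ℝ, E3) 1 F)
    (hi : ∀ p, Function.Injective (differential F p)) :
    boundaryLength F ((𝓡∂ 2).interior S) = 0 :=
  measure_eq_zero_of_charts measurableSet_manifoldInterior fun p => by
    rw [boundaryLength_restrict hF hi, chartLength_interior]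

theorem areaMeasure_eq_hausdorff [Nonempty S] (hF : ContMDiff (𝓡∂ 2) 𝓘(ℝ, E3) 1 F)
    (hi : ∀ p, Function.Injective (differential F p)) {p : S} {A : Set S} (hA : MeasurableSet A)
    (hAs : A ⊆ (extChartAt (𝓡∂ 2) p).source) (hAi : A ⊆ (𝓡∂ 2).interior S) (hFA : InjOn F A) :
    areaMeasure F A = (μHE[2] : Measure E3) (F '' A) := by
  rw [← chartArea_eq_hausdorff hF hi hA hAs hAi hFA, ← areaMeasure_restrict hF hi,
    Measure.restrict_apply hA, inter_eq_left.2 hAs]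

theorem isFiniteMeasure_of_charts [Nonempty S] {μ : Measure S}
    (h : ∀ p : S, ∃ N : Set S, IsOpen N ∧ p ∈ N ∧ μ N < ⊤) : IsFiniteMeasure μ := by
  have : IsLocallyFiniteMeasure μ := ⟨fun p => by
    obtain ⟨N, hN, hp, hlt⟩ := h p
    exact ⟨N, hN.mem_nhds hp, hlt⟩⟩
  exact ⟨isCompact_univ.measure_lt_top⟩

theorem lintegral_lt_top_of_continuousOn_isCompact {α : Type*} [TopologicalSpace α]
    [MeasurableSpace α] [BorelSpace α] [T2Space α] {μ : Measure α} [IsFiniteMeasureOnCompacts μ]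
    {K : Set α} (hK : IsCompact K) {f : α → ℝ} (hf : ContinuousOn f K) :
    ∫⁻ u in K, ENNReal.ofReal (f u) ∂μ < ⊤ := by
  obtain ⟨C, hC⟩ := hK.exists_bound_of_continuousOn hf
  calc ∫⁻ u in K, ENNReal.ofReal (f u) ∂μ ≤ ∫⁻ u in K, ENNReal.ofReal C ∂μ :=
        setLIntegral_mono' hK.measurableSet fun u hu =>
          ENNReal.ofReal_le_ofReal ((le_abs_self _).trans (hC u hu))
    _ = ENNReal.ofReal C * μ K := setLIntegral_const _ _
    _ < ⊤ := ENNReal.mul_lt_top ENNReal.ofReal_lt_top hK.measure_lt_top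

theorem exists_compact_chart_nhds (p : S) :
    ∃ (N : Set S) (K : Set E2), IsOpen N ∧ p ∈ N ∧ N ⊆ (extChartAt (𝓡∂ 2) p).source ∧
      IsCompact K ∧ K ⊆ chartTarget p ∧ ∀ u ∈ chartTarget p, (extChartAt (𝓡∂ 2) p).symm u ∈ N → u ∈ K := by
  obtain ⟨O, hO, h⟩ := exists_isOpen_chartTarget p
  have hp : extChartAt (𝓡∂ 2) p p ∈ O := by
    have : extChartAt (𝓡∂ 2) p p ∈ chartTarget p := mem_extChartAt_target p
    rw [h] at this
    exact this.1
  obtain ⟨r, hr, hrO⟩ := Metric.nhds_basis_closedBall.mem_iff.1 (hO.mem_nhds hp)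
  refine ⟨(extChartAt (𝓡∂ 2) p).source ∩ extChartAt (𝓡∂ 2) p ⁻¹'
    Metric.ball (extChartAt (𝓡∂ 2) p p) r, Metric.closedBall (extChartAt (𝓡∂ 2) p p) r ∩
    range (𝓡∂ 2), ?_, ⟨mem_extChartAt_source p, Metric.mem_ball_self hr⟩, inter_subset_left,
    (isCompact_closedBall _ _).inter_right (𝓡∂ 2).isClosed_range, ?_, ?_⟩
  · simp only [extChartAt_source]
    exact isOpen_extChartAt_preimage p Metric.isOpen_ball
  · rw [h]
    exact inter_subset_inter_left _ hrO
  · rintro u hu ⟨-, hN⟩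
    rw [mem_preimage, (extChartAt (𝓡∂ 2) p).right_inv hu] at hN
    exact ⟨Metric.ball_subset_closedBall hN, chartTarget_subset p hu⟩

theorem continuousOn_chartPartial (hF : ContMDiff (𝓡∂ 2) 𝓘(ℝ, E3) 1 F) (p : S) (i : Fin 2) :
    ContinuousOn (fun u => chartPartial F p u i) (chartTarget p) :=
  (contDiffOn_fderivWithin_chartMap (n := 0) (by simpa using hF) p).continuousOn.clm_apply
    continuousOn_const

theorem continuousOn_sqrt_gram_det (hF : ContMDiff (𝓡∂ 2) 𝓘(ℝ, E3) 1 F) (p : S) :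
    ContinuousOn (fun u => √(Matrix.gram ℝ (chartPartial F p u)).det) (chartTarget p) := by
  simp_rw [sqrt_gram_det_eq_normDet]
  exact continuous_normDet.comp_continuousOn
    (contDiffOn_fderivWithin_chartMap (n := 0) (by simpa using hF) p).continuousOn

theorem continuousOn_norm_boundary_chartPartial (hF : ContMDiff (𝓡∂ 2) 𝓘(ℝ, E3) 1 F) (p : S) :
    ContinuousOn (fun t : ℝ => chartPartial F p !₂[0, t] 1) (boundaryParameters p) := by
  have h1 := (continuousOn_chartPartial hF p 1).comp
    (s := boundaryParameters p) boundaryLine.continuous.continuousOn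
    (fun t ht => by rw [boundaryLine_apply]; exact ht)
  simpa [Function.comp_def, boundaryLine_apply] using h1

theorem isFiniteMeasure_areaMeasure [Nonempty S] (hF : ContMDiff (𝓡∂ 2) 𝓘(ℝ, E3) 1 F)
    (hi : ∀ p, Function.Injective (differential F p)) : IsFiniteMeasure (areaMeasure F) := by
  refine isFiniteMeasure_of_charts fun p => ?_
  obtain ⟨N, K, hN, hpN, hNs, hK, hKt, hNK⟩ := exists_compact_chart_nhds p
  refine ⟨N, hN, hpN, ?_⟩
  rw [← inter_eq_left.2 hNs, ← Measure.restrict_apply hN.measurableSet,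
    areaMeasure_restrict hF hi, chartArea_apply F p hN.measurableSet]
  refine lt_of_le_of_lt (lintegral_mono_set fun u hu => hNK u hu.2 hu.1)
    (lintegral_lt_top_of_continuousOn_isCompact hK ((continuousOn_sqrt_gram_det hF p).mono hKt))

theorem isFiniteMeasure_boundaryLength [Nonempty S] (hF : ContMDiff (𝓡∂ 2) 𝓘(ℝ, E3) 1 F)
    (hi : ∀ p, Function.Injective (differential F p)) : IsFiniteMeasure (boundaryLength F) := by
  refine isFiniteMeasure_of_charts fun p => ?_
  obtain ⟨N, K, hN, hpN, hNs, hK, hKt, hNK⟩ := exists_compact_chart_nhds p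
  refine ⟨N, hN, hpN, ?_⟩
  rw [← inter_eq_left.2 hNs, ← Measure.restrict_apply hN.measurableSet,
    boundaryLength_restrict hF hi, chartLength_apply F p hN.measurableSet]
  have hiso : Isometry boundaryLine := by
    refine AddMonoidHomClass.isometry_of_norm _ fun t => ?_
    simp [boundaryLine, norm_smul]
  have hK' : IsCompact (boundaryLine ⁻¹' K) := hiso.isClosedEmbedding.isCompact_preimage hK
  refine lt_of_le_of_lt (lintegral_mono_set (t := boundaryLine ⁻¹' K) fun t ht => ?_)
    (lintegral_lt_top_of_continuousOn_isCompact hK'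
      ((continuousOn_norm_boundary_chartPartial hF p).norm.mono fun t ht => ?_))
  · rw [mem_preimage, boundaryLine_apply]
    exact hNK _ ht.2 ht.1
  · have := hKt ht
    rwa [boundaryLine_apply] at this

/-- Integrals over a chart domain with respect to the area measure. -/
theorem integral_areaMeasure_of_support [Nonempty S] (hF : ContMDiff (𝓡∂ 2) 𝓘(ℝ, E3) 1 F)
    (hi : ∀ p, Function.Injective (differential F p)) (p : S) {f : S → ℝ}
    (hf : AEStronglyMeasurable f (areaMeasure F))
    (hs : ∀ x ∉ (extChartAt (𝓡∂ 2) p).source, f x = 0) :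
    ∫ x, f x ∂(areaMeasure F) = ∫ u in chartTarget p,
      √(Matrix.gram ℝ (chartPartial F p u)).det * f ((extChartAt (𝓡∂ 2) p).symm u) := by
  rw [← setIntegral_eq_integral_of_forall_compl_eq_zero hs, areaMeasure_restrict hF hi]
  have hf' : AEStronglyMeasurable f (chartArea F p) := by
    rw [← areaMeasure_restrict hF hi]; exact hf.restrict
  have hd : AEMeasurable (fun u => ENNReal.ofReal √(Matrix.gram ℝ (chartPartial F p u)).det)
      (volume.restrict (chartTarget p)) :=
    (aemeasurable_restrict_of_continuousOn (measurableSet_chartTarget p)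
      (continuousOn_sqrt_gram_det hF p)).ennreal_ofReal
  rw [chartArea, integral_map ((aemeasurable_restrict_of_continuousOn
    (measurableSet_chartTarget p) (continuousOn_chart_symm p)).mono_ac
    (withDensity_absolutelyContinuous _ _)) hf',
    integral_withDensity_eq_integral_toReal_smul₀ hd (Filter.Eventually.of_forall fun _ =>
      ENNReal.ofReal_lt_top)]
  refine integral_congr_ae (Filter.Eventually.of_forall fun u => ?_)
  simp only [smul_eq_mul]
  rw [ENNReal.toReal_ofReal (Real.sqrt_nonneg _)]

/-- Integrals over a chart domain with respect to the boundary length. -/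
theorem integral_boundaryLength_of_support [Nonempty S] (hF : ContMDiff (𝓡∂ 2) 𝓘(ℝ, E3) 1 F)
    (hi : ∀ p, Function.Injective (differential F p)) (p : S) {f : S → ℝ}
    (hf : AEStronglyMeasurable f (chartLength F p))
    (hs : ∀ x ∉ (extChartAt (𝓡∂ 2) p).source, f x = 0) :
    ∫ x, f x ∂(boundaryLength F) = ∫ t in boundaryParameters p,
      ‖chartPartial F p !₂[0, t] 1‖ * f ((extChartAt (𝓡∂ 2) p).symm !₂[0, t]) := by
  rw [← setIntegral_eq_integral_of_forall_compl_eq_zero hs, boundaryLength_restrict hF hi]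
  have hm := (isOpen_boundaryParameters p).measurableSet
  have hd : AEMeasurable (fun t : ℝ => ENNReal.ofReal ‖chartPartial F p !₂[0, t] 1‖)
      (volume.restrict (boundaryParameters p)) :=
    (aemeasurable_restrict_of_continuousOn hm
      (continuousOn_norm_boundary_chartPartial hF p).norm).ennreal_ofReal
  rw [chartLength, integral_map ((aemeasurable_restrict_of_continuousOn hm
    (continuousOn_boundary_symm p)).mono_ac (withDensity_absolutelyContinuous _ _)) hf,
    integral_withDensity_eq_integral_toReal_smul₀ hd (Filter.Eventually.of_forall fun _ =>
      ENNReal.ofReal_lt_top)]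
  refine integral_congr_ae (Filter.Eventually.of_forall fun u => ?_)
  simp only [smul_eq_mul]
  rw [ENNReal.toReal_ofReal (norm_nonneg _)]

end Glue


/-! ### Density points and tangent planes -/

/-- A set of density one at `x` meets every rescaled ball `x + r B` for small `r`. Shrinking `B` to
a point `y` shows that every `y` belongs to the tangent cone. -/
theorem uniqueDiffWithinAt_of_density_one {E : Type*} [NormedAddCommGroup E] [NormedSpace ℝ E]
    [MeasurableSpace E] [BorelSpace E] [FiniteDimensional ℝ E] (μ : Measure E) [μ.IsAddHaarMeasure]
    {s : Set E} {x : E} (hx : x ∈ s)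
    (h : Tendsto (fun r => μ (s ∩ Metric.closedBall x r) / μ (Metric.closedBall x r)) (𝓝[>] 0)
      (𝓝 1)) : UniqueDiffWithinAt ℝ s x := by
  have hall : tangentConeAt ℝ s x = univ := by
    refine eq_univ_of_forall fun y => ?_
    have hex : ∀ n : ℕ, ∃ (r : ℝ) (t : E), 0 < r ∧ r < 1 / (n + 1 : ℝ) ∧
        dist t y ≤ 1 / (n + 1 : ℝ) ∧ x + r • t ∈ s := by
      intro n
      have hn : (0 : ℝ) < 1 / (n + 1 : ℝ) := by positivity
      have he := Measure.eventually_nonempty_inter_smul_of_density_one μ s x h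
        (Metric.closedBall y (1 / (n + 1 : ℝ))) Metric.isClosed_closedBall.measurableSet
        (Metric.measure_closedBall_pos μ y hn).ne'
      have hlt : ∀ᶠ r in 𝓝[>] (0 : ℝ), r < 1 / (n + 1 : ℝ) :=
        nhdsWithin_le_nhds (eventually_lt_nhds hn)
      obtain ⟨r, ⟨⟨z, hzs, hz⟩, hr⟩, hr0⟩ := ((he.and hlt).and self_mem_nhdsWithin).exists
      obtain ⟨a, ha, b, ⟨t, ht, rfl⟩, rfl⟩ := hz
      rw [mem_singleton_iff] at ha
      subst ha
      exact ⟨r, t, hr0, hr, ht, hzs⟩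
    choose r t hr0 hr ht hs using hex
    have hone := tendsto_one_div_add_atTop_nhds_zero_nat (𝕜 := ℝ)
    have htt : Tendsto t atTop (𝓝 y) := tendsto_iff_dist_tendsto_zero.2
      (squeeze_zero (fun _ => dist_nonneg) ht hone)
    have hrt : Tendsto r atTop (𝓝 0) := squeeze_zero (fun n => (hr0 n).le) (fun n => (hr n).le) hone
    refine mem_tangentConeAt_of_seq (α := ℕ) atTop (fun n => (r n)⁻¹) (fun n => r n • t n) ?_
      (Eventually.of_forall hs) ?_
    · simpa using hrt.smul htt
    · refine htt.congr fun n => ?_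
      rw [smul_smul, inv_mul_cancel₀ (hr0 n).ne', one_smul]
  refine ⟨?_, subset_closure hx⟩
  rw [hall, Submodule.span_univ]
  exact dense_univ

/-- This is Lebesgue's density theorem. Measurability of `s` is not needed, so it applies directly
to the set where two sheets of the surface coincide. -/
theorem ae_uniqueDiffWithinAt {E : Type*} [NormedAddCommGroup E] [NormedSpace ℝ E]
    [MeasurableSpace E] [BorelSpace E] [FiniteDimensional ℝ E] (μ : Measure E) [μ.IsAddHaarMeasure]
    (s : Set E) : μ {x | x ∈ s ∧ ¬ UniqueDiffWithinAt ℝ s x} = 0 := by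
  have h := Besicovitch.ae_tendsto_measure_inter_div μ s
  rw [ae_iff] at h
  refine le_antisymm (le_trans ?_ ((Measure.le_restrict_apply s _).trans h.le)) zero_le
  exact measure_mono fun x hx => ⟨fun hd => hx.2 (uniqueDiffWithinAt_of_density_one μ hx.1 hd), hx.1⟩

/-- If two parametrizations agree along a set with the unique differentiability property, then a
linear form that vanishes on the image of one differential vanishes on that of the other. -/
theorem comp_fderiv_eq_zero_of_reparametrization {E E' W : Type*} [NormedAddCommGroup E]
    [NormedSpace ℝ E] [NormedAddCommGroup E'] [NormedSpace ℝ E'] [NormedAddCommGroup W]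
    [NormedSpace ℝ W] {D : Set E} {T : Set E'} {G : E → W} {G' : E' → W} {A : E →L[ℝ] W}
    {B : E' →L[ℝ] W} {h : E → E'} {u : E} {C : NNReal} (hD : UniqueDiffWithinAt ℝ D u)
    (hG : HasFDerivWithinAt G A D u) (hG' : HasFDerivWithinAt G' B T (h u)) (hu : u ∈ D)
    (hT : ∀ w ∈ D, h w ∈ T) (hGh : ∀ w ∈ D, G' (h w) = G w)
    (hC : ∀ w ∈ D, dist (h w) (h u) ≤ C * dist (G w) (G u)) (ℓ : W →L[ℝ] ℝ) (hℓ : ℓ ∘L B = 0) :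
    ℓ ∘L A = 0 := by
  -- The change of parameters is controlled by the parametrized points, so `h w - h u = O(w - u)`.
  -- The little-o expansion of `ℓ ∘ G'` at `h u` therefore pulls back along `h`, and `ℓ ∘ G` has
  -- derivative zero; unique differentiability compares it with `ℓ ∘ A`.
  have hO : (fun w => h w - h u) =O[𝓝[D] u] fun w => w - u := by
    have h1 : (fun w => h w - h u) =O[𝓝[D] u] fun w => G w - G u := by
      refine Asymptotics.IsBigO.of_bound C ?_
      filter_upwards [self_mem_nhdsWithin] with w hw
      simpa [dist_eq_norm] using hC w hw
    exact h1.trans hG.isBigO_sub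
  have hcont : Tendsto h (𝓝[D] u) (𝓝[T] (h u)) := by
    refine tendsto_nhdsWithin_iff.2 ⟨?_, eventually_mem_nhdsWithin.mono hT⟩
    rw [tendsto_iff_norm_sub_tendsto_zero]
    refine (hO.norm_left).trans_tendsto ?_
    have : Tendsto (fun w => w - u) (𝓝[D] u) (𝓝 (u - u)) :=
      (tendsto_id.sub_const u).mono_left nhdsWithin_le_nhds
    simpa using this
  have h2 : HasFDerivWithinAt (fun v => ℓ (G' v)) (ℓ ∘L B) T (h u) :=
    ℓ.hasFDerivAt.comp_hasFDerivWithinAt _ hG'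
  rw [hℓ] at h2
  have h3 := (h2.isLittleO.comp_tendsto hcont).trans_isBigO hO
  have h4 : HasFDerivWithinAt (fun w => ℓ (G w)) (0 : E →L[ℝ] ℝ) D u := by
    refine HasFDerivWithinAt.of_isLittleO (h3.congr' ?_ (EventuallyEq.refl _ _))
    filter_upwards [self_mem_nhdsWithin] with w hw
    simp [Function.comp_apply, hGh w hw, hGh u hu]
  exact hD.eq (ℓ.hasFDerivAt.comp_hasFDerivWithinAt _ hG) h4

/-! ### Integrals over linear images -/

theorem integral_range_eq_normDet_mul {A : E2 →L[ℝ] E3} (hA : Function.Injective A) (f : E3 → ℝ) :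
    ∫ y in range A, f y ∂(μHE[2] : Measure E3) =
      (A : E2 →ₗ[ℝ] E3).normDet * ∫ v, f (A v) := by
  have hemb : MeasurableEmbedding A :=
    (LinearMap.isClosedEmbedding_of_injective (f := (A : E2 →ₗ[ℝ] E3))
      (LinearMap.ker_eq_bot.2 hA)).measurableEmbedding
  have hmap : (μHE[2] : Measure E3).restrict (range A) =
      ENNReal.ofReal (A : E2 →ₗ[ℝ] E3).normDet • (volume : Measure E2).map A := by
    ext B hB
    rw [Measure.restrict_apply hB, Measure.smul_apply, hemb.map_apply, ← image_preimage_eq_inter_range]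
    have h := (A : E2 →ₗ[ℝ] E3).euclideanHausdorffMeasure_image_eq_normDet_mul_volume (A ⁻¹' B)
    rw [finrank_euclideanSpace_fin] at h
    exact h
  rw [hmap, integral_smul_measure, hemb.integral_map,
    ENNReal.toReal_ofReal (LinearMap.normDet_nonneg _), smul_eq_mul]


/-! ### The image of the surface: rectifiability, fibres and multiplicity. -/

section ImageMeasure

variable {S : Type*} [TopologicalSpace S] [ChartedSpace (EuclideanHalfSpace 2) S]
  [IsManifold (𝓡∂ 2) ∞ S] [CompactSpace S] {F ν : S → E3} {θ : ℝ}

theorem IsCountablyTwoRectifiable.mono {M N : Set E3} (hN : IsCountablyTwoRectifiable N)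
    (h : M ⊆ N) : IsCountablyTwoRectifiable M := by
  obtain ⟨f, hf, h0⟩ := hN
  exact ⟨f, hf, measure_mono_null (sdiff_subset_sdiff_left h) h0⟩

theorem isCountablyTwoRectifiable_range [Nonempty S] (hF : ContMDiff (𝓡∂ 2) 𝓘(ℝ, E3) 1 F)
    (hi : ∀ p, Function.Injective (differential F p)) : IsCountablyTwoRectifiable (range F) := by
  obtain ⟨e, Q, -, hQs, hQu, hQC⟩ := exists_patch_sequence hF hi
  have hext : ∀ n, ∃ g : E2 → E3, (∃ K, LipschitzWith K g) ∧ F '' Q n ⊆ range g := by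
    intro n
    obtain ⟨C, hC⟩ := hQC n
    have hL : LipschitzOnWith C (chartMap F (e n)) (extChartAt (𝓡∂ 2) (e n) '' Q n) := by
      refine LipschitzOnWith.of_dist_le_mul ?_
      rintro _ ⟨x, hx, rfl⟩ _ ⟨y, hy, rfl⟩
      simp only [chartMap, Function.comp_apply, (extChartAt (𝓡∂ 2) (e n)).left_inv (hQs n hx),
        (extChartAt (𝓡∂ 2) (e n)).left_inv (hQs n hy)]
      exact (hC x hx y hy).1
    obtain ⟨g, hg, hgE⟩ := hL.extend_finite_dimension
    refine ⟨g, ⟨_, hg⟩, ?_⟩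
    rintro _ ⟨x, hx, rfl⟩
    refine ⟨extChartAt (𝓡∂ 2) (e n) x, ?_⟩
    rw [← hgE (mem_image_of_mem _ hx)]
    simp only [chartMap, Function.comp_apply, (extChartAt (𝓡∂ 2) (e n)).left_inv (hQs n hx)]
  choose g hg hgr using hext
  refine ⟨g, hg, ?_⟩
  have : range F \ ⋃ j, range (g j) = ∅ := by
    rw [sdiff_eq_empty, ← image_univ, ← hQu, image_iUnion]
    exact iUnion_mono hgr
  rw [this, measure_empty]

theorem hausdorff_image_eq_zero {p : S} {A : Set S} (hA : A ⊆ (extChartAt (𝓡∂ 2) p).source)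
    {C : NNReal} (hC : ∀ x ∈ A, ∀ y ∈ A,
      dist (F x) (F y) ≤ C * dist (extChartAt (𝓡∂ 2) p x) (extChartAt (𝓡∂ 2) p y))
    (h0 : volume (extChartAt (𝓡∂ 2) p '' A) = 0) : (μHE[2] : Measure E3) (F '' A) = 0 := by
  have himg : F '' A = chartMap F p '' (extChartAt (𝓡∂ 2) p '' A) := by
    rw [image_image]
    refine image_congr fun x hx => ?_
    simp only [chartMap, Function.comp_apply, (extChartAt (𝓡∂ 2) p).left_inv (hA hx)]
  rw [himg]
  refine euclideanHausdorffMeasure_image_null_of_dist_le (K := C) ?_ ?_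
  · rintro _ ⟨x, hx, rfl⟩ _ ⟨y, hy, rfl⟩
    simp only [chartMap, Function.comp_apply, (extChartAt (𝓡∂ 2) p).left_inv (hA hx),
      (extChartAt (𝓡∂ 2) p).left_inv (hA hy)]
    exact hC x hx y hy
  · rwa [EuclideanSpace.euclideanHausdorffMeasure_eq_volume 2]

theorem hausdorff_image_boundary [Nonempty S] (hF : ContMDiff (𝓡∂ 2) 𝓘(ℝ, E3) 1 F)
    (hi : ∀ p, Function.Injective (differential F p)) :
    (μHE[2] : Measure E3) (F '' (𝓡∂ 2).boundary S) = 0 := by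
  obtain ⟨e, Q, -, hQs, hQu, hQC⟩ := exists_patch_sequence hF hi
  rw [← inter_univ ((𝓡∂ 2).boundary S), ← hQu, inter_iUnion, image_iUnion]
  refine measure_iUnion_null fun n => ?_
  obtain ⟨C, hC⟩ := hQC n
  refine hausdorff_image_eq_zero (inter_subset_right.trans (hQs n))
    (fun x hx y hy => (hC x hx.2 y hy.2).1) (measure_mono_null ?_ volume_coord_zero_eq_zero)
  rintro _ ⟨x, hx, rfl⟩
  have ht := (extChartAt (𝓡∂ 2) (e n)).map_source (hQs n hx.2)
  refine (symm_mem_boundary_iff ht).1 ?_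
  rw [(extChartAt (𝓡∂ 2) (e n)).left_inv (hQs n hx.2)]
  exact hx.1

/-- Finitely many patches cover the surface, and each contains at most one preimage of `x`. -/
theorem finite_fiber [Nonempty S] (hF : ContMDiff (𝓡∂ 2) 𝓘(ℝ, E3) 1 F)
    (hi : ∀ p, Function.Injective (differential F p)) (x : E3) : (F ⁻¹' {x}).Finite := by
  obtain ⟨e, Q, hQo, hQs, hQu, hQC⟩ := exists_patch_sequence hF hi
  obtain ⟨t, ht⟩ := isCompact_univ.elim_finite_subcover Q hQo hQu.ge
  have hsub : F ⁻¹' {x} ⊆ ⋃ n ∈ t, (F ⁻¹' {x} ∩ Q n) := by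
    intro q hq
    have := ht (mem_univ q)
    simp only [mem_iUnion] at this ⊢
    obtain ⟨n, hn, hqn⟩ := this
    exact ⟨n, hn, hq, hqn⟩
  refine (t.finite_toSet.biUnion fun n _ => ?_).subset hsub
  obtain ⟨C, hC⟩ := hQC n
  have hinj : InjOn F (Q n) := injOn_of_dist_le
    ((extChartAt (𝓡∂ 2) (e n)).injOn.mono (hQs n)) fun a ha b hb => (hC a ha b hb).2
  refine Set.Subsingleton.finite fun a ha b hb => hinj ha.2 hb.2 ?_
  rw [mem_singleton_iff.1 ha.1, mem_singleton_iff.1 hb.1]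

/-- Height separates interior from boundary points. The image of the interior is thus a compact set
minus a closed set, hence Borel. -/
theorem IsCapillaryImmersion.image_interior (hF : IsCapillaryImmersion θ F ν) :
    F '' (𝓡∂ 2).interior S = range F \ boundaryPlane := by
  ext x
  constructor
  · rintro ⟨p, hp, rfl⟩
    exact ⟨mem_range_self p, fun h => (hF.interior_pos p hp).ne' h⟩
  · rintro ⟨⟨p, rfl⟩, hp⟩
    refine ⟨p, ?_, rfl⟩
    rw [hF.mem_boundaryPlane_iff, ← ModelWithCorners.compl_interior] at hp
    exact not_not.1 hp

theorem isClosed_boundaryPlane : IsClosed boundaryPlane :=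
  isClosed_eq (by fun_prop) continuous_const

theorem IsCapillaryImmersion.measurableSet_image_interior (hF : IsCapillaryImmersion θ F ν) :
    MeasurableSet (F '' (𝓡∂ 2).interior S) := by
  rw [hF.image_interior]
  exact (isCompact_range hF.contMDiff.continuous).isClosed.measurableSet.diff
    isClosed_boundaryPlane.measurableSet

variable [MeasurableSpace S] [BorelSpace S]

theorem measurableSet_image_of_injOn (hF : ContMDiff (𝓡∂ 2) 𝓘(ℝ, E3) 1 F) {p : S} {A : Set S}
    (hA : MeasurableSet A) (hAs : A ⊆ (extChartAt (𝓡∂ 2) p).source) (hFA : InjOn F A) :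
    MeasurableSet (F '' A) := by
  rw [← image_chartMap_preimage F hAs]
  exact (measurableSet_preimage_inter_of_continuousOn (measurableSet_chartTarget p)
    (continuousOn_chart_symm p) hA).image_of_continuousOn_injOn
    (((contDiffOn_chartMap hF p).continuousOn).mono inter_subset_right) (injOn_chartMap hFA)

/-- The number of preimages under `F`. -/
def fiberCount (F : S → E3) (x : E3) : ℝ := (F ⁻¹' {x}).ncard

variable [T2Space S]

/-- Each piece contains at most one preimage of a point, so the indicators of the images of the
pieces add up to the cardinality of the fibre. -/
theorem IsCapillaryImmersion.exists_partition [Nonempty S] (hF : IsCapillaryImmersion θ F ν) :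
    ∃ (e : ℕ → S) (B : ℕ → Set S), (∀ n, MeasurableSet (B n)) ∧
      Pairwise (Function.onFun Disjoint B) ∧ (∀ n, B n ⊆ (extChartAt (𝓡∂ 2) (e n)).source) ∧
      ⋃ n, B n = (𝓡∂ 2).interior S ∧ (∀ n, InjOn F (B n)) ∧ (∀ n, MeasurableSet (F '' B n)) ∧
      ∀ x ∈ F '' (𝓡∂ 2).interior S,
        ENNReal.ofReal (fiberCount F x) = ∑' n, (F '' B n).indicator 1 x := by
  have hc := hF.contMDiff_one
  obtain ⟨e, Q, hQo, hQs, hQu, hQC⟩ := exists_patch_sequence hc hF.immersion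
  have hQi : ∀ n, InjOn F (Q n) := fun n => by
    obtain ⟨C, hC⟩ := hQC n
    exact injOn_of_dist_le ((extChartAt (𝓡∂ 2) (e n)).injOn.mono (hQs n))
      fun a ha b hb => (hC a ha b hb).2
  set B : ℕ → Set S := fun n => disjointed Q n ∩ (𝓡∂ 2).interior S with hB
  have hBm : ∀ n, MeasurableSet (B n) := fun n =>
    (MeasurableSet.disjointed (fun n => (hQo n).measurableSet) n).inter measurableSet_manifoldInterior
  have hBd : Pairwise (Function.onFun Disjoint B) := fun a b hab =>
    (disjoint_disjointed Q hab).mono inter_subset_left inter_subset_left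
  have hBQ : ∀ n, B n ⊆ Q n := fun n => inter_subset_left.trans (disjointed_subset _ _)
  have hBu : ⋃ n, B n = (𝓡∂ 2).interior S := by
    rw [hB, ← iUnion_inter, iUnion_disjointed, hQu, univ_inter]
  have hBi : ∀ n, InjOn F (B n) := fun n => (hQi n).mono (hBQ n)
  have hFB : ∀ n, MeasurableSet (F '' B n) := fun n =>
    measurableSet_image_of_injOn hc (hBm n) ((hBQ n).trans (hQs n)) (hBi n)
  refine ⟨e, B, hBm, hBd, fun n => (hBQ n).trans (hQs n), hBu, hBi, hFB, fun x hx => ?_⟩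
  have hfin := finite_fiber hc hF.immersion x
  have hsub : F ⁻¹' {x} ⊆ (𝓡∂ 2).interior S := by
    intro q hq
    rw [hF.image_interior] at hx
    rw [← mem_singleton_iff.1 (mem_preimage.1 hq)] at hx
    have := hx.2
    rw [hF.mem_boundaryPlane_iff, ← ModelWithCorners.compl_interior] at this
    exact not_not.1 this
  have h1 : ENNReal.ofReal (fiberCount F x) = Measure.count (F ⁻¹' {x}) := by
    rw [Measure.count_apply_finite _ hfin, fiberCount, ENNReal.ofReal_natCast,
      ncard_eq_toFinset_card _ hfin]
  rw [h1, ← inter_eq_left.2 hsub, ← hBu, inter_iUnion,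
    measure_iUnion (fun a b hab => (hBd hab).mono inter_subset_right inter_subset_right)
      fun n => hfin.measurableSet.inter (hBm n)]
  refine tsum_congr fun n => ?_
  by_cases hn : x ∈ F '' B n
  · obtain ⟨q, hq, rfl⟩ := hn
    have : F ⁻¹' {F q} ∩ B n = {q} := by
      ext q'
      refine ⟨fun h => hBi n h.2 hq h.1, ?_⟩
      rintro rfl
      exact ⟨rfl, hq⟩
    rw [this, Measure.count_singleton, indicator_of_mem (mem_image_of_mem _ hq), Pi.one_apply]
  · have : F ⁻¹' {x} ∩ B n = ∅ := by
      refine eq_empty_of_forall_notMem fun q hq => hn ⟨q, hq.2, hq.1⟩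
    rw [this, measure_empty, indicator_of_notMem hn]

/-- The image of the area measure is the two-dimensional Hausdorff measure weighted with the number
of preimages. -/
theorem IsCapillaryImmersion.map_areaMeasure [Nonempty S] (hF : IsCapillaryImmersion θ F ν) :
    (areaMeasure F).map F = weightedArea (F '' (𝓡∂ 2).interior S) (fiberCount F) := by
  have hc := hF.contMDiff_one
  obtain ⟨e, B, hBm, hBd, hBs, hBu, hBi, hFB, hcount⟩ := hF.exists_partition
  have hFm : Measurable F := hF.contMDiff.continuous.measurable
  ext A hA
  rw [Measure.map_apply hFm hA, weightedArea, withDensity_apply _ hA,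
    measure_eq_interior_add_boundary, measure_mono_null inter_subset_right
      (areaMeasure_boundary hc hF.immersion), add_zero, ← hBu, inter_iUnion,
    measure_iUnion (fun a b hab => (hBd hab).mono inter_subset_right inter_subset_right)
      fun n => (hFm hA).inter (hBm n), Measure.restrict_restrict hA, hBu]
  rw [setLIntegral_congr_fun (hA.inter hF.measurableSet_image_interior) fun x hx => hcount x hx.2,
    lintegral_tsum fun n => (measurable_one.indicator (hFB n)).aemeasurable]
  refine tsum_congr fun n => ?_
  rw [lintegral_indicator_one (hFB n), Measure.restrict_apply (hFB n),
    areaMeasure_eq_hausdorff hc hF.immersion ((hFm hA).inter (hBm n))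
      (inter_subset_right.trans (hBs n))
      (inter_subset_right.trans (hBu ▸ subset_iUnion B n)) ((hBi n).mono inter_subset_right)]
  congr 1
  ext y
  constructor
  · rintro ⟨q, ⟨hqA, hqB⟩, rfl⟩
    exact ⟨mem_image_of_mem _ hqB, hqA, mem_image_of_mem _ (hBu ▸ mem_iUnion_of_mem n hqB)⟩
  · rintro ⟨⟨q, hq, rfl⟩, hqA, -⟩
    exact mem_image_of_mem _ ⟨hqA, hq⟩

theorem IsCapillaryImmersion.integrable_fiberCount [Nonempty S] (hF : IsCapillaryImmersion θ F ν) :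
    Integrable (fiberCount F) ((μHE[2] : Measure E3).restrict (F '' (𝓡∂ 2).interior S)) := by
  obtain ⟨e, B, -, -, -, -, -, hFB, hcount⟩ := hF.exists_partition
  have hnonneg : ∀ x, 0 ≤ fiberCount F x := fun x => Nat.cast_nonneg _
  have hm : Measurable fun x => ∑' n, (F '' B n).indicator (1 : E3 → ENNReal) x :=
    Measurable.tsum fun n => measurable_one.indicator (hFB n)
  refine ⟨?_, ?_⟩
  · refine AEMeasurable.aestronglyMeasurable
      ⟨fun x => (∑' n, (F '' B n).indicator (1 : E3 → ENNReal) x).toReal, hm.ennreal_toReal, ?_⟩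
    filter_upwards [ae_restrict_mem hF.measurableSet_image_interior] with x hx
    rw [← hcount x hx, ENNReal.toReal_ofReal (hnonneg x)]
  · have := isFiniteMeasure_areaMeasure hF.contMDiff_one hF.immersion
    have h : (areaMeasure F).map F univ < ⊤ := measure_lt_top _ _
    rw [hF.map_areaMeasure, weightedArea, withDensity_apply _ MeasurableSet.univ,
      Measure.restrict_univ] at h
    rw [hasFiniteIntegral_iff_ofReal (Eventually.of_forall hnonneg)]
    exact h

end ImageMeasure


/-! ### Blow-ups of the image measure -/

section BlowUp

variable {S : Type*} [TopologicalSpace S] [ChartedSpace (EuclideanHalfSpace 2) S]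
  [IsManifold (𝓡∂ 2) ∞ S] [CompactSpace S] {F ν : S → E3} {θ : ℝ}

theorem chartTarget_mem_nhds {p : S} (hp : p ∈ (𝓡∂ 2).interior S) :
    chartTarget p ∈ 𝓝 (extChartAt (𝓡∂ 2) p p) := by
  have hu := (extChartAt (𝓡∂ 2) p).map_source (mem_extChartAt_source p)
  have hpos : 0 < extChartAt (𝓡∂ 2) p p 0 := by
    rw [← symm_mem_interior_iff hu, extChartAt_to_inv]
    exact hp
  exact mem_of_superset ((isOpen_pos_chartTarget p).mem_nhds ⟨hu, hpos⟩) fun u hu => hu.1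

variable [MeasurableSpace S] [BorelSpace S]

/-- Substituting `u = u₀ + r v` in the chart turns the blow-up into an integral over `v` that
converges to `J u₀` times the integral of `f (A v)`, an integral over the tangent plane. All small
open `U` are allowed so that neighbourhoods of different preimages can later be made disjoint. -/
theorem tendsto_blowUp_patch [Nonempty S] (hF : ContMDiff (𝓡∂ 2) 𝓘(ℝ, E3) 1 F)
    (hi : ∀ p, Function.Injective (differential F p)) {p : S} (hp : p ∈ (𝓡∂ 2).interior S) :
    ∃ N : Set S, IsOpen N ∧ p ∈ N ∧ ∀ U : Set S, IsOpen U → p ∈ U → U ⊆ N →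
      ∀ f : E3 → ℝ, Continuous f → HasCompactSupport f →
        Tendsto (fun r : ℝ => (r ^ 2)⁻¹ * ∫ q in U, f (r⁻¹ • (F q - F p)) ∂(areaMeasure F))
          (𝓝[>] 0) (𝓝 (∫ y in ((tangentPlane F hi p).1 : Set E3), f y ∂(μHE[2] : Measure E3))) := by
  obtain ⟨ρ, hρ, C, hsub, hC⟩ := exists_biLipschitz_patch hF hi p
  set u₀ := extChartAt (𝓡∂ 2) p p with hu₀
  have hu₀T : u₀ ∈ chartTarget p := (extChartAt (𝓡∂ 2) p).map_source (mem_extChartAt_source p)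
  have hψu₀ : (extChartAt (𝓡∂ 2) p).symm u₀ = p := extChartAt_to_inv p
  have hpos : 0 < u₀ 0 := by
    rw [← symm_mem_interior_iff hu₀T, hψu₀]
    exact hp
  have hGu₀ : chartMap F p u₀ = F p := by simp only [chartMap, Function.comp_apply, hψu₀]
  set K : Set E2 := Metric.closedBall u₀ (ρ / 2) ∩ range (𝓡∂ 2) with hK
  have hKT : K ⊆ chartTarget p := fun u hu =>
    hsub ⟨Metric.closedBall_subset_ball (half_lt_self hρ) hu.1, hu.2⟩
  have hKc : IsCompact K := (isCompact_closedBall _ _).inter_right (𝓡∂ 2).isClosed_range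
  set J : E2 → ℝ := fun u => √(Matrix.gram ℝ (chartPartial F p u)).det with hJ
  have hJc : ContinuousOn J (chartTarget p) := continuousOn_sqrt_gram_det hF p
  obtain ⟨M, hM⟩ := hKc.exists_bound_of_continuousOn (hJc.mono hKT)
  set A : E2 →L[ℝ] E3 := fderivWithin ℝ (chartMap F p) (range (𝓡∂ 2)) u₀ with hA
  have hAi : Function.Injective A := fderivWithin_chartMap_injective hF hi hu₀T
  have hAd : HasFDerivAt (chartMap F p) A u₀ := hasFDerivAt_chartMap hF hu₀T hpos
  have hAr : ((tangentPlane F hi p).1 : Set E3) = range A := by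
    have h := range_fderivWithin_chartMap hF hi hu₀T
    rw [hψu₀] at h
    rw [← h]
    rfl
  have hJA : J u₀ = (A : E2 →ₗ[ℝ] E3).normDet := sqrt_gram_det_eq_normDet F p u₀
  refine ⟨(extChartAt (𝓡∂ 2) p).source ∩ extChartAt (𝓡∂ 2) p ⁻¹' Metric.ball u₀ (ρ / 2), ?_,
    ⟨mem_extChartAt_source p, Metric.mem_ball_self (half_pos hρ)⟩, ?_⟩
  · simp only [extChartAt_source]
    exact isOpen_extChartAt_preimage p Metric.isOpen_ball
  intro U hUo hpU hUN f hf hfc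
  have hUs : U ⊆ (extChartAt (𝓡∂ 2) p).source := hUN.trans inter_subset_left
  set D : Set E2 := (extChartAt (𝓡∂ 2) p).symm ⁻¹' U ∩ chartTarget p with hD
  have hDm : MeasurableSet D := measurableSet_preimage_inter_of_continuousOn
    (measurableSet_chartTarget p) (continuousOn_chart_symm p) hUo.measurableSet
  have hDK : D ⊆ K := by
    rintro u ⟨huU, huT⟩
    refine ⟨Metric.ball_subset_closedBall ?_, chartTarget_subset p huT⟩
    have := (hUN huU).2
    rwa [mem_preimage, (extChartAt (𝓡∂ 2) p).right_inv huT] at this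
  have hDn : D ∈ 𝓝 u₀ := by
    refine inter_mem ?_ (chartTarget_mem_nhds hp)
    have hcont : ContinuousAt (extChartAt (𝓡∂ 2) p).symm u₀ :=
      (continuousOn_chart_symm p).continuousAt (chartTarget_mem_nhds hp)
    refine hcont.preimage_mem_nhds ?_
    rw [hψu₀]
    exact hUo.mem_nhds hpU
  have hDT : D ⊆ chartTarget p := inter_subset_right
  have hFm : Measurable F := hF.continuous.measurable
  -- the integral in the chart
  have hint : ∀ r : ℝ, ∫ q in U, f (r⁻¹ • (F q - F p)) ∂(areaMeasure F) =
      ∫ u, D.indicator (fun u => J u * f (r⁻¹ • (chartMap F p u - F p))) u := by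
    intro r
    have hm : Measurable fun q => f (r⁻¹ • (F q - F p)) :=
      hf.measurable.comp (by fun_prop)
    rw [← integral_indicator hUo.measurableSet, integral_areaMeasure_of_support hF hi p
      ((hm.indicator hUo.measurableSet).aestronglyMeasurable) fun x hx => indicator_of_notMem (fun h => hx (hUs h)) _,
      ← integral_indicator (measurableSet_chartTarget p)]
    congr 1
    ext u
    by_cases huT : u ∈ chartTarget p
    · by_cases huU : (extChartAt (𝓡∂ 2) p).symm u ∈ U
      · rw [indicator_of_mem huT, indicator_of_mem huU,
          indicator_of_mem (show u ∈ D from ⟨huU, huT⟩)]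
        rfl
      · rw [indicator_of_mem huT, indicator_of_notMem huU, indicator_of_notMem fun h => huU h.1,
          mul_zero]
    · rw [indicator_of_notMem huT, indicator_of_notMem fun h => huT h.2]
  have hsubst : ∀ r : ℝ, 0 < r → (r ^ 2)⁻¹ * ∫ q in U, f (r⁻¹ • (F q - F p)) ∂(areaMeasure F) =
      ∫ v, D.indicator (fun u => J u * f (r⁻¹ • (chartMap F p u - F p))) (u₀ + r • v) := by
    intro r hr
    rw [hint, ← integral_add_left_eq_self _ u₀]
    have := Measure.integral_comp_smul_of_nonneg (volume : Measure E2)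
      (fun w => D.indicator (fun u => J u * f (r⁻¹ • (chartMap F p u - F p))) (u₀ + w)) r (hR := hr.le)
    rw [this, finrank_euclideanSpace_fin, smul_eq_mul]
  rw [hAr, integral_range_eq_normDet_mul hAi, ← hJA, ← integral_const_mul]
  obtain ⟨R, hR⟩ := hfc.isCompact.isBounded.subset_closedBall (0 : E3)
  obtain ⟨M', hM'⟩ := hf.bounded_above_of_compact_support hfc
  refine Tendsto.congr' (f₁ := fun r : ℝ => ∫ v, D.indicator
    (fun u => J u * f (r⁻¹ • (chartMap F p u - F p))) (u₀ + r • v)) ?_ ?_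
  · filter_upwards [self_mem_nhdsWithin] with r hr
    exact (hsubst r hr).symm
  -- The support of `f` lies in the ball of radius `R`, and the chart map is expanding up to the
  -- factor `C`, so only `‖v‖ ≤ C * R` contributes, whatever `r > 0` is.
  refine tendsto_integral_filter_of_dominated_convergence
    ((Metric.closedBall (0 : E2) (C * R)).indicator fun _ => M * M') ?_ ?_ ?_ ?_
  · refine Eventually.of_forall fun r => ?_
    have hm : AEStronglyMeasurable (D.indicator
        (fun u => J u * f (r⁻¹ • (chartMap F p u - F p)))) volume := by
      refine (aestronglyMeasurable_indicator_iff hDm).2 ?_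
      refine ContinuousOn.aestronglyMeasurable ?_ hDm
      have hg : Continuous fun y : E3 => f (r⁻¹ • (y - F p)) := hf.comp (by fun_prop)
      exact (hJc.mono hDT).mul
        (hg.comp_continuousOn ((contDiffOn_chartMap hF p).continuousOn.mono hDT))
    by_cases hr : r = 0
    · subst hr
      simp only [zero_smul, add_zero]
      exact aestronglyMeasurable_const
    · have hq : Measure.QuasiMeasurePreserving (fun v : E2 => u₀ + r • v) volume volume := by
        refine (measurePreserving_add_left volume u₀).quasiMeasurePreserving.comp
          (f := fun v : E2 => r • v) ⟨measurable_const_smul r, ?_⟩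
        rw [Measure.map_addHaar_smul volume hr]
        exact Measure.smul_absolutelyContinuous
      exact hm.comp_quasiMeasurePreserving hq
  · filter_upwards [self_mem_nhdsWithin] with r hr
    have hr : 0 < r := hr
    refine Eventually.of_forall fun v => ?_
    by_cases hv : u₀ + r • v ∈ D
    swap
    · rw [indicator_of_notMem hv, norm_zero]
      refine indicator_nonneg (fun _ _ => ?_) _
      exact mul_nonneg ((norm_nonneg _).trans (hM u₀ (hDK (mem_of_mem_nhds hDn))))
        ((norm_nonneg _).trans (hM' 0))
    rw [indicator_of_mem hv]
    by_cases hf0 : f (r⁻¹ • (chartMap F p (u₀ + r • v) - F p)) = 0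
    · rw [hf0, mul_zero, norm_zero]
      refine indicator_nonneg (fun _ _ => ?_) _
      exact mul_nonneg ((norm_nonneg _).trans (hM u₀ (hDK (mem_of_mem_nhds hDn))))
        ((norm_nonneg _).trans (hM' 0))
    have hvb : v ∈ Metric.closedBall (0 : E2) (C * R) := by
      have h1 := hR (subset_tsupport f hf0)
      rw [mem_closedBall_zero_iff, norm_smul, norm_inv, Real.norm_of_nonneg hr.le,
        inv_mul_le_iff₀ hr] at h1
      have hin : ∀ u ∈ D, u ∈ Metric.ball u₀ ρ ∩ range (𝓡∂ 2) := fun u hu =>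
        ⟨Metric.closedBall_subset_ball (half_lt_self hρ) (hDK hu).1, (hDK hu).2⟩
      have h2 := (hC _ (hin _ hv) _ (hin _ (mem_of_mem_nhds hDn))).2
      rw [dist_eq_norm, dist_eq_norm, add_sub_cancel_left, norm_smul, Real.norm_of_nonneg hr.le,
        hGu₀] at h2
      rw [mem_closedBall_zero_iff]
      have h3 : r * ‖v‖ ≤ r * (C * R) := by
        refine h2.trans ?_
        calc (C : ℝ) * _ ≤ C * (r * R) := mul_le_mul_of_nonneg_left h1 C.2
          _ = r * (C * R) := by ring
      exact le_of_mul_le_mul_left h3 hr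
    rw [indicator_of_mem hvb, norm_mul]
    exact mul_le_mul (hM _ (hDK hv)) (hM' _) (norm_nonneg _)
      ((norm_nonneg _).trans (hM u₀ (hDK (mem_of_mem_nhds hDn))))
  · refine (integrable_indicator_iff Metric.isClosed_closedBall.measurableSet).2 ?_
    exact integrableOn_const (isCompact_closedBall _ _).measure_lt_top.ne
  · refine Eventually.of_forall fun v => ?_
    have hlim : Tendsto (fun r : ℝ => u₀ + r • v) (𝓝[>] 0) (𝓝 u₀) := by
      have : Continuous fun r : ℝ => u₀ + r • v := by fun_prop
      simpa using (this.tendsto 0).mono_left nhdsWithin_le_nhds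
    have hJu : ContinuousAt J u₀ := hJc.continuousAt (chartTarget_mem_nhds hp)
    have hline : Tendsto (fun r : ℝ => r⁻¹ • (chartMap F p (u₀ + r • v) - F p)) (𝓝[>] 0)
        (𝓝 (A v)) := by
      have h := (hAd.hasLineDerivAt v).tendsto_slope_zero_right
      refine h.congr fun r => ?_
      rw [hGu₀]
    refine ((hJu.tendsto.comp hlim).mul ((hf.tendsto _).comp hline)).congr' ?_
    filter_upwards [hlim.eventually hDn] with r hr
    exact (indicator_of_mem (s := D) hr
      fun u => J u * f (r⁻¹ • (chartMap F p u - F p))).symm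

variable [T2Space S]

/-- Outside disjoint neighbourhoods of the finitely many preimages, `F` keeps a positive distance
from `x` by compactness. For small `r` only these neighbourhoods contribute, each with the same
plane `P`. -/
theorem tendsto_blowUp [Nonempty S] (hF : ContMDiff (𝓡∂ 2) 𝓘(ℝ, E3) 1 F)
    (hi : ∀ p, Function.Injective (differential F p)) {x : E3}
    (hx : F ⁻¹' {x} ⊆ (𝓡∂ 2).interior S) {P : Grass}
    (hP : ∀ q, F q = x → tangentPlane F hi q = P) (f : E3 → ℝ) (hf : Continuous f)
    (hfc : HasCompactSupport f) :
    Tendsto (fun r : ℝ => (r ^ 2)⁻¹ * ∫ y, f (r⁻¹ • (y - x)) ∂((areaMeasure F).map F)) (𝓝[>] 0)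
      (𝓝 (fiberCount F x * ∫ y in (P.1 : Set E3), f y ∂(μHE[2] : Measure E3))) := by
  have hfin := finite_fiber hF hi x
  have hFc : Continuous F := hF.continuous
  have := isFiniteMeasure_areaMeasure hF hi
  have hN : ∀ q : S, ∃ N : Set S, IsOpen N ∧ q ∈ N ∧ (F q = x → ∀ U : Set S, IsOpen U → q ∈ U →
      U ⊆ N → Tendsto (fun r : ℝ => (r ^ 2)⁻¹ * ∫ y in U, f (r⁻¹ • (F y - x)) ∂(areaMeasure F))
        (𝓝[>] 0) (𝓝 (∫ y in (P.1 : Set E3), f y ∂(μHE[2] : Measure E3)))) := by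
    intro q
    by_cases hq : F q = x
    · obtain ⟨N, hNo, hqN, hN⟩ := tendsto_blowUp_patch hF hi (hx hq)
      refine ⟨N, hNo, hqN, fun _ U hUo hqU hUN => ?_⟩
      have := hN U hUo hqU hUN f hf hfc
      rwa [hP q hq, hq] at this
    · exact ⟨univ, isOpen_univ, mem_univ _, fun h => absurd h hq⟩
  choose N hNo hqN hN using hN
  obtain ⟨U, hU, hUd⟩ := hfin.t2_separation
  set O : S → Set S := fun q => U q ∩ N q with hO
  have hOo : ∀ q, IsOpen (O q) := fun q => (hU q).2.inter (hNo q)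
  set t := hfin.toFinset with ht
  set Ω : Set S := ⋃ q ∈ t, O q with hΩ
  have hΩo : IsOpen Ω := isOpen_biUnion fun q _ => hOo q
  have hxΩ : x ∉ F '' Ωᶜ := by
    rintro ⟨q, hq, hqx⟩
    exact hq (mem_biUnion (hfin.mem_toFinset.2 hqx) ⟨(hU q).1, hqN q⟩)
  have hKc : IsClosed (F '' Ωᶜ) := (hΩo.isClosed_compl.isCompact.image hFc).isClosed
  obtain ⟨δ, hδ, hδK⟩ := Metric.isOpen_iff.1 hKc.isOpen_compl x hxΩ
  obtain ⟨R, hR⟩ := hfc.isCompact.isBounded.subset_closedBall (0 : E3)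
  obtain ⟨M', hM'⟩ := hf.bounded_above_of_compact_support hfc
  have hint : ∀ r : ℝ, Integrable (fun q => f (r⁻¹ • (F q - x))) (areaMeasure F) := fun r =>
    Integrable.of_bound (hf.comp (by fun_prop)).aestronglyMeasurable M'
      (Eventually.of_forall fun q => hM' _)
  have hev : ∀ᶠ r in 𝓝[>] (0 : ℝ), (r ^ 2)⁻¹ * ∫ y, f (r⁻¹ • (y - x)) ∂((areaMeasure F).map F) =
      ∑ q ∈ t, (r ^ 2)⁻¹ * ∫ y in O q, f (r⁻¹ • (F y - x)) ∂(areaMeasure F) := by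
    have hsmall : ∀ᶠ r in 𝓝[>] (0 : ℝ), r * R < δ := by
      have : Tendsto (fun r : ℝ => r * R) (𝓝[>] 0) (𝓝 0) := by
        have h : Continuous fun r : ℝ => r * R := by fun_prop
        simpa using (h.tendsto 0).mono_left nhdsWithin_le_nhds
      exact this.eventually_lt_const hδ
    filter_upwards [self_mem_nhdsWithin, hsmall] with r hr hrR
    have hr : 0 < r := hr
    have hg : Continuous fun y : E3 => f (r⁻¹ • (y - x)) := hf.comp (by fun_prop)
    rw [integral_map hFc.measurable.aemeasurable hg.aestronglyMeasurable,
      ← Finset.mul_sum, ← integral_biUnion_finset t (fun q _ => (hOo q).measurableSet)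
        (fun a ha b hb hab => (hUd (hfin.mem_toFinset.1 ha) (hfin.mem_toFinset.1 hb) hab).mono
          inter_subset_left inter_subset_left) fun q _ => (hint r).integrableOn,
      setIntegral_eq_integral_of_forall_compl_eq_zero]
    intro q hq
    by_contra hne
    have h1 := hR (subset_tsupport f hne)
    rw [mem_closedBall_zero_iff, norm_smul, norm_inv, Real.norm_of_nonneg hr.le,
      inv_mul_le_iff₀ hr] at h1
    have h2 : F q ∈ Metric.ball x δ := by
      rw [Metric.mem_ball, dist_eq_norm]
      exact h1.trans_lt hrR
    exact hδK h2 (mem_image_of_mem _ hq)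
  refine Tendsto.congr' (EventuallyEq.symm hev) ?_
  have hsum : fiberCount F x * ∫ y in (P.1 : Set E3), f y ∂(μHE[2] : Measure E3) =
      ∑ q ∈ t, ∫ y in (P.1 : Set E3), f y ∂(μHE[2] : Measure E3) := by
    rw [Finset.sum_const, nsmul_eq_mul, fiberCount, ncard_eq_toFinset_card _ hfin]
  rw [hsum]
  exact tendsto_finsetSum _ fun q hq => hN q (hfin.mem_toFinset.1 hq) _ (hOo q)
    ⟨(hU q).1, hqN q⟩ inter_subset_right

end BlowUp


/-! ### The image varifold is rectifiable -/

section ImageVarifold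

variable {S : Type*} [TopologicalSpace S] [ChartedSpace (EuclideanHalfSpace 2) S]
  [IsManifold (𝓡∂ 2) ∞ S] [CompactSpace S] {F ν : S → E3} {θ : ℝ}

/-- Almost everywhere on the image, the tangent planes of all sheets agree. -/
theorem IsCapillaryImmersion.hausdorff_image_tangentPlane_ne [Nonempty S]
    (hF : IsCapillaryImmersion θ F ν) :
    (μHE[2] : Measure E3) (F '' {q | ∃ q', F q' = F q ∧
      tangentPlane F hF.immersion q ≠ tangentPlane F hF.immersion q'}) = 0 := by
  have hc := hF.contMDiff_one
  obtain ⟨e, Q, hQo, hQs, hQu, hQC⟩ := exists_patch_sequence hc hF.immersion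
  set bad : ℕ → ℕ → Set S := fun n m => {q | q ∈ Q n ∧ ∃ q' ∈ Q m, F q' = F q ∧
    tangentPlane F hF.immersion q ≠ tangentPlane F hF.immersion q'} with hbad
  have hsub : F '' {q | ∃ q', F q' = F q ∧
      tangentPlane F hF.immersion q ≠ tangentPlane F hF.immersion q'} ⊆
      ⋃ n, ⋃ m, F '' bad n m := by
    rintro _ ⟨q, ⟨q', hq', hne⟩, rfl⟩
    obtain ⟨n, hn⟩ := mem_iUnion.1 (hQu.ge (mem_univ q))
    obtain ⟨m, hm⟩ := mem_iUnion.1 (hQu.ge (mem_univ q'))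
    exact mem_iUnion.2 ⟨n, mem_iUnion.2 ⟨m, q, ⟨hn, q', hm, hq', hne⟩, rfl⟩⟩
  refine measure_mono_null hsub (measure_iUnion_null fun n => measure_iUnion_null fun m => ?_)
  obtain ⟨C, hC⟩ := hQC n
  obtain ⟨C', hC'⟩ := hQC m
  refine hausdorff_image_eq_zero (fun q hq => hQs n hq.1) (fun x hx y hy => (hC x hx.1 y hy.1).1) ?_
  -- `D` is the coincidence set of the two sheets, seen in the chart of the first one. At a point of
  -- `D` with unique differentiability the planes agree, so the bad points lie in the null set of
  -- remaining points.
  set D : Set E2 := extChartAt (𝓡∂ 2) (e n) '' {q | q ∈ Q n ∧ ∃ q' ∈ Q m, F q' = F q} with hD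
  refine measure_mono_null ?_ (ae_uniqueDiffWithinAt (volume : Measure E2) D)
  rintro _ ⟨q, ⟨hq, q', hq', hqq', hne⟩, rfl⟩
  refine ⟨⟨q, ⟨hq, q', hq', hqq'⟩, rfl⟩, fun hud => hne ?_⟩
  set φ := extChartAt (𝓡∂ 2) (e n) with hφ
  set φ' := extChartAt (𝓡∂ 2) (e m) with hφ'
  have hψ : ∀ y ∈ Q n, φ.symm (φ y) = y := fun y hy => φ.left_inv (hQs n hy)
  have hψ' : ∀ y ∈ Q m, φ'.symm (φ' y) = y := fun y hy => φ'.left_inv (hQs m hy)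
  have hex : ∀ w : E2, ∃ y : S, w ∈ D → y ∈ Q m ∧ F y = chartMap F (e n) w := by
    intro w
    by_cases hw : w ∈ D
    · obtain ⟨x, ⟨hx, y, hy, hyx⟩, rfl⟩ := hw
      refine ⟨y, fun _ => ⟨hy, ?_⟩⟩
      simp only [chartMap, Function.comp_apply, ← hφ, hψ x hx, hyx]
    · exact ⟨q, fun h => absurd h hw⟩
  choose y hy using hex
  have hDq : φ q ∈ D := ⟨q, ⟨hq, q', hq', hqq'⟩, rfl⟩
  have hinj : InjOn F (Q m) := injOn_of_dist_le
    ((extChartAt (𝓡∂ 2) (e m)).injOn.mono (hQs m)) fun a ha b hb => (hC' a ha b hb).2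
  have hyq : y (φ q) = q' := by
    refine hinj (hy _ hDq).1 hq' ?_
    rw [(hy _ hDq).2, hqq']
    simp only [chartMap, Function.comp_apply, ← hφ, hψ q hq]
  have hDH : D ⊆ range (𝓡∂ 2) := by
    rintro _ ⟨x, hx, rfl⟩
    exact chartTarget_subset _ (φ.map_source (hQs n hx.1))
  have htq : φ q ∈ chartTarget (e n) := φ.map_source (hQs n hq)
  have htq' : φ' q' ∈ chartTarget (e m) := φ'.map_source (hQs m hq')
  have hr := range_fderivWithin_chartMap hc hF.immersion htq
  have hr' := range_fderivWithin_chartMap hc hF.immersion htq'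
  have hG' := hasFDerivWithinAt_chartMap hc htq'
  rw [← hφ, hψ q hq] at hr
  rw [← hφ', hψ' q' hq'] at hr'
  have hG'm : ∀ w ∈ D, chartMap F (e m) (φ' (y w)) = chartMap F (e n) w := by
    intro w hw
    rw [← (hy w hw).2]
    simp only [chartMap, Function.comp_apply, ← hφ', hψ' _ (hy w hw).1]
  -- The second sheet is reparametrized by `w ↦ φ' (y w)`. The form `⟨ν q', ·⟩` kills the plane at
  -- `q'`, hence also the plane at `q`; equal dimensions give equality.
  have key : tangentPlane F hF.immersion q = tangentPlane F hF.immersion q' := by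
    have hle : (tangentPlane F hF.immersion q).1 ≤ (tangentPlane F hF.immersion q').1 := by
      have hz := comp_fderiv_eq_zero_of_reparametrization (h := fun w => φ' (y w)) (C := C')
        (T := range (𝓡∂ 2)) hud
        ((hasFDerivWithinAt_chartMap hc htq).mono hDH) (by rw [hyq]; exact hG') hDq
        (fun w hw => chartTarget_subset _ (φ'.map_source (hQs m (hy w hw).1))) hG'm
        (fun w hw => by
          rw [← (hy w hw).2, ← (hy _ hDq).2]
          exact (hC' _ (hy w hw).1 _ (hy _ hDq).1).2) (innerSL ℝ (ν q')) ?_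
      · rw [← hr, hF.tangentPlane_eq q']
        rintro _ ⟨v, rfl⟩
        rw [Submodule.mem_orthogonal_singleton_iff_inner_right]
        exact congrArg (fun L : E2 →L[ℝ] ℝ => L v) hz
      · ext v
        have hv : (fderivWithin ℝ (chartMap F (e m)) (range (𝓡∂ 2)) (φ' q')) v ∈
            (tangentPlane F hF.immersion q').1 := by
          rw [← hr']
          exact ⟨v, rfl⟩
        rw [hF.tangentPlane_eq q', Submodule.mem_orthogonal_singleton_iff_inner_right] at hv
        simpa using hv
    have := Submodule.eq_of_le_of_finrank_eq hle (by
      rw [(tangentPlane F hF.immersion q).2, (tangentPlane F hF.immersion q').2])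
    exact Subtype.ext this
  exact key

variable [MeasurableSpace S] [BorelSpace S] [T2Space S]

theorem IsCapillaryImmersion.measurable_pair (hF : IsCapillaryImmersion θ F ν) :
    Measurable fun p => (F p, tangentPlane F hF.immersion p) :=
  hF.contMDiff.continuous.measurable.prodMk hF.continuous_tangentPlane.measurable

theorem IsCapillaryImmersion.varifoldWeight_eq (hF : IsCapillaryImmersion θ F ν) :
    varifoldWeight (imageVarifold F hF.immersion) = (areaMeasure F).map F := by
  rw [varifoldWeight, imageVarifold, Measure.map_map measurable_fst hF.measurable_pair]
  rfl

theorem IsCapillaryImmersion.support_subset (hF : IsCapillaryImmersion θ F ν) :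
    (varifoldWeight (imageVarifold F hF.immersion)).support ⊆ range F := by
  have hcl : IsClosed (range F) := (isCompact_range hF.contMDiff.continuous).isClosed
  rw [hF.varifoldWeight_eq]
  refine Measure.support_subset_of_isClosed hcl ?_
  rw [mem_ae_iff, Measure.map_apply hF.contMDiff.continuous.measurable hcl.measurableSet.compl]
  simp

theorem IsCapillaryImmersion.isRectifiableVarifold [Nonempty S] (hF : IsCapillaryImmersion θ F ν) :
    IsRectifiableVarifold (imageVarifold F hF.immersion) := by
  have hc := hF.contMDiff_one
  have hFc := hF.contMDiff.continuous
  have := isFiniteMeasure_areaMeasure hc hF.immersion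
  have hfinV : IsFiniteMeasure (imageVarifold F hF.immersion) := by
    rw [imageVarifold]
    infer_instance
  refine ⟨inferInstance, F '' (𝓡∂ 2).interior S, fiberCount F, ?_⟩
  set M := F '' (𝓡∂ 2).interior S with hM
  set tp := tangentPlane F hF.immersion with htp
  have hmap := hF.map_areaMeasure
  have hMm : MeasurableSet M := hF.measurableSet_image_interior
  have hfib : ∀ x ∈ M, F ⁻¹' {x} ⊆ (𝓡∂ 2).interior S := by
    intro x hx q hq
    rw [hM, hF.image_interior, ← mem_singleton_iff.1 (mem_preimage.1 hq)] at hx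
    have := hx.2
    rw [hF.mem_boundaryPlane_iff, ← ModelWithCorners.compl_interior] at this
    exact not_not.1 this
  -- A measurable null set containing all points where sheets have different tangent planes. Off `Z`
  -- the common plane defines `T` on `M`; everywhere else `T` is `planeGrass`, an irrelevant
  -- default.
  set Z : Set E3 := toMeasurable (μHE[2] : Measure E3)
    (F '' {q | ∃ q', F q' = F q ∧ tp q ≠ tp q'}) with hZ
  have hZm : MeasurableSet Z := measurableSet_toMeasurable _ _
  have hZ0 : (μHE[2] : Measure E3) Z = 0 := by
    rw [hZ, measure_toMeasurable]
    exact hF.hausdorff_image_tangentPlane_ne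
  have hag : ∀ q q', F q ∉ Z → F q' = F q → tp q = tp q' := by
    intro q q' hq hqq'
    by_contra hne
    exact hq (subset_toMeasurable _ _ ⟨q, ⟨q', hqq', hne⟩, rfl⟩)
  have hT : ∃ T : E3 → Grass, (∀ q, F q ∈ M \ Z → T (F q) = tp q) ∧
      ∀ x ∉ M \ Z, T x = planeGrass := by
    have : ∀ x, ∃ P : Grass, (∀ q, F q = x → x ∈ M \ Z → P = tp q) ∧
        (x ∉ M \ Z → P = planeGrass) := by
      intro x
      by_cases hx : x ∈ M \ Z
      · obtain ⟨⟨q, hq, rfl⟩, hqZ⟩ := hx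
        exact ⟨tp q, fun q' hq' _ => hag q q' hqZ hq', fun h => absurd ⟨⟨q, hq, rfl⟩, hqZ⟩ h⟩
      · exact ⟨planeGrass, fun q _ h => absurd h hx, fun _ => rfl⟩
    choose T hT hT' using this
    exact ⟨T, fun q hq => hT _ q rfl hq, hT'⟩
  obtain ⟨T, hTq, hTn⟩ := hT
  -- For closed `K` the set of surface points with tangent plane in `K` is compact, so its image is
  -- closed; no selection of preimages is needed.
  have hTm : Measurable T := by
    refine measurable_of_isClosed fun K hK => ?_
    have hKc : IsClosed (tp ⁻¹' K) := hK.preimage hF.continuous_tangentPlane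
    have himg : MeasurableSet (F '' (tp ⁻¹' K)) := (hKc.isCompact.image hFc).isClosed.measurableSet
    have heq : T ⁻¹' K = ((M \ Z) ∩ F '' (tp ⁻¹' K)) ∪ ((M \ Z)ᶜ ∩ {_x | planeGrass ∈ K}) := by
      ext x
      by_cases hx : x ∈ M \ Z
      · simp only [mem_preimage, mem_union, mem_inter_iff, hx, true_and, mem_compl_iff,
          not_true_eq_false, false_and, or_false]
        constructor
        · intro h
          obtain ⟨q, hq, rfl⟩ := hx.1
          rw [hTq q hx] at h
          exact ⟨q, h, rfl⟩
        · rintro ⟨q, hq, rfl⟩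
          rw [hTq q hx]
          exact hq
      · simp [hx, hTn x hx, mem_preimage]
    rw [heq]
    exact ((hMm.diff hZm).inter himg).union ((hMm.diff hZm).compl.inter (MeasurableSet.const _))
  have hae : ∀ᵐ x ∂((μHE[2] : Measure E3).restrict M), x ∈ M \ Z := by
    filter_upwards [ae_restrict_mem hMm, ae_restrict_of_ae (compl_mem_ae_iff.2 hZ0)] with x hx hxZ
    exact ⟨hx, hxZ⟩
  have hacM : (areaMeasure F).map F ≪ (μHE[2] : Measure E3).restrict M := by
    rw [hmap]
    exact withDensity_absolutelyContinuous _ _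
  have hfinite : IsFiniteMeasure (weightedArea M (fiberCount F)) := by
    rw [← hmap]
    infer_instance
  refine ⟨T, hMm, (isCountablyTwoRectifiable_range hc hF.immersion).mono (image_subset_range _ _),
    ?_, ?_, hTm.aemeasurable, ?_, ?_⟩
  · rintro x ⟨q, hq, rfl⟩
    rw [fiberCount, Nat.cast_pos, ncard_pos (finite_fiber hc hF.immersion _)]
    exact ⟨q, rfl⟩
  · exact hF.integrable_fiberCount.locallyIntegrable
  · filter_upwards [hae] with x hx
    obtain ⟨q, hq, rfl⟩ := hx.1
    intro f hf hfc
    rw [← hmap, hTq q hx]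
    exact tendsto_blowUp hc hF.immersion (hfib _ hx.1)
      (fun q' hq' => (hag q q' hx.2 hq').symm) f hf hfc
  · rw [← hmap, imageVarifold, Measure.map_map (g := fun x => (x, T x)) (measurable_id.prodMk hTm)
      hFc.measurable]
    refine Measure.map_congr ?_
    have := ae_of_ae_map hFc.measurable.aemeasurable (hacM.ae_le hae)
    filter_upwards [this] with q hq
    exact Prod.ext rfl (hTq q hq).symm

end ImageVarifold


/-! ### The Cauchy kernel and Green's formula for winding numbers -/

section Cauchy

theorem lintegral_cauchy_le (A : Set ℂ) (w t : ℂ) :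
    ∫⁻ z in A, ‖t / (w - z)‖ₑ ≤
      ‖t‖ₑ * ((∫⁻ z in Metric.ball (0 : ℂ) 1, ENNReal.ofReal ‖z‖⁻¹) + volume A) := by
  calc ∫⁻ z in A, ‖t / (w - z)‖ₑ = ∫⁻ z in A, ‖t‖ₑ * ENNReal.ofReal ‖z - w‖⁻¹ := by
        refine lintegral_congr fun z => ?_
        rw [div_eq_mul_inv, enorm_mul, ← ofReal_norm (w - z)⁻¹, norm_inv, norm_sub_rev]
    _ = ‖t‖ₑ * ∫⁻ z in A, ENNReal.ofReal ‖z - w‖⁻¹ :=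
        lintegral_const_mul' _ _ enorm_ne_top
    _ ≤ _ := by gcongr; exact lintegral_inv_norm_sub_le A w

theorem lintegral_cauchy_const_ne_top {A : Set ℂ} (hA : volume A ≠ ⊤) :
    (∫⁻ z in Metric.ball (0 : ℂ) 1, ENNReal.ofReal ‖z‖⁻¹) + volume A ≠ ⊤ :=
  ENNReal.add_ne_top.2 ⟨lintegral_inv_norm_ball_lt_top.ne, hA⟩

theorem integrable_mul_cauchy {a : ℂ → ℝ} (ha : Continuous a) (ha' : HasCompactSupport a)
    (w t : ℂ) : Integrable fun z => (a z : ℂ) * (t / (w - z)) := by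
  have hk : IntegrableOn (fun z => t / (w - z)) (tsupport a) := by
    refine ⟨(Measurable.aestronglyMeasurable (by fun_prop)), ?_⟩
    refine (lintegral_cauchy_le _ w t).trans_lt (ENNReal.mul_lt_top enorm_lt_top ?_)
    exact (lintegral_cauchy_const_ne_top ha'.isCompact.measure_lt_top.ne).lt_top
  obtain ⟨M, hM⟩ := ha.bounded_above_of_compact_support ha'
  have h2 : IntegrableOn (fun z => (a z : ℂ) * (t / (w - z))) (tsupport a) :=
    hk.bdd_mul (Complex.continuous_ofReal.comp ha).aestronglyMeasurable
      (Eventually.of_forall fun z => (Complex.norm_real _).trans_le (hM z))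
  refine (integrableOn_iff_integrable_of_support_subset ?_).1 h2
  intro z hz
  by_contra hcon
  exact hz (by simp [image_eq_zero_of_notMem_tsupport hcon])

variable {Ω : Type*} [MeasurableSpace Ω] {σ : Measure Ω} [IsFiniteMeasure σ] {c τ : Ω → ℂ}

theorem integrable_cauchy_prod (hc : Measurable c) (hτ : Measurable τ)
    (hτ1 : ∀ᵐ q ∂σ, ‖τ q‖ ≤ 1) {A : Set ℂ} (hA : volume A ≠ ⊤) :
    Integrable (fun x : ℂ × Ω => τ x.2 / (c x.2 - x.1)) ((volume.restrict A).prod σ) := by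
  have hm : Measurable fun x : ℂ × Ω => τ x.2 / (c x.2 - x.1) := by fun_prop
  refine ⟨hm.aestronglyMeasurable, ?_⟩
  rw [hasFiniteIntegral_iff_enorm, lintegral_prod_symm _ hm.enorm.aemeasurable]
  refine (lintegral_mono_ae (g := fun _ => (∫⁻ z in Metric.ball (0 : ℂ) 1, ENNReal.ofReal ‖z‖⁻¹) +
    volume A) ?_).trans_lt ?_
  · filter_upwards [hτ1] with q hq
    refine (lintegral_cauchy_le A (c q) (τ q)).trans ?_
    refine mul_le_of_le_one_left zero_le ?_
    rw [← ofReal_norm]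
    exact ENNReal.ofReal_le_one.2 hq
  · rw [lintegral_const]
    exact ENNReal.mul_lt_top (lintegral_cauchy_const_ne_top hA).lt_top (measure_lt_top _ _)

theorem integrable_mul_cauchy_prod (hc : Measurable c) (hτ : Measurable τ)
    (hτ1 : ∀ᵐ q ∂σ, ‖τ q‖ ≤ 1) {a : ℂ → ℝ} (ha : Continuous a) (ha' : HasCompactSupport a) :
    Integrable (fun x : ℂ × Ω => (a x.1 : ℂ) * (τ x.2 / (c x.2 - x.1))) (volume.prod σ) := by
  have hk := integrable_cauchy_prod hc hτ hτ1 (A := tsupport a) ha'.isCompact.measure_lt_top.ne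
  obtain ⟨M, hM⟩ := ha.bounded_above_of_compact_support ha'
  have h2 : Integrable (fun x : ℂ × Ω => (a x.1 : ℂ) * (τ x.2 / (c x.2 - x.1)))
      ((volume.restrict (tsupport a)).prod σ) :=
    hk.bdd_mul (c := M) (by
      have : Measurable fun x : ℂ × Ω => (a x.1 : ℂ) := by
        have := ha.measurable
        fun_prop
      exact this.aestronglyMeasurable)
      (Eventually.of_forall fun z => by rw [Complex.norm_real]; exact hM _)
  have hr : (volume.restrict (tsupport a)).prod σ =
      ((volume : Measure ℂ).prod σ).restrict (tsupport a ×ˢ univ) := by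
    rw [← Measure.prod_restrict, Measure.restrict_univ]
  rw [hr] at h2
  refine (integrableOn_iff_integrable_of_support_subset ?_).1 h2
  intro z hz
  refine ⟨?_, mem_univ _⟩
  by_contra hcon
  exact hz (by simp [image_eq_zero_of_notMem_tsupport hcon])

theorem locallyIntegrable_cauchy (hc : Measurable c) (hτ : Measurable τ)
    (hτ1 : ∀ᵐ q ∂σ, ‖τ q‖ ≤ 1) : LocallyIntegrable (fun z : ℂ => ∫ q, τ q / (c q - z) ∂σ) := by
  rw [locallyIntegrable_iff]
  intro K hK
  exact (integrable_cauchy_prod hc hτ hτ1 hK.measure_lt_top.ne).integral_prod_left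

/-- Expanding `t / (w - z)` turns the integrand into radial and angular derivatives of `f` and `g`
about `w`. The angular ones integrate to zero and the radial ones give the values at `w`. The curl
term is what completes the divergence to such a combination. -/
theorem integral_div_curl_cauchy {f g : ℂ → ℝ} (hf : ContDiff ℝ 1 f) (hf' : HasCompactSupport f)
    (hg : ContDiff ℝ 1 g) (hg' : HasCompactSupport g) (w t : ℂ) :
    ∫ z, ((fderiv ℝ f z 1 + fderiv ℝ g z Complex.I) * (t / (w - z)).im +
      (fderiv ℝ f z Complex.I - fderiv ℝ g z 1) * (t / (w - z)).re) =
      2 * Real.pi * (f w * t.im - g w * t.re) := by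
  have hsplit : ∀ h : ℂ → ℝ, ContDiff ℝ 1 h → HasCompactSupport h → ∀ v : ℂ,
      Integrable fun z => fderiv ℝ h z (v * (z - w)) / ‖z - w‖ ^ 2 := by
    intro h hh hh' v
    have hcont : ∀ u : ℂ, Continuous fun z => fderiv ℝ h z u := fun u =>
      (hh.continuous_fderiv one_ne_zero).clm_apply continuous_const
    have hcs : ∀ u : ℂ, HasCompactSupport fun z => fderiv ℝ h z u := fun u => hh'.fderiv_apply ℝ u
    have h1 := ((integrable_mul_cauchy (hcont v) (hcs v) w 1).re)
    have h2 := ((integrable_mul_cauchy (hcont (v * Complex.I)) (hcs (v * Complex.I)) w 1).im)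
    refine (h2.sub h1).congr (Eventually.of_forall fun z => ?_)
    simp only [RCLike.re_to_complex, RCLike.im_to_complex, Complex.re_ofReal_mul,
      Complex.im_ofReal_mul, Pi.sub_apply]
    have hz : v * (z - w) = (z - w).re • v + (z - w).im • (v * Complex.I) := by
      conv_lhs => rw [← Complex.re_add_im (z - w)]
      rw [Complex.real_smul, Complex.real_smul]
      ring
    rw [hz, map_add, map_smul, map_smul, smul_eq_mul, smul_eq_mul, one_div, Complex.inv_re,
      Complex.inv_im, Complex.normSq_eq_norm_sq, norm_sub_rev w z]
    simp only [Complex.sub_re, Complex.sub_im]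
    ring
  have hpt : ∀ z, (fderiv ℝ f z 1 + fderiv ℝ g z Complex.I) * (t / (w - z)).im +
      (fderiv ℝ f z Complex.I - fderiv ℝ g z 1) * (t / (w - z)).re =
      (-t.im * (fderiv ℝ f z (1 * (z - w)) / ‖z - w‖ ^ 2) +
        -t.im * (fderiv ℝ g z (Complex.I * (z - w)) / ‖z - w‖ ^ 2)) +
      (t.re * (fderiv ℝ g z (1 * (z - w)) / ‖z - w‖ ^ 2) +
        -t.re * (fderiv ℝ f z (Complex.I * (z - w)) / ‖z - w‖ ^ 2)) := by
    intro z
    have hz : 1 * (z - w) = (z - w).re • (1 : ℂ) + (z - w).im • Complex.I := by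
      rw [one_mul, Complex.real_smul, Complex.real_smul, mul_one, Complex.re_add_im]
    have hz' : Complex.I * (z - w) = -((z - w).im • (1 : ℂ)) + (z - w).re • Complex.I := by
      conv_lhs => rw [← Complex.re_add_im (z - w)]
      rw [Complex.real_smul, Complex.real_smul]
      linear_combination ((z - w).im : ℂ) * Complex.I_mul_I
    rw [hz, hz', map_add, map_add, map_add, map_add, map_neg, map_neg, map_smul, map_smul, map_smul,
      map_smul, map_smul, map_smul, map_smul, map_smul, div_eq_mul_inv t]
    simp only [smul_eq_mul, Complex.mul_re, Complex.mul_im, Complex.inv_re,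
      Complex.inv_im, Complex.normSq_eq_norm_sq, norm_sub_rev w z]
    simp only [Complex.sub_re, Complex.sub_im]
    ring
  simp_rw [hpt]
  rw [integral_add, integral_add, integral_add]
  · simp only [integral_const_mul, one_mul]
    rw [integral_fderiv_radial hf hf', integral_fderiv_radial hg hg',
      integral_fderiv_angular hf hf', integral_fderiv_angular hg hg']
    ring
  · exact (hsplit g hg hg' 1).const_mul _
  · exact (hsplit f hf hf' _).const_mul _
  · exact (hsplit f hf hf' 1).const_mul _
  · exact (hsplit g hg hg' _).const_mul _
  · exact ((hsplit f hf hf' 1).const_mul _).add ((hsplit g hg hg' _).const_mul _)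
  · exact ((hsplit g hg hg' 1).const_mul _).add ((hsplit f hf hf' _).const_mul _)

theorem integral_mul_cauchy_swap (hc : Measurable c) (hτ : Measurable τ)
    (hτ1 : ∀ᵐ q ∂σ, ‖τ q‖ ≤ 1) {a : ℂ → ℝ} (ha : Continuous a) (ha' : HasCompactSupport a) :
    ∫ z : ℂ, (a z : ℂ) * ∫ q, τ q / (c q - z) ∂σ = ∫ q, (∫ z : ℂ, (a z : ℂ) * (τ q / (c q - z))) ∂σ := by
  simp_rw [← integral_const_mul]
  exact integral_integral_swap (f := fun z q => (a z : ℂ) * (τ q / (c q - z))) (integrable_mul_cauchy_prod hc hτ hτ1 ha ha')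

/-- Green's formula for a curve whose Cauchy integral has vanishing real part. -/
theorem integral_divergence_mul_cauchy_im (hc : Measurable c) (hτ : Measurable τ)
    (hτ1 : ∀ᵐ q ∂σ, ‖τ q‖ ≤ 1) (hre : ∀ᵐ z : ℂ, (∫ q, τ q / (c q - z) ∂σ).re = 0)
    {f g : ℂ → ℝ} (hf : ContDiff ℝ 1 f) (hf' : HasCompactSupport f)
    (hg : ContDiff ℝ 1 g) (hg' : HasCompactSupport g) :
    ∫ z, (fderiv ℝ f z 1 + fderiv ℝ g z Complex.I) * (∫ q, τ q / (c q - z) ∂σ).im =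
      2 * Real.pi * ∫ q, (f (c q) * (τ q).im - g (c q) * (τ q).re) ∂σ := by
  have hcont : ∀ h : ℂ → ℝ, ContDiff ℝ 1 h → ∀ u : ℂ, Continuous fun z => fderiv ℝ h z u :=
    fun h hh u => (hh.continuous_fderiv one_ne_zero).clm_apply continuous_const
  have hcs : ∀ h : ℂ → ℝ, HasCompactSupport h → ∀ u : ℂ,
    HasCompactSupport fun z => fderiv ℝ h z u := fun h hh' u => hh'.fderiv_apply ℝ u
  set d : ℂ → ℝ := fun z => fderiv ℝ f z 1 + fderiv ℝ g z Complex.I with hd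
  set r : ℂ → ℝ := fun z => fderiv ℝ f z Complex.I - fderiv ℝ g z 1 with hr
  have hdc : Continuous d := (hcont f hf _).add (hcont g hg _)
  have hrc : Continuous r := (hcont f hf _).sub (hcont g hg _)
  have hds : HasCompactSupport d := (hcs f hf' _).add (hcs g hg' _)
  have hrs : HasCompactSupport r := (hcs f hf' _).sub (hcs g hg' _)
  set k : ℂ → ℂ := fun z => ∫ q, τ q / (c q - z) ∂σ with hk
  have hpd := integrable_mul_cauchy_prod hc hτ hτ1 hdc hds
  have hpr := integrable_mul_cauchy_prod hc hτ hτ1 hrc hrs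
  have h1 : ∫ z, d z * (k z).im = (∫ z, (d z : ℂ) * k z).im := by
    have hint : Integrable fun z => (d z : ℂ) * k z := by
      have := hpd.integral_prod_left
      simpa only [integral_const_mul] using this
    have := integral_im hint
    simp only [RCLike.im_to_complex, Complex.im_ofReal_mul] at this
    exact this
  have h2 : (∫ z, (r z : ℂ) * k z).re = 0 := by
    have hint : Integrable fun z => (r z : ℂ) * k z := by
      have := hpr.integral_prod_left
      simpa only [integral_const_mul] using this
    have := integral_re hint
    simp only [RCLike.re_to_complex, Complex.re_ofReal_mul] at this
    rw [← this]
    refine integral_eq_zero_of_ae ?_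
    filter_upwards [hre] with z hz
    simp only [hk, hz, mul_zero, Pi.zero_apply]
  -- The added curl term vanishes because the real part of `k` does. It allows the pointwise
  -- identity for the Cauchy kernel to be applied under the integral after Fubini.
  have h3 : ∫ z, d z * (k z).im = (∫ z, (d z : ℂ) * k z).im + (∫ z, (r z : ℂ) * k z).re := by
    rw [h1, h2, add_zero]
  rw [h3, integral_mul_cauchy_swap hc hτ hτ1 hdc hds, integral_mul_cauchy_swap hc hτ hτ1 hrc hrs]
  have h4 := integral_im (μ := σ) hpd.integral_prod_right
  have h5 := integral_re (μ := σ) hpr.integral_prod_right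
  simp only [RCLike.im_to_complex, RCLike.re_to_complex] at h4 h5
  have i4 : Integrable (fun q => (∫ z : ℂ, (d z : ℂ) * (τ q / (c q - z))).im) σ :=
    hpd.integral_prod_right.im
  have i5 : Integrable (fun q => (∫ z : ℂ, (r z : ℂ) * (τ q / (c q - z))).re) σ :=
    hpr.integral_prod_right.re
  rw [← h4, ← h5, ← integral_add i4 i5, ← integral_const_mul]
  refine integral_congr_ae (Eventually.of_forall fun q => ?_)
  have h6 := integral_im (integrable_mul_cauchy hdc hds (c q) (τ q))
  have h7 := integral_re (integrable_mul_cauchy hrc hrs (c q) (τ q))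
  simp only [RCLike.im_to_complex, RCLike.re_to_complex] at h6 h7
  simp only
  rw [← h6, ← h7,
    ← integral_div_curl_cauchy hf hf' hg hg', ← integral_add]
  · simp only [Complex.im_ofReal_mul, Complex.re_ofReal_mul, hd, hr]
  · exact (integrable_mul_cauchy hdc hds (c q) (τ q)).im
  · exact (integrable_mul_cauchy hrc hrs (c q) (τ q)).re

end Cauchy


/-! ### Tangential derivatives along the boundary -/

section BoundaryDerivative

variable {S : Type*} [TopologicalSpace S] [ChartedSpace (EuclideanHalfSpace 2) S]
  [IsManifold (𝓡∂ 2) ∞ S] {F ν : S → E3} {θ : ℝ}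

theorem exists_smooth_partition [CompactSpace S] [T2Space S] :
    ∃ (t : Finset S) (χ : S → S → ℝ), (∀ p, ContMDiff (𝓡∂ 2) 𝓘(ℝ, ℝ) ∞ (χ p)) ∧
      (∀ p, tsupport (χ p) ⊆ (extChartAt (𝓡∂ 2) p).source) ∧ ∀ x, ∑ p ∈ t, χ p x = 1 := by
  obtain ⟨f, hf⟩ := SmoothPartitionOfUnity.exists_isSubordinate_chartAt_source (𝓡∂ 2) S
  have hfin := f.locallyFinite.finite_nonempty_of_compact
  refine ⟨hfin.toFinset, fun p => f p, fun p => (f p).contMDiff, fun p => ?_, fun x => ?_⟩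
  · rw [extChartAt_source]
    exact hf p
  · rw [← f.sum_eq_one (mem_univ x)]
    refine (finsum_eq_sum_of_support_subset _ fun p hp => ?_).symm
    rw [Finset.mem_coe, hfin.mem_toFinset]
    exact ⟨x, hp⟩

theorem isCompact_chart_image_tsupport [CompactSpace S] {f : S → ℝ} {p : S}
    (hf : tsupport f ⊆ (extChartAt (𝓡∂ 2) p).source) :
    IsCompact (extChartAt (𝓡∂ 2) p '' tsupport f) ∧
      extChartAt (𝓡∂ 2) p '' tsupport f ⊆ chartTarget p ∧
      ∀ u ∈ chartTarget p, u ∉ extChartAt (𝓡∂ 2) p '' tsupport f →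
        (extChartAt (𝓡∂ 2) p).symm u ∉ tsupport f := by
  refine ⟨(isClosed_tsupport f).isCompact.image_of_continuousOn
    ((continuousOn_extChartAt p).mono hf), ?_, ?_⟩
  · rintro _ ⟨x, hx, rfl⟩
    exact (extChartAt (𝓡∂ 2) p).map_source (hf hx)
  · intro u hu hun hmem
    exact hun ⟨_, hmem, (extChartAt (𝓡∂ 2) p).right_inv hu⟩

/-- At boundary points the second coordinate vector is parallel to `τ`, but a chart may traverse the
boundary against `τ`; hence the signed factor. -/
theorem IsCapillaryImmersion.chartPartial_tangent (hF : IsCapillaryImmersion θ F ν)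
    (hθ : θ ∈ Set.Ioo 0 Real.pi) {p : S} {u : E2} (hu : u ∈ chartTarget p) (hu0 : u 0 = 0) :
    chartPartial F p u 1 = (inner ℝ (chartPartial F p u 1)
      (capillaryTangent θ ν ((extChartAt (𝓡∂ 2) p).symm u)) : ℝ) •
        capillaryTangent θ ν ((extChartAt (𝓡∂ 2) p).symm u) ∧
    ‖chartPartial F p u 1‖ = |(inner ℝ (chartPartial F p u 1)
      (capillaryTangent θ ν ((extChartAt (𝓡∂ 2) p).symm u)) : ℝ)| ∧
    (inner ℝ (chartPartial F p u 1)
      (capillaryTangent θ ν ((extChartAt (𝓡∂ 2) p).symm u)) : ℝ) ≠ 0 := by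
  have hs : 0 < Real.sin θ := Real.sin_pos_of_mem_Ioo hθ
  have hb := (symm_mem_boundary_iff hu).2 hu0
  have h := (capillary_conormal_formula hs (Real.sin_sq_add_cos_sq θ) (hF.inner_normal_self _)
    (hF.normal_two_and_conormal hθ hb).1 (hF.inner_normal_chartPartial hu 0)
    (hF.inner_normal_chartPartial hu 1) (hF.chartPartial_two hu hu0).1
    (hF.chartPartial_two hu hu0).2).2
  refine ⟨h.1, h.2, fun h0 => ?_⟩
  have hz : chartPartial F p u 1 = 0 := by
    rw [← norm_eq_zero]
    refine h.2.trans ?_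
    rw [abs_eq_zero]
    exact h0
  have hinj := fderivWithin_chartMap_injective hF.contMDiff_one hF.immersion hu
  have h1 : (EuclideanSpace.single 1 1 : E2) = 0 := by
    refine hinj ?_
    rw [map_zero]
    exact hz
  simpa using congrArg (fun v : E2 => v 1) h1

open Classical in
/-- The tangent vector of the surface that `F` maps to the boundary tangent. -/
def tangentDirection (θ : ℝ) (F ν : S → E3) (p : S) : E2 :=
  if h : ∃ v : E2, differential F p v = capillaryTangent θ ν p then h.choose else 0

theorem differential_tangentDirection {p : S}
    (h : ∃ v : E2, differential F p v = capillaryTangent θ ν p) :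
    differential F p (tangentDirection θ F ν p) = capillaryTangent θ ν p := by
  rw [tangentDirection, dif_pos h]
  exact h.choose_spec

/-- The differential of a real function on the surface. -/
def scalarDifferential (f : S → ℝ) (p : S) : E2 →L[ℝ] ℝ :=
  mfderiv (𝓡∂ 2) 𝓘(ℝ, ℝ) f p

/-- The derivative of a function on the surface in the direction of the boundary tangent. -/
def tangentialDerivative (θ : ℝ) (F ν : S → E3) (f : S → ℝ) (p : S) : ℝ :=
  scalarDifferential f p (tangentDirection θ F ν p)

/-- Injectivity of the differential of `F` makes the second coordinate direction a multiple of
`tangentDirection`, with the same factor as for the image vectors. -/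
theorem IsCapillaryImmersion.fderivWithin_eq_tangentialDerivative
    (hF : IsCapillaryImmersion θ F ν) (hθ : θ ∈ Set.Ioo 0 Real.pi) {f : S → ℝ}
    (hf : ContMDiff (𝓡∂ 2) 𝓘(ℝ, ℝ) 1 f) {p : S} {u : E2} (hu : u ∈ chartTarget p)
    (hu0 : u 0 = 0) :
    fderivWithin ℝ (chartMap f p) (range (𝓡∂ 2)) u (EuclideanSpace.single 1 1) =
      inner ℝ (chartPartial F p u 1) (capillaryTangent θ ν ((extChartAt (𝓡∂ 2) p).symm u)) *
        tangentialDerivative θ F ν f ((extChartAt (𝓡∂ 2) p).symm u) := by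
  obtain ⟨h1, -, h3⟩ := hF.chartPartial_tangent hθ hu hu0
  set c : ℝ := inner ℝ (chartPartial F p u 1)
    (capillaryTangent θ ν ((extChartAt (𝓡∂ 2) p).symm u)) with hc
  set w := chartDifferential p u (EuclideanSpace.single 1 1) with hw
  have hFw : chartPartial F p u 1 = differential F ((extChartAt (𝓡∂ 2) p).symm u) w := by
    have h := fderivWithin_chartMap hu (hF.contMDiff_one.mdifferentiableAt one_ne_zero)
    change fderivWithin ℝ (chartMap F p) (range (𝓡∂ 2)) u (EuclideanSpace.single 1 1) = _
    rw [h]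
    rfl
  have hex : ∃ v : E2, differential F ((extChartAt (𝓡∂ 2) p).symm u) v =
      capillaryTangent θ ν ((extChartAt (𝓡∂ 2) p).symm u) := by
    refine ⟨c⁻¹ • w, ?_⟩
    rw [map_smul, ← hFw, h1, smul_smul, inv_mul_cancel₀ h3, one_smul]
  have hv := differential_tangentDirection hex
  have hwv : w = c • tangentDirection θ F ν ((extChartAt (𝓡∂ 2) p).symm u) := by
    refine hF.immersion ((extChartAt (𝓡∂ 2) p).symm u) ?_
    rw [map_smul, hv, ← hFw]
    exact h1
  rw [fderivWithin_chartMap hu (hf.mdifferentiableAt one_ne_zero)]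
  change scalarDifferential f _ w = c * scalarDifferential f _ _
  rw [hwv, map_smul, smul_eq_mul]

variable [CompactSpace S] [MeasurableSpace S] [BorelSpace S]

/-- The definition uses preferred charts, but in one fixed chart the derivative is the quotient of
`∂₂ f` and the signed boundary speed, both continuous there. -/
theorem IsCapillaryImmersion.continuousOn_tangentialDerivative
    (hF : IsCapillaryImmersion θ F ν) (hθ : θ ∈ Set.Ioo 0 Real.pi) {f : S → ℝ}
    (hf : ContMDiff (𝓡∂ 2) 𝓘(ℝ, ℝ) 1 f) :
    ContinuousOn (tangentialDerivative θ F ν f) ((𝓡∂ 2).boundary S) := by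
  intro q hq
  have hso : IsOpen (extChartAt (𝓡∂ 2) q).source := isOpen_extChartAt_source q
  have hcoord : ∀ x ∈ (extChartAt (𝓡∂ 2) q).source ∩ (𝓡∂ 2).boundary S,
      extChartAt (𝓡∂ 2) q x ∈ chartTarget q ∧ extChartAt (𝓡∂ 2) q x 0 = 0 := by
    intro x hx
    have ht := (extChartAt (𝓡∂ 2) q).map_source hx.1
    refine ⟨ht, (symm_mem_boundary_iff ht).1 ?_⟩
    rw [(extChartAt (𝓡∂ 2) q).left_inv hx.1]
    exact hx.2
  have hmaps : MapsTo (extChartAt (𝓡∂ 2) q)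
      ((extChartAt (𝓡∂ 2) q).source ∩ (𝓡∂ 2).boundary S) (chartTarget q) :=
    fun x hx => (hcoord x hx).1
  have hφ : ContinuousOn (extChartAt (𝓡∂ 2) q)
      ((extChartAt (𝓡∂ 2) q).source ∩ (𝓡∂ 2).boundary S) :=
    (continuousOn_extChartAt q).mono inter_subset_left
  have hnum : ContinuousOn (fun u => fderivWithin ℝ (chartMap f q) (range (𝓡∂ 2)) u
      (EuclideanSpace.single 1 1)) (chartTarget q) :=
    ((contDiffOn_fderivWithin_chartMap (n := 0) (by simpa using hf) q).continuousOn).clm_apply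
      continuousOn_const
  have hden : ContinuousOn (fun x : S => (inner ℝ (chartPartial F q (extChartAt (𝓡∂ 2) q x) 1)
      (capillaryTangent θ ν x) : ℝ)) ((extChartAt (𝓡∂ 2) q).source ∩ (𝓡∂ 2).boundary S) :=
    ((continuousOn_chartPartial hF.contMDiff_one q 1).comp hφ hmaps).inner
      (continuous_capillaryTangent hF.normal_continuous).continuousOn
  have hcont : ContinuousOn (tangentialDerivative θ F ν f)
      ((extChartAt (𝓡∂ 2) q).source ∩ (𝓡∂ 2).boundary S) := by
    refine ((hnum.comp hφ hmaps).div hden ?_).congr ?_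
    · intro x hx
      have h := (hF.chartPartial_tangent hθ (hcoord x hx).1 (hcoord x hx).2).2.2
      rwa [(extChartAt (𝓡∂ 2) q).left_inv hx.1] at h
    · intro x hx
      have h := hF.fderivWithin_eq_tangentialDerivative hθ hf (hcoord x hx).1 (hcoord x hx).2
      have h' := (hF.chartPartial_tangent hθ (hcoord x hx).1 (hcoord x hx).2).2.2
      rw [(extChartAt (𝓡∂ 2) q).left_inv hx.1] at h h'
      simp only [Function.comp_apply, Pi.div_apply]
      rw [h, mul_div_cancel_left₀ _ h']
  have := hcont q ⟨mem_extChartAt_source q, hq⟩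
  rw [inter_comm] at this
  exact this.mono_of_mem_nhdsWithin
    (inter_mem self_mem_nhdsWithin (mem_nhdsWithin_of_mem_nhds (hso.mem_nhds (mem_extChartAt_source q))))

theorem tangentialDerivative_eq_zero {f : S → ℝ} {x : S} (hx : x ∉ tsupport f) :
    tangentialDerivative θ F ν f x = 0 := by
  have h0 : f =ᶠ[𝓝 x] fun _ => (0 : ℝ) := notMem_tsupport_iff_eventuallyEq.1 hx
  have h1 : scalarDifferential f x = 0 := by
    rw [scalarDifferential, h0.mfderiv_eq, mfderiv_const]
    rfl
  rw [tangentialDerivative, h1]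
  rfl

theorem IsCapillaryImmersion.boundaryLength_eq_restrict [Nonempty S]
    (hF : IsCapillaryImmersion θ F ν) :
    (boundaryLength F).restrict ((𝓡∂ 2).boundary S) = boundaryLength F := by
  refine Measure.restrict_eq_self_of_ae_mem ?_
  rw [ae_iff]
  have h := boundaryLength_interior hF.contMDiff_one hF.immersion
  rwa [← ModelWithCorners.compl_boundary] at h

theorem IsCapillaryImmersion.integrable_of_continuousOn_boundary [Nonempty S] {E : Type*}
    [NormedAddCommGroup E] (hF : IsCapillaryImmersion θ F ν) {f : S → E}
    (hf : ContinuousOn f ((𝓡∂ 2).boundary S)) : Integrable f (boundaryLength F) := by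
  have := isFiniteMeasure_boundaryLength hF.contMDiff_one hF.immersion
  rw [← hF.boundaryLength_eq_restrict]
  exact hf.integrableOn_compact' ((𝓡∂ 2).isClosed_boundary (n := ∞) (by simp)).isCompact
    measurableSet_manifoldBoundary

theorem IsCapillaryImmersion.integral_tangentialDerivative_of_tsupport [Nonempty S]
    (hF : IsCapillaryImmersion θ F ν) (hθ : θ ∈ Set.Ioo 0 Real.pi) {f : S → ℝ}
    (hf : ContMDiff (𝓡∂ 2) 𝓘(ℝ, ℝ) 1 f) {p : S}
    (hfp : tsupport f ⊆ (extChartAt (𝓡∂ 2) p).source) :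
    ∫ x, tangentialDerivative θ F ν f x ∂(boundaryLength F) = 0 := by
  have hc := hF.contMDiff_one
  have hD := hF.continuousOn_tangentialDerivative hθ hf
  have hint := hF.integrable_of_continuousOn_boundary hD
  rw [integral_boundaryLength_of_support hc hF.immersion p
    (by rw [← boundaryLength_restrict hc hF.immersion]; exact hint.aestronglyMeasurable.restrict)
    fun x hx => tangentialDerivative_eq_zero fun h => hx (hfp h)]
  obtain ⟨hK, hKT, hKn⟩ := isCompact_chart_image_tsupport hfp
  set K := extChartAt (𝓡∂ 2) p '' tsupport f with hKdef
  set B := boundaryParameters p with hB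
  have hBo : IsOpen B := isOpen_boundaryParameters p
  have hline : Continuous fun t : ℝ => (!₂[0, t] : E2) := by
    have := boundaryLine.continuous
    refine this.congr fun t => boundaryLine_apply t
  have hKcl : IsClosed {t : ℝ | !₂[0, t] ∈ K} := hK.isClosed.preimage hline
  have hKb : IsCompact {t : ℝ | !₂[0, t] ∈ K} := by
    refine Metric.isCompact_of_isClosed_isBounded hKcl ?_
    obtain ⟨R, hR⟩ := hK.isBounded.exists_norm_le
    refine isBounded_iff_forall_norm_le.2 ⟨R, fun t ht => ?_⟩
    exact (PiLp.norm_apply_le (!₂[0, t] : E2) 1).trans (hR _ ht)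
  have hKB : {t : ℝ | !₂[0, t] ∈ K} ⊆ B := fun t ht => hKT ht
  set k' : ℝ → ℝ := B.indicator fun t => ‖chartPartial F p !₂[0, t] 1‖ *
    tangentialDerivative θ F ν f ((extChartAt (𝓡∂ 2) p).symm !₂[0, t]) with hk'
  -- The sign of the chart orientation relative to `τ`. With it the integrand `k'` becomes the
  -- derivative of the compactly supported function `ε f`.
  set ε : ℝ → ℝ := fun t => ‖chartPartial F p !₂[0, t] 1‖ / inner ℝ (chartPartial F p !₂[0, t] 1)
    (capillaryTangent θ ν ((extChartAt (𝓡∂ 2) p).symm !₂[0, t])) with hε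
  set k : ℝ → ℝ := B.indicator fun t => ε t * chartMap f p !₂[0, t] with hk
  have hout : ∀ t, !₂[0, t] ∉ K → k t = 0 ∧ k' t = 0 := by
    intro t ht
    by_cases htB : t ∈ B
    · have hn := hKn _ htB ht
      rw [hk, hk', indicator_of_mem htB, indicator_of_mem htB, tangentialDerivative_eq_zero hn]
      simp only [chartMap, Function.comp_apply, image_eq_zero_of_notMem_tsupport hn, mul_zero,
        and_self]
    · rw [hk, hk', indicator_of_notMem htB, indicator_of_notMem htB]
      exact ⟨rfl, rfl⟩
  have houtev : ∀ t, !₂[0, t] ∉ K → k =ᶠ[𝓝 t] (fun _ => 0) ∧ k' =ᶠ[𝓝 t] fun _ => 0 := by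
    intro t ht
    have hev : ∀ᶠ s in 𝓝 t, !₂[0, s] ∉ K := hKcl.isOpen_compl.mem_nhds ht
    exact ⟨hev.mono fun s hs => (hout s hs).1, hev.mono fun s hs => (hout s hs).2⟩
  have hψ := continuousOn_boundary_symm p
  have hnorm := (continuousOn_norm_boundary_chartPartial hc p).norm
  have hψb : MapsTo (fun t : ℝ => (extChartAt (𝓡∂ 2) p).symm !₂[0, t]) B ((𝓡∂ 2).boundary S) :=
    fun t ht => (symm_mem_boundary_iff (p := p) ht).2 rfl
  have hk'c : Continuous k' := by
    rw [continuous_iff_continuousAt]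
    intro t
    by_cases ht : !₂[0, t] ∈ K
    · have htB : B ∈ 𝓝 t := hBo.mem_nhds (hKB ht)
      have h1 := (hnorm.mul (hD.comp hψ hψb)).continuousAt htB
      refine h1.congr ?_
      filter_upwards [htB] with s hs
      rw [hk', indicator_of_mem hs]
      rfl
    · exact continuousAt_const.congr (houtev t ht).2.symm
  have hεc : ContinuousOn ε B := hnorm.div
    ((continuousOn_norm_boundary_chartPartial hc p).inner
      ((continuous_capillaryTangent hF.normal_continuous).comp_continuousOn hψ))
    fun t ht => (hF.chartPartial_tangent hθ ht rfl).2.2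
  have hε1 : ∀ t ∈ B, ε t = 1 ∨ ε t = -1 := by
    intro t ht
    obtain ⟨-, h2, h3⟩ := hF.chartPartial_tangent hθ (p := p) ht rfl
    simp only [hε]
    rw [h2]
    rcases abs_choice (inner ℝ (chartPartial F p !₂[0, t] 1)
      (capillaryTangent θ ν ((extChartAt (𝓡∂ 2) p).symm !₂[0, t])) : ℝ) with h | h
    · left; rw [h, div_self h3]
    · right; rw [h, neg_div, div_self h3]
  -- A continuous function with values `±1` is locally constant: distance less than `1` excludes the
  -- opposite sign.
  have hεloc : ∀ t ∈ B, ∀ᶠ s in 𝓝 t, s ∈ B ∧ ε s = ε t := by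
    intro t ht
    have htB : B ∈ 𝓝 t := hBo.mem_nhds ht
    have h1 := Metric.tendsto_nhds.1 (hεc.continuousAt htB) 1 one_pos
    filter_upwards [h1, htB] with s hs hsB
    refine ⟨hsB, ?_⟩
    rw [Real.dist_eq, abs_lt] at hs
    rcases hε1 s hsB with h | h <;> rcases hε1 t ht with h' | h' <;> rw [h, h'] at hs ⊢ <;>
      norm_num at hs
  have hder : ∀ t, HasDerivAt k (k' t) t := by
    intro t
    by_cases ht : !₂[0, t] ∈ K
    · have htB : t ∈ B := hKB ht
      obtain ⟨-, -, h3⟩ := hF.chartPartial_tangent hθ (p := p) htB rfl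
      have h1 := (hasDerivAt_boundary_chartMap hf htB).const_mul (ε t)
      rw [hF.fderivWithin_eq_tangentialDerivative hθ hf htB rfl] at h1
      have h2 : k' t = ε t * (inner ℝ (chartPartial F p !₂[0, t] 1)
          (capillaryTangent θ ν ((extChartAt (𝓡∂ 2) p).symm !₂[0, t])) *
          tangentialDerivative θ F ν f ((extChartAt (𝓡∂ 2) p).symm !₂[0, t])) := by
        rw [hk', indicator_of_mem htB, hε]
        field_simp
      rw [h2]
      refine h1.congr_of_eventuallyEq ?_
      filter_upwards [hεloc t htB] with s hs
      rw [hk, indicator_of_mem hs.1, hs.2]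
    · rw [(hout t ht).2]
      exact (hasDerivAt_const t (0 : ℝ)).congr_of_eventuallyEq (houtev t ht).1
  have hkc : Continuous k := continuous_iff_continuousAt.2 fun t => (hder t).continuousAt
  have hks : HasCompactSupport k := HasCompactSupport.intro hKb fun t ht => (hout t ht).1
  have hk's : HasCompactSupport k' := HasCompactSupport.intro hKb fun t ht => (hout t ht).2
  rw [← integral_indicator hBo.measurableSet]
  exact integral_eq_zero_of_hasDerivAt_of_integrable hder (hk'c.integrable_of_hasCompactSupport hk's)
    (hkc.integrable_of_hasCompactSupport hks)

/-- The tangential derivative of a function integrates to zero over the closed boundary curves. -/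
theorem IsCapillaryImmersion.integral_tangentialDerivative [T2Space S] [Nonempty S]
    (hF : IsCapillaryImmersion θ F ν) (hθ : θ ∈ Set.Ioo 0 Real.pi) {f : S → ℝ}
    (hf : ContMDiff (𝓡∂ 2) 𝓘(ℝ, ℝ) 1 f) :
    ∫ x, tangentialDerivative θ F ν f x ∂(boundaryLength F) = 0 := by
  obtain ⟨t, χ, hχ, hχs, hχ1⟩ := exists_smooth_partition (S := S)
  have hχ' : ∀ p, ContMDiff (𝓡∂ 2) 𝓘(ℝ, ℝ) 1 (χ p) := fun p => (hχ p).of_le (mod_cast le_top)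
  have hprod : ∀ p, ContMDiff (𝓡∂ 2) 𝓘(ℝ, ℝ) 1 (χ p * f) := fun p => (hχ' p).mul hf
  have hts : ∀ p, tsupport (χ p * f) ⊆ (extChartAt (𝓡∂ 2) p).source := fun p =>
    (tsupport_mul_subset_left).trans (hχs p)
  have hsum : ∀ x, tangentialDerivative θ F ν f x =
      ∑ p ∈ t, tangentialDerivative θ F ν (χ p * f) x := by
    intro x
    have hfe : f = ∑ p ∈ t, χ p * f := by
      ext y
      rw [Finset.sum_apply]
      simp only [Pi.mul_apply]
      rw [← Finset.sum_mul, hχ1, one_mul]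
    have h : ∀ s : Finset S, MDifferentiableAt (𝓡∂ 2) 𝓘(ℝ, ℝ) (∑ p ∈ s, χ p * f) x ∧
        scalarDifferential (∑ p ∈ s, χ p * f) x = ∑ p ∈ s, scalarDifferential (χ p * f) x := by
      classical
      intro s
      induction s using Finset.induction_on with
      | empty =>
        rw [Finset.sum_empty, Finset.sum_empty]
        exact ⟨mdifferentiableAt_const, mfderiv_const⟩
      | insert p s hp ih =>
        have hp1 := (hprod p).mdifferentiableAt (x := x) one_ne_zero
        rw [Finset.sum_insert hp, Finset.sum_insert hp, ← ih.2]
        exact ⟨hp1.add ih.1, mfderiv_add hp1 ih.1⟩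
    have hd' := (h t).2
    rw [← hfe] at hd'
    simp only [tangentialDerivative]
    rw [hd', sum_apply]
  simp_rw [hsum]
  rw [integral_finsetSum _ fun p _ => hF.integrable_of_continuousOn_boundary
    (hF.continuousOn_tangentialDerivative hθ (hprod p))]
  exact Finset.sum_eq_zero fun p _ =>
    hF.integral_tangentialDerivative_of_tsupport hθ (hprod p) (hts p)

end BoundaryDerivative


/-! ### The boundary plane as a copy of `ℂ` -/

/-- The isometric embedding of `ℂ` onto the boundary plane. -/
def planeEmbedding : ℂ →ₗᵢ[ℝ] E3 where
  toFun z := !₂[z.re, z.im, 0]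
  map_add' z w := by ext i; fin_cases i <;> simp
  map_smul' c z := by ext i; fin_cases i <;> simp
  norm_map' z := by
    rw [Complex.norm_eq_sqrt_sq_add_sq]
    simp [EuclideanSpace.norm_eq, Fin.sum_univ_three]

theorem planeEmbedding_apply_zero (z : ℂ) : planeEmbedding z 0 = z.re := rfl

theorem planeEmbedding_apply_one (z : ℂ) : planeEmbedding z 1 = z.im := rfl

theorem planeEmbedding_apply_two (z : ℂ) : planeEmbedding z 2 = 0 := rfl

/-- The horizontal coordinates as a complex number. -/
def planeProjection (x : E3) : ℂ := ⟨x 0, x 1⟩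

theorem continuous_planeProjection : Continuous planeProjection :=
  Complex.equivRealProdCLM.symm.continuous.comp
    (g := Complex.equivRealProdCLM.symm) (f := fun x : E3 => (x 0, x 1)) (by fun_prop)

theorem planeEmbedding_planeProjection {x : E3} (hx : x ∈ boundaryPlane) :
    planeEmbedding (planeProjection x) = x :=
  E3.ext_coord rfl rfl (Eq.symm hx)

theorem range_planeEmbedding : range planeEmbedding = boundaryPlane := by
  ext x
  constructor
  · rintro ⟨z, rfl⟩
    exact planeEmbedding_apply_two z
  · intro hx
    exact ⟨_, planeEmbedding_planeProjection hx⟩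

theorem isClosedEmbedding_planeEmbedding : IsClosedEmbedding planeEmbedding :=
  planeEmbedding.isometry.isClosedEmbedding

theorem hausdorff_restrict_boundaryPlane :
    (μHE[2] : Measure E3).restrict boundaryPlane = (volume : Measure ℂ).map planeEmbedding := by
  ext B hB
  rw [Measure.restrict_apply hB, isClosedEmbedding_planeEmbedding.measurableEmbedding.map_apply,
    ← range_planeEmbedding, ← image_preimage_eq_inter_range,
    planeEmbedding.isometry.euclideanHausdorffMeasure_image]
  have h := InnerProductSpace.euclideanHausdorffMeasure_eq_volume (V := ℂ)
  rw [Complex.finrank_real_complex] at h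
  rw [h]

/-- Since `t / v = t v̄ / |v|²`, the real part of the quotient is the radial component and the
imaginary part the angular one; the next lemma is the latter. -/
theorem inner_planeEmbedding_div (v : ℂ) (t : E3) :
    inner ℝ (planeEmbedding v) t / ‖planeEmbedding v‖ ^ 2 = (planeProjection t / v).re := by
  rw [planeEmbedding.norm_map, inner_E3, planeEmbedding_apply_zero, planeEmbedding_apply_one,
    planeEmbedding_apply_two, div_eq_mul_inv (planeProjection t), Complex.mul_re, Complex.inv_re,
    Complex.inv_im, Complex.normSq_eq_norm_sq]
  simp only [planeProjection]
  ring

theorem inner_cross_planeEmbedding_div (v : ℂ) (t : E3) :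
    inner ℝ (cross vertical (planeEmbedding v)) t / ‖planeEmbedding v‖ ^ 2 =
      (planeProjection t / v).im := by
  rw [planeEmbedding.norm_map, inner_E3, cross_apply_zero, cross_apply_one, cross_apply_two,
    vertical_apply_zero, vertical_apply_one, vertical_apply_two, planeEmbedding_apply_zero,
    planeEmbedding_apply_one, planeEmbedding_apply_two, div_eq_mul_inv (planeProjection t),
    Complex.mul_im, Complex.inv_re, Complex.inv_im, Complex.normSq_eq_norm_sq]
  simp only [planeProjection]
  ring

theorem divAlong_planeSubmodule {X : E3 → E3} (hX : ContDiff ℝ 1 X) (z : ℂ) :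
    divAlong planeSubmodule X (planeEmbedding z) =
      fderiv ℝ (fun z => X (planeEmbedding z) 0) z 1 +
        fderiv ℝ (fun z => X (planeEmbedding z) 1) z Complex.I := by
  have hpart : ∀ (i : Fin 3) (v : ℂ), fderiv ℝ (fun z => X (planeEmbedding z) i) z v =
      fderiv ℝ X (planeEmbedding z) (planeEmbedding v) i := by
    intro i v
    have h1 : HasFDerivAt (fun z => X (planeEmbedding z))
        (fderiv ℝ X (planeEmbedding z) ∘L planeEmbedding.toContinuousLinearMap) z :=
      (hX.differentiable one_ne_zero _).hasFDerivAt.comp z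
        planeEmbedding.toContinuousLinearMap.hasFDerivAt
    have h2 := (EuclideanSpace.proj i : E3 →L[ℝ] ℝ).hasFDerivAt.comp z h1
    exact congrArg (fun L : ℂ →L[ℝ] ℝ => L v) h2.fderiv
  have haa : inner ℝ (planeEmbedding 1) (planeEmbedding 1) = (1 : ℝ) := by
    rw [inner_E3]; simp [planeEmbedding_apply_zero, planeEmbedding_apply_one, planeEmbedding_apply_two]
  have hbb : inner ℝ (planeEmbedding Complex.I) (planeEmbedding Complex.I) = (1 : ℝ) := by
    rw [inner_E3]; simp [planeEmbedding_apply_zero, planeEmbedding_apply_one, planeEmbedding_apply_two]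
  have hab : inner ℝ (planeEmbedding 1) (planeEmbedding Complex.I) = (0 : ℝ) := by
    rw [inner_E3]; simp [planeEmbedding_apply_zero, planeEmbedding_apply_one, planeEmbedding_apply_two]
  rw [divAlong_eq_of_basis (a := planeEmbedding 1) (b := planeEmbedding Complex.I) (D := 1)
    (planeEmbedding_apply_two 1) (planeEmbedding_apply_two Complex.I) ?_ (by rw [haa, hbb, hab]; norm_num)
    one_ne_zero, haa, hbb, hab, hpart, hpart]
  · simp [inner_E3, planeEmbedding_apply_zero, planeEmbedding_apply_one, planeEmbedding_apply_two]
  · intro v hv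
    refine ⟨v 0, v 1, ?_⟩
    have hv2 : v 2 = 0 := hv
    refine E3.ext_coord ?_ ?_ ?_ <;>
    simp [planeEmbedding_apply_zero, planeEmbedding_apply_one, planeEmbedding_apply_two, hv2]

/-! ### The winding number of the boundary curves -/

section Winding

variable {S : Type*} [TopologicalSpace S] [ChartedSpace (EuclideanHalfSpace 2) S]
  [IsManifold (𝓡∂ 2) ∞ S] {F ν : S → E3} {θ : ℝ}

theorem IsCapillaryImmersion.exists_differential_eq_capillaryTangent
    (hF : IsCapillaryImmersion θ F ν) (p : S) :
    ∃ v : E2, differential F p v = capillaryTangent θ ν p := by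
  have h : capillaryTangent θ ν p ∈ (tangentPlane F hF.immersion p).1 := by
    rw [hF.tangentPlane_eq, Submodule.mem_orthogonal_singleton_iff_inner_right, capillaryTangent,
      inner_smul_right, inner_E3]
    simp only [cross_apply_zero, cross_apply_one, cross_apply_two, vertical_apply_zero,
      vertical_apply_one, vertical_apply_two]
    ring
  exact h

theorem IsCapillaryImmersion.norm_capillaryTangent (hF : IsCapillaryImmersion θ F ν)
    (hθ : θ ∈ Set.Ioo 0 Real.pi) {p : S} (hp : p ∈ (𝓡∂ 2).boundary S) :
    ‖capillaryTangent θ ν p‖ = 1 := by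
  have h := (inner_capillary_frame (Real.sin_pos_of_mem_Ioo hθ).ne' (Real.sin_sq_add_cos_sq θ)
    (hF.inner_normal_self p) (hF.normal_two_and_conormal hθ hp).1).1
  rw [real_inner_self_eq_norm_sq] at h
  have h' : ‖capillaryTangent θ ν p‖ ^ 2 = 1 := h
  exact (pow_eq_one_iff_of_nonneg (norm_nonneg _) two_ne_zero).1 h'

theorem norm_planeProjection_le (x : E3) : ‖planeProjection x‖ ≤ ‖x‖ := by
  rw [Complex.norm_eq_sqrt_sq_add_sq, EuclideanSpace.norm_eq]
  refine Real.sqrt_le_sqrt ?_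
  rw [Fin.sum_univ_three]
  simp only [planeProjection, Real.norm_eq_abs, sq_abs]
  nlinarith [sq_nonneg (x 2)]

variable [CompactSpace S] [MeasurableSpace S] [BorelSpace S] [Nonempty S]

theorem IsCapillaryImmersion.ae_mem_boundary (hF : IsCapillaryImmersion θ F ν) :
    ∀ᵐ p ∂(boundaryLength F), p ∈ (𝓡∂ 2).boundary S := by
  rw [← hF.boundaryLength_eq_restrict]
  exact ae_restrict_mem measurableSet_manifoldBoundary

/-- The Cauchy integral of the boundary curves. -/
def cauchyIntegral (θ : ℝ) (F ν : S → E3) (z : ℂ) : ℂ :=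
  ∫ p, planeProjection (capillaryTangent θ ν p) / (planeProjection (F p) - z) ∂(boundaryLength F)

theorem IsCapillaryImmersion.sub_eq_planeEmbedding (hF : IsCapillaryImmersion θ F ν) {p : S}
    (hp : p ∈ (𝓡∂ 2).boundary S) (z : ℂ) :
    F p - planeEmbedding z = planeEmbedding (planeProjection (F p) - z) := by
  rw [map_sub, planeEmbedding_planeProjection (hF.boundary_zero p hp)]

theorem IsCapillaryImmersion.integrable_cauchy (hF : IsCapillaryImmersion θ F ν) {z : ℂ}
    (hz : planeEmbedding z ∉ F '' (𝓡∂ 2).boundary S) :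
    Integrable (fun p => planeProjection (capillaryTangent θ ν p) / (planeProjection (F p) - z))
      (boundaryLength F) := by
  refine hF.integrable_of_continuousOn_boundary (ContinuousOn.div
    (continuous_planeProjection.comp
      (continuous_capillaryTangent hF.normal_continuous)).continuousOn
    ((continuous_planeProjection.comp hF.contMDiff.continuous).sub
      continuous_const).continuousOn fun p hp h0 => hz ⟨p, hp, ?_⟩)
  have h := hF.sub_eq_planeEmbedding hp z
  have h0' : planeProjection (F p) - z = 0 := h0
  rw [h0', map_zero] at h
  exact sub_eq_zero.1 h

/-- Change of the polar angle is the imaginary part of `dw / (w - z)` along the curve. -/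
theorem IsCapillaryImmersion.windingNumber_eq_cauchy (hF : IsCapillaryImmersion θ F ν)
    (hθ : θ ∈ Set.Ioo 0 Real.pi) {z : ℂ} (hz : planeEmbedding z ∉ F '' (𝓡∂ 2).boundary S) :
    windingNumber F ν (planeEmbedding z) = (2 * Real.pi)⁻¹ * (cauchyIntegral θ F ν z).im := by
  have h := integral_im (hF.integrable_cauchy hz)
  simp only [RCLike.im_to_complex] at h
  rw [windingNumber, cauchyIntegral, ← h]
  congr 1
  refine integral_congr_ae ?_
  filter_upwards [hF.ae_mem_boundary] with p hp
  rw [hF.boundaryTangent_eq hθ hp, hF.sub_eq_planeEmbedding hp, inner_cross_planeEmbedding_div]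

variable [T2Space S]

/-- The real part of the Cauchy integral vanishes: it integrates the derivative of `log |F - x|`. -/
theorem IsCapillaryImmersion.cauchyIntegral_re (hF : IsCapillaryImmersion θ F ν)
    (hθ : θ ∈ Set.Ioo 0 Real.pi) {z : ℂ} (hz : planeEmbedding z ∉ F '' (𝓡∂ 2).boundary S) :
    (cauchyIntegral θ F ν z).re = 0 := by
  set x := planeEmbedding z with hx
  -- Interior points are mapped strictly above the plane containing `x`, so `log |F - x|` is `C¹` on
  -- the entire surface, not only near the boundary.
  have hne : ∀ p, F p - x ≠ 0 := by
    intro p h0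
    have h1 : F p = x := sub_eq_zero.1 h0
    have h2 : F p ∈ boundaryPlane := by
      rw [h1]
      exact planeEmbedding_apply_two z
    exact hz ⟨p, (hF.mem_boundaryPlane_iff p).1 h2, h1⟩
  set φ : E3 → ℝ := fun y => Real.log (‖y - x‖ ^ 2) / 2 with hφ
  have hφd : ∀ p, ContDiffAt ℝ 1 φ (F p) := by
    intro p
    have h1 : ContDiffAt ℝ 1 (fun y : E3 => ‖y - x‖ ^ 2) (F p) :=
      ((contDiff_id.sub contDiff_const).norm_sq ℝ).contDiffAt
    exact (h1.log (pow_ne_zero 2 (norm_ne_zero_iff.2 (hne p)))).div_const 2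
  have hφ' : ∀ p v, fderiv ℝ φ (F p) v = inner ℝ (F p - x) v / ‖F p - x‖ ^ 2 := by
    intro p v
    have h1 : HasFDerivAt (fun y : E3 => y - x) (ContinuousLinearMap.id ℝ E3) (F p) :=
      (hasFDerivAt_id _).sub_const x
    have h2 := h1.norm_sq
    have h3 := (h2.log (pow_ne_zero 2 (norm_ne_zero_iff.2 (hne p)))).mul_const (2⁻¹ : ℝ)
    have h4 : HasFDerivAt φ _ (F p) := h3
    rw [h4.fderiv]
    simp only [smul_apply, ContinuousLinearMap.comp_id, innerSL_apply_apply, smul_eq_mul,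
      nsmul_eq_mul, Nat.cast_ofNat]
    ring
  have hf : ContMDiff (𝓡∂ 2) 𝓘(ℝ, ℝ) 1 (fun p => φ (F p)) := fun p =>
    (hφd p).contMDiffAt.comp p (hF.contMDiff_one p)
  have hD : ∀ p, tangentialDerivative θ F ν (fun p => φ (F p)) p =
      inner ℝ (F p - x) (capillaryTangent θ ν p) / ‖F p - x‖ ^ 2 := by
    intro p
    have h1 : scalarDifferential (fun p => φ (F p)) p = fderiv ℝ φ (F p) ∘L differential F p := by
      have h := mfderiv_comp p ((hφd p).contMDiffAt.mdifferentiableAt one_ne_zero)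
        ((hF.contMDiff_one p).mdifferentiableAt one_ne_zero)
      rw [mfderiv_eq_fderiv] at h
      exact h
    rw [tangentialDerivative, h1, ContinuousLinearMap.comp_apply,
      differential_tangentDirection (hF.exists_differential_eq_capillaryTangent p), hφ']
  have hzero := hF.integral_tangentialDerivative hθ hf
  have h := integral_re (hF.integrable_cauchy hz)
  simp only [RCLike.re_to_complex] at h
  rw [cauchyIntegral, ← h, ← hzero]
  refine integral_congr_ae ?_
  filter_upwards [hF.ae_mem_boundary] with p hp
  rw [hD, hF.sub_eq_planeEmbedding hp, inner_planeEmbedding_div]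

theorem IsCapillaryImmersion.ae_notMem_boundary_curve (hF : IsCapillaryImmersion θ F ν) :
    ∀ᵐ z : ℂ, planeEmbedding z ∉ F '' (𝓡∂ 2).boundary S := by
  have h0 := hausdorff_image_boundary hF.contMDiff_one hF.immersion
  have h1 : (volume : Measure ℂ).map planeEmbedding (F '' (𝓡∂ 2).boundary S) = 0 := by
    rw [← hausdorff_restrict_boundaryPlane]
    exact le_antisymm ((Measure.restrict_apply_le _ _).trans h0.le) zero_le
  rw [isClosedEmbedding_planeEmbedding.measurableEmbedding.map_apply] at h1
  exact compl_mem_ae_iff.2 h1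

theorem IsCapillaryImmersion.measurable_curve (hF : IsCapillaryImmersion θ F ν) :
    Measurable (fun p => planeProjection (F p)) ∧
      Measurable fun p => planeProjection (capillaryTangent θ ν p) :=
  ⟨(continuous_planeProjection.comp hF.contMDiff.continuous).measurable,
    (continuous_planeProjection.comp (continuous_capillaryTangent hF.normal_continuous)).measurable⟩

theorem IsCapillaryImmersion.ae_norm_tangent_le (hF : IsCapillaryImmersion θ F ν)
    (hθ : θ ∈ Set.Ioo 0 Real.pi) :
    ∀ᵐ p ∂(boundaryLength F), ‖planeProjection (capillaryTangent θ ν p)‖ ≤ 1 := by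
  filter_upwards [hF.ae_mem_boundary] with p hp
  exact (norm_planeProjection_le _).trans (hF.norm_capillaryTangent hθ hp).le

theorem IsCapillaryImmersion.locallyIntegrable_winding (hF : IsCapillaryImmersion θ F ν)
    (hθ : θ ∈ Set.Ioo 0 Real.pi) :
    LocallyIntegrable fun z => windingNumber F ν (planeEmbedding z) := by
  have := isFiniteMeasure_boundaryLength hF.contMDiff_one hF.immersion
  have h := locallyIntegrable_cauchy hF.measurable_curve.1 hF.measurable_curve.2
    (hF.ae_norm_tangent_le hθ)
  rw [locallyIntegrable_iff] at h ⊢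
  intro K hK
  have h1 : IntegrableOn (fun z => (2 * Real.pi)⁻¹ * (cauchyIntegral θ F ν z).im) K :=
    (h K hK).im.const_mul _
  refine h1.congr (ae_restrict_of_ae ?_)
  filter_upwards [hF.ae_notMem_boundary_curve] with z hz
  exact (hF.windingNumber_eq_cauchy hθ hz).symm

theorem IsCapillaryImmersion.continuousAt_winding (hF : IsCapillaryImmersion θ F ν)
    (hθ : θ ∈ Set.Ioo 0 Real.pi) {z : ℂ} (hz : planeEmbedding z ∉ F '' (𝓡∂ 2).boundary S) :
    ContinuousAt (fun z => windingNumber F ν (planeEmbedding z)) z := by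
  have := isFiniteMeasure_boundaryLength hF.contMDiff_one hF.immersion
  have hcl : IsClosed (F '' (𝓡∂ 2).boundary S) :=
    (((𝓡∂ 2).isClosed_boundary (n := ∞) (by simp)).isCompact.image hF.contMDiff.continuous).isClosed
  have hop : IsOpen (planeEmbedding ⁻¹' (F '' (𝓡∂ 2).boundary S)ᶜ) :=
    hcl.isOpen_compl.preimage planeEmbedding.continuous
  obtain ⟨δ, hδ, hball⟩ := Metric.isOpen_iff.1 hop z hz
  have hev : ∀ᶠ w in 𝓝 z, planeEmbedding w ∉ F '' (𝓡∂ 2).boundary S := hop.mem_nhds hz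
  have hdist : ∀ p ∈ (𝓡∂ 2).boundary S, δ ≤ ‖planeProjection (F p) - z‖ := by
    intro p hp
    by_contra hlt
    refine hball (a := planeProjection (F p)) ?_ ⟨p, hp, ?_⟩
    · rw [Metric.mem_ball, dist_eq_norm]
      exact not_le.1 hlt
    · rw [planeEmbedding_planeProjection (hF.boundary_zero p hp)]
  have hcont : ContinuousAt (cauchyIntegral θ F ν) z := by
    -- With `δ` at most the distance from `z` to the curves, points of the ball of radius `δ / 2`
    -- stay at distance at least `δ / 2` from them, which bounds the kernel.
    refine continuousAt_of_dominated (bound := fun _ => (δ / 2)⁻¹) ?_ ?_ (integrable_const _) ?_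
    · exact hev.mono fun w hw => (hF.integrable_cauchy hw).aestronglyMeasurable
    · filter_upwards [Metric.ball_mem_nhds z (half_pos hδ)] with w hw
      filter_upwards [hF.ae_mem_boundary, hF.ae_norm_tangent_le hθ] with p hp hp1
      rw [norm_div, div_eq_mul_inv]
      have h1 : δ / 2 ≤ ‖planeProjection (F p) - w‖ := by
        have h2 := hdist p hp
        have h3 : ‖planeProjection (F p) - z‖ ≤ ‖planeProjection (F p) - w‖ + ‖w - z‖ := by
          have := norm_add_le (planeProjection (F p) - w) (w - z)
          rwa [sub_add_sub_cancel] at this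
        rw [Metric.mem_ball, dist_eq_norm] at hw
        linarith
      calc _ ≤ 1 * (δ / 2)⁻¹ := mul_le_mul hp1 (inv_anti₀ (half_pos hδ) h1)
            (inv_nonneg.2 (norm_nonneg _)) zero_le_one
        _ = _ := one_mul _
    · filter_upwards [hF.ae_mem_boundary] with p hp
      refine continuousAt_const.div (continuousAt_const.sub continuousAt_id) ?_
      have := hdist p hp
      exact norm_pos_iff.1 (hδ.trans_le this)
  refine ((Complex.continuous_im.continuousAt.comp hcont).const_mul (2 * Real.pi)⁻¹).congr ?_
  filter_upwards [hev] with w hw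
  exact (hF.windingNumber_eq_cauchy hθ hw).symm

/-- Almost everywhere on the boundary `boundaryTangent` may be replaced by the continuous
`capillaryTangent`; then the integrand is jointly measurable in the point and the parameter. -/
theorem IsCapillaryImmersion.measurable_winding (hF : IsCapillaryImmersion θ F ν)
    (hθ : θ ∈ Set.Ioo 0 Real.pi) : Measurable (windingNumber F ν) := by
  have := isFiniteMeasure_boundaryLength hF.contMDiff_one hF.immersion
  have heq : windingNumber F ν = fun x => (2 * Real.pi)⁻¹ * ∫ p, inner ℝ (cross vertical (F p - x))
      (capillaryTangent θ ν p) / ‖F p - x‖ ^ 2 ∂(boundaryLength F) := by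
    ext x
    rw [windingNumber]
    congr 1
    refine integral_congr_ae ?_
    filter_upwards [hF.ae_mem_boundary] with p hp
    rw [hF.boundaryTangent_eq hθ hp]
  have hFm : Measurable F := hF.contMDiff.continuous.measurable
  have htm : Measurable (capillaryTangent θ ν) :=
    (continuous_capillaryTangent hF.normal_continuous).measurable
  have hcr : Measurable (cross vertical) :=
    (continuous_cross.comp (Continuous.prodMk_right vertical)).measurable
  have hd : Measurable fun y : E3 × S => F y.2 - y.1 := by fun_prop
  have hm : Measurable fun y : E3 × S => (inner ℝ (cross vertical (F y.2 - y.1))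
      (capillaryTangent θ ν y.2) / ‖F y.2 - y.1‖ ^ 2 : ℝ) :=
    ((hcr.comp hd).inner (htm.comp measurable_snd)).div (hd.norm.pow_const 2)
  rw [heq]
  exact (hm.stronglyMeasurable.integral_prod_right (ν := boundaryLength F)).measurable.const_mul _

/-- Green's formula: the divergence of `X`, weighted with the winding number, integrates to the
flux of `X` through the boundary curves. -/
theorem IsCapillaryImmersion.integral_div_winding (hF : IsCapillaryImmersion θ F ν)
    (hθ : θ ∈ Set.Ioo 0 Real.pi) {X : E3 → E3} (hX : ContDiff ℝ 1 X) (hX' : HasCompactSupport X) :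
    ∫ z : ℂ, divAlong planeSubmodule X (planeEmbedding z) * windingNumber F ν (planeEmbedding z) =
      ∫ p, inner ℝ (cross (capillaryTangent θ ν p) vertical) (X (F p)) ∂(boundaryLength F) := by
  have := isFiniteMeasure_boundaryLength hF.contMDiff_one hF.immersion
  have hXe : ContDiff ℝ 1 fun z => X (planeEmbedding z) :=
    hX.comp planeEmbedding.toContinuousLinearMap.contDiff
  have hXs : HasCompactSupport fun z => X (planeEmbedding z) :=
    hX'.comp_isClosedEmbedding isClosedEmbedding_planeEmbedding
  have hcoord : ∀ i : Fin 3, ContDiff ℝ 1 (fun z => X (planeEmbedding z) i) ∧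
      HasCompactSupport fun z => X (planeEmbedding z) i := fun i =>
    ⟨(EuclideanSpace.proj i : E3 →L[ℝ] ℝ).contDiff.comp hXe,
      hXs.comp_left (g := fun y : E3 => y i) rfl⟩
  have h := integral_divergence_mul_cauchy_im hF.measurable_curve.1 hF.measurable_curve.2
    (hF.ae_norm_tangent_le hθ) (by
      filter_upwards [hF.ae_notMem_boundary_curve] with z hz
      exact hF.cauchyIntegral_re hθ hz) (hcoord 0).1 (hcoord 0).2 (hcoord 1).1 (hcoord 1).2
  have hpi : (2 * Real.pi) ≠ 0 := by positivity
  calc _ = ∫ z : ℂ, (2 * Real.pi)⁻¹ * ((fderiv ℝ (fun z => X (planeEmbedding z) 0) z 1 +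
        fderiv ℝ (fun z => X (planeEmbedding z) 1) z Complex.I) * (cauchyIntegral θ F ν z).im) := by
        refine integral_congr_ae ?_
        filter_upwards [hF.ae_notMem_boundary_curve] with z hz
        rw [divAlong_planeSubmodule hX, hF.windingNumber_eq_cauchy hθ hz]
        ring
    _ = (2 * Real.pi)⁻¹ * (2 * Real.pi * ∫ p, (X (planeEmbedding (planeProjection (F p))) 0 *
          (planeProjection (capillaryTangent θ ν p)).im -
          X (planeEmbedding (planeProjection (F p))) 1 *
          (planeProjection (capillaryTangent θ ν p)).re) ∂(boundaryLength F)) := by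
        rw [integral_const_mul, ← h]
        rfl
    _ = _ := by
        rw [inv_mul_cancel_left₀ hpi]
        refine integral_congr_ae ?_
        filter_upwards [hF.ae_mem_boundary] with p hp
        rw [planeEmbedding_planeProjection (hF.boundary_zero p hp), inner_E3, cross_apply_zero,
          cross_apply_one, cross_apply_two, vertical_apply_zero, vertical_apply_one,
          vertical_apply_two]
        simp only [planeProjection]
        ring

end Winding


/-! ### The winding varifold -/

section WindingVarifold

variable {S : Type*} [TopologicalSpace S] [ChartedSpace (EuclideanHalfSpace 2) S]
  [IsManifold (𝓡∂ 2) ∞ S] {F ν : S → E3} {θ : ℝ}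
  [CompactSpace S] [MeasurableSpace S] [BorelSpace S]

theorem windingMeasure_eq (F ν : S → E3) :
    windingMeasure F ν = ((volume : Measure ℂ).map planeEmbedding).withDensity
      fun x => ENNReal.ofReal (windingNumber F ν x) := by
  rw [windingMeasure, weightedArea, hausdorff_restrict_boundaryPlane]

theorem windingVarifold_weight (F ν : S → E3) :
    varifoldWeight (windingVarifold F ν) = windingMeasure F ν := by
  rw [varifoldWeight, windingVarifold,
    Measure.map_map (f := fun x : E3 => (x, planeGrass)) measurable_fst
      (measurable_id.prodMk measurable_const)]
  exact Measure.map_id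

theorem windingMeasure_compl_boundaryPlane (F ν : S → E3) :
    windingMeasure F ν boundaryPlaneᶜ = 0 := by
  refine withDensity_absolutelyContinuous _ _ ?_
  rw [Measure.restrict_apply isClosed_boundaryPlane.measurableSet.compl, compl_inter_self,
    measure_empty]

theorem support_windingVarifold (F ν : S → E3) :
    (varifoldWeight (windingVarifold F ν)).support ⊆ boundaryPlane := by
  rw [windingVarifold_weight]
  exact Measure.support_subset_of_isClosed isClosed_boundaryPlane
    (mem_ae_iff.2 (windingMeasure_compl_boundaryPlane F ν))

variable [Nonempty S] [T2Space S]

/-- The density is an `ENNReal.ofReal`, so only the positive part of the winding number is seen.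
Nonnegativity is used later, to remove the truncation. -/
theorem IsCapillaryImmersion.integral_windingMeasure (hF : IsCapillaryImmersion θ F ν)
    (hθ : θ ∈ Set.Ioo 0 Real.pi) (g : E3 → ℝ) :
    ∫ x, g x ∂(windingMeasure F ν) =
      ∫ z : ℂ, max (windingNumber F ν (planeEmbedding z)) 0 * g (planeEmbedding z) := by
  rw [windingMeasure_eq, integral_withDensity_eq_integral_toReal_smul
    (hF.measurable_winding hθ).ennreal_ofReal (Eventually.of_forall fun _ => ENNReal.ofReal_lt_top),
    isClosedEmbedding_planeEmbedding.measurableEmbedding.integral_map]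
  simp only [ENNReal.toReal_ofReal', smul_eq_mul]

theorem IsCapillaryImmersion.windingMeasure_lt_top (hF : IsCapillaryImmersion θ F ν)
    (hθ : θ ∈ Set.Ioo 0 Real.pi) {K : Set E3} (hK : IsCompact K) :
    windingMeasure F ν K < ⊤ := by
  have hι := isClosedEmbedding_planeEmbedding
  rw [windingMeasure_eq, withDensity_apply _ hK.measurableSet, hι.measurableEmbedding.restrict_map,
    hι.measurableEmbedding.lintegral_map]
  have h := (locallyIntegrable_iff.1 (hF.locallyIntegrable_winding hθ) _
    (hι.isCompact_preimage hK)).2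
  refine lt_of_le_of_lt (lintegral_mono fun z => ?_) h
  exact Real.ofReal_le_enorm _

/-- The set of points off the boundary curves with positive winding number. -/
def windingRegion (F ν : S → E3) : Set E3 :=
  {x | x ∈ boundaryPlane ∧ x ∉ F '' (𝓡∂ 2).boundary S ∧ 0 < windingNumber F ν x}

theorem IsCapillaryImmersion.measurableSet_windingRegion (hF : IsCapillaryImmersion θ F ν)
    (hθ : θ ∈ Set.Ioo 0 Real.pi) : MeasurableSet (windingRegion F ν) := by
  have hcl : IsClosed (F '' (𝓡∂ 2).boundary S) :=
    (((𝓡∂ 2).isClosed_boundary (n := ∞) (by simp)).isCompact.image hF.contMDiff.continuous).isClosed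
  exact isClosed_boundaryPlane.measurableSet.inter (hcl.measurableSet.compl.inter
    (measurableSet_lt measurable_const (hF.measurable_winding hθ)))

/-- Rectifiable varifolds require positive multiplicity, so the plane is cut down to
`windingRegion`. Nothing is lost: the curves are `ℋ²`-null and elsewhere the discarded density is
zero. -/
theorem IsCapillaryImmersion.weightedArea_windingRegion (hF : IsCapillaryImmersion θ F ν)
    (hθ : θ ∈ Set.Ioo 0 Real.pi) :
    weightedArea (windingRegion F ν) (windingNumber F ν) = windingMeasure F ν := by
  have hm := hF.measurableSet_windingRegion hθ
  have hsub : windingRegion F ν ⊆ boundaryPlane := fun x hx => hx.1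
  have hr : (μHE[2] : Measure E3).restrict (windingRegion F ν) =
      ((μHE[2] : Measure E3).restrict boundaryPlane).restrict (windingRegion F ν) := by
    rw [Measure.restrict_restrict hm, inter_eq_left.2 hsub]
  rw [windingMeasure, weightedArea, weightedArea, hr, ← withDensity_indicator hm]
  refine withDensity_congr_ae ?_
  have h0 := hausdorff_image_boundary hF.contMDiff_one hF.immersion
  filter_upwards [ae_restrict_mem isClosed_boundaryPlane.measurableSet,
    ae_restrict_of_ae (compl_mem_ae_iff.2 h0)] with x hx hxΓ
  by_cases hxr : x ∈ windingRegion F ν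
  · rw [indicator_of_mem hxr]
  · rw [indicator_of_notMem hxr, eq_comm, ENNReal.ofReal_eq_zero]
    by_contra hpos
    exact hxr ⟨hx, hxΓ, not_le.1 hpos⟩

theorem planeSubmodule_coe : (planeSubmodule : Set E3) = boundaryPlane := rfl

/-- The winding number is continuous off the curves, so blowing up a weighted plane freezes the
weight at its value at `x`. -/
theorem IsCapillaryImmersion.isApproxTangentPlane_winding (hF : IsCapillaryImmersion θ F ν)
    (hθ : θ ∈ Set.Ioo 0 Real.pi) {x : E3} (hx : x ∈ windingRegion F ν) :
    IsApproxTangentPlane (windingRegion F ν) (windingNumber F ν) x planeSubmodule := by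
  intro f hf hfc
  have hι := isClosedEmbedding_planeEmbedding
  obtain ⟨z₀, rfl⟩ : ∃ z, planeEmbedding z = x := range_planeEmbedding.ge hx.1
  set h : ℂ → ℝ := fun z => max (windingNumber F ν (planeEmbedding z)) 0 with hh
  have hhc : ContinuousAt h z₀ := (hF.continuousAt_winding hθ hx.2.1).max continuousAt_const
  have hhm : Measurable h :=
    ((hF.measurable_winding hθ).comp planeEmbedding.continuous.measurable).max measurable_const
  have hhx : windingNumber F ν (planeEmbedding z₀) = h z₀ := (max_eq_left hx.2.2.le).symm
  have hfe : Continuous fun v : ℂ => f (planeEmbedding v) := hf.comp planeEmbedding.continuous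
  have hfs : HasCompactSupport fun v : ℂ => f (planeEmbedding v) := hfc.comp_isClosedEmbedding hι
  rw [planeSubmodule_coe, hausdorff_restrict_boundaryPlane, hι.measurableEmbedding.integral_map,
    hhx, ← integral_const_mul]
  have hsubst : ∀ r : ℝ, 0 < r → (r ^ 2)⁻¹ * ∫ y, f (r⁻¹ • (y - planeEmbedding z₀))
      ∂(weightedArea (windingRegion F ν) (windingNumber F ν)) =
      ∫ v : ℂ, h (z₀ + r • v) * f (planeEmbedding v) := by
    intro r hr
    rw [hF.weightedArea_windingRegion hθ, hF.integral_windingMeasure hθ,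
      ← integral_add_left_eq_self _ z₀]
    have := Measure.integral_comp_smul_of_nonneg (volume : Measure ℂ)
      (fun w => h (z₀ + w) * f (r⁻¹ • (planeEmbedding (z₀ + w) - planeEmbedding z₀))) r (hR := hr.le)
    rw [Complex.finrank_real_complex, smul_eq_mul] at this
    rw [← this]
    refine integral_congr_ae (Eventually.of_forall fun v => ?_)
    simp only
    rw [← map_sub, add_sub_cancel_left, map_smul, smul_smul, inv_mul_cancel₀ hr.ne', one_smul]
  refine Tendsto.congr' (f₁ := fun r : ℝ => ∫ v : ℂ, h (z₀ + r • v) * f (planeEmbedding v)) ?_ ?_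
  · filter_upwards [self_mem_nhdsWithin] with r hr
    exact (hsubst r hr).symm
  have hlim : ∀ v : ℂ, Tendsto (fun r : ℝ => z₀ + r • v) (𝓝[>] 0) (𝓝 z₀) := by
    intro v
    have : Continuous fun r : ℝ => z₀ + r • v := by fun_prop
    simpa using (this.tendsto 0).mono_left nhdsWithin_le_nhds
  obtain ⟨δ, hδ, hδh⟩ := Metric.continuousAt_iff.1 hhc 1 one_pos
  obtain ⟨R, hR⟩ := hfs.isCompact.isBounded.subset_closedBall (0 : ℂ)
  have hsmall : ∀ᶠ r in 𝓝[>] (0 : ℝ), r * R < δ := by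
    have : Tendsto (fun r : ℝ => r * R) (𝓝[>] 0) (𝓝 0) := by
      have h : Continuous fun r : ℝ => r * R := by fun_prop
      simpa using (h.tendsto 0).mono_left nhdsWithin_le_nhds
    exact this.eventually_lt_const hδ
  -- When `r * R < δ`, every point `z₀ + r v` with `v` in the support lies where the weight differs
  -- from `h z₀` by less than `1`.
  refine tendsto_integral_filter_of_dominated_convergence
    (fun v => (|h z₀| + 1) * ‖f (planeEmbedding v)‖) ?_ ?_ ?_ ?_
  · refine Eventually.of_forall fun r => Measurable.aestronglyMeasurable ?_
    have := hfe.measurable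
    exact (hhm.comp (by fun_prop)).mul this
  · filter_upwards [self_mem_nhdsWithin, hsmall] with r hr hrR
    have hr : 0 < r := hr
    refine Eventually.of_forall fun v => ?_
    rw [norm_mul]
    by_cases hv : f (planeEmbedding v) = 0
    · rw [hv, norm_zero, mul_zero, mul_zero]
    refine mul_le_mul_of_nonneg_right ?_ (norm_nonneg _)
    have hvR : ‖v‖ ≤ R := mem_closedBall_zero_iff.1 (hR (subset_tsupport _ hv))
    have hd : dist (z₀ + r • v) z₀ < δ := by
      rw [dist_eq_norm, add_sub_cancel_left, norm_smul, Real.norm_of_nonneg hr.le]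
      exact (mul_le_mul_of_nonneg_left hvR hr.le).trans_lt hrR
    have h1 := hδh hd
    rw [Real.dist_eq] at h1
    have h2 := abs_add_le (h (z₀ + r • v) - h z₀) (h z₀)
    rw [sub_add_cancel] at h2
    rw [Real.norm_eq_abs]
    linarith
  · exact ((hfe.integrable_of_hasCompactSupport hfs).norm).const_mul _
  · exact Eventually.of_forall fun v => (hhc.tendsto.comp (hlim v)).mul tendsto_const_nhds

theorem IsCapillaryImmersion.isRectifiableVarifold_winding (hF : IsCapillaryImmersion θ F ν)
    (hθ : θ ∈ Set.Ioo 0 Real.pi) : IsRectifiableVarifold (windingVarifold F ν) := by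
  have hι := isClosedEmbedding_planeEmbedding
  refine ⟨⟨fun x => ⟨Prod.fst ⁻¹' Metric.ball x.1 1,
    continuous_fst.continuousAt.preimage_mem_nhds (Metric.ball_mem_nhds _ one_pos), ?_⟩⟩,
    windingRegion F ν, windingNumber F ν, fun _ => planeGrass, hF.measurableSet_windingRegion hθ,
    ?_, fun x hx => hx.2.2, ?_, aemeasurable_const, ?_, ?_⟩
  · rw [← Measure.map_apply measurable_fst measurableSet_ball]
    change varifoldWeight (windingVarifold F ν) _ < ⊤
    rw [windingVarifold_weight]
    exact (measure_mono Metric.ball_subset_closedBall).trans_lt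
      (hF.windingMeasure_lt_top hθ (isCompact_closedBall _ _))
  · have hL : LipschitzWith 1 fun u : E2 => planeEmbedding (⟨u 0, u 1⟩ : ℂ) := by
      refine LipschitzWith.of_dist_le_mul fun u v => ?_
      rw [planeEmbedding.dist_map, NNReal.coe_one, one_mul, EuclideanSpace.dist_eq,
        Complex.dist_eq_re_im, Fin.sum_univ_two, Real.dist_eq, Real.dist_eq, sq_abs, sq_abs]
    refine ⟨fun _ u => planeEmbedding (⟨u 0, u 1⟩ : ℂ), fun _ => ⟨1, hL⟩, ?_⟩
    have hempty : windingRegion F ν \ ⋃ _j : ℕ, range (fun u : E2 => planeEmbedding (⟨u 0, u 1⟩ : ℂ)) =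
        ∅ := by
      rw [sdiff_eq_empty]
      intro x hx
      refine mem_iUnion.2 ⟨0, !₂[x 0, x 1], ?_⟩
      exact planeEmbedding_planeProjection hx.1
    rw [hempty, measure_empty]
  · rw [locallyIntegrable_iff]
    intro K hK
    have h1 : IntegrableOn (windingNumber F ν) K ((volume : Measure ℂ).map planeEmbedding) := by
      rw [hι.measurableEmbedding.integrableOn_map_iff]
      exact locallyIntegrable_iff.1 (hF.locallyIntegrable_winding hθ) _ (hι.isCompact_preimage hK)
    rw [← hausdorff_restrict_boundaryPlane] at h1
    exact h1.mono_measure (Measure.restrict_mono (fun x hx => hx.1) le_rfl)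
  · filter_upwards [ae_restrict_mem (hF.measurableSet_windingRegion hθ)] with x hx
    exact hF.isApproxTangentPlane_winding hθ hx
  · rw [hF.weightedArea_windingRegion hθ]
    rfl

/-- The first variation of the winding varifold is the flux through the boundary curves. -/
theorem IsCapillaryImmersion.integral_div_windingMeasure (hF : IsCapillaryImmersion θ F ν)
    (hθ : θ ∈ Set.Ioo 0 Real.pi)
    (hwind : ∀ x ∈ boundaryPlane, x ∉ F '' (𝓡∂ 2).boundary S → 0 ≤ windingNumber F ν x)
    {X : E3 → E3} (hX : ContDiff ℝ 1 X) (hX' : HasCompactSupport X) :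
    ∫ x, divAlong planeSubmodule X x ∂(varifoldWeight (windingVarifold F ν)) =
      ∫ p, inner ℝ (cross (capillaryTangent θ ν p) vertical) (X (F p)) ∂(boundaryLength F) := by
  rw [windingVarifold_weight, hF.integral_windingMeasure hθ, ← hF.integral_div_winding hθ hX hX']
  refine integral_congr_ae ?_
  filter_upwards [hF.ae_notMem_boundary_curve] with z hz
  rw [max_eq_left (hwind _ (planeEmbedding_apply_two z) hz), mul_comm]

end WindingVarifold


/-! ### The first variation of the surface -/

section FirstVariation

instance : SecondCountableTopology Grass :=
  TopologicalSpace.secondCountableTopology_induced Grass (E3 →L[ℝ] E3) _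

theorem continuous_divAlong {X : E3 → E3} (hX : ContDiff ℝ 1 X) :
    Continuous fun z : E3 × Grass => divAlong z.2.1 X z.1 := by
  have htr : Continuous ((LinearMap.trace ℝ E3) ∘ₗ ContinuousLinearMap.coeLM ℝ (M := E3) (N₃ := E3)) :=
    LinearMap.continuous_of_finiteDimensional _
  have hP : Continuous fun P : Grass => P.1.starProjection := continuous_induced_dom
  exact htr.comp ((hP.comp continuous_snd).clm_comp
    ((hX.continuous_fderiv one_ne_zero).comp continuous_fst))

variable {S : Type*} [TopologicalSpace S] [ChartedSpace (EuclideanHalfSpace 2) S]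
  [IsManifold (𝓡∂ 2) ∞ S] {F ν : S → E3} {θ : ℝ}

/-- The gradient of the `i`-th coordinate times the area density, in the chart at `p`. -/
def chartGradient (F : S → E3) (p : S) (i : Fin 2) (u : E2) : E3 :=
  (√(Matrix.gram ℝ (chartPartial F p u)).det)⁻¹ •
    ((inner ℝ (chartPartial F p u (i + 1)) (chartPartial F p u (i + 1)) : ℝ) • chartPartial F p u i -
      (inner ℝ (chartPartial F p u i) (chartPartial F p u (i + 1)) : ℝ) • chartPartial F p u (i + 1))

theorem IsCapillaryImmersion.contDiffOn_chartPartial (hF : IsCapillaryImmersion θ F ν) (p : S)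
    (i : Fin 2) : ContDiffOn ℝ 1 (fun u => chartPartial F p u i) (chartTarget p) :=
  (contDiffOn_fderivWithin_chartMap (n := 1) (by exact_mod_cast hF.contMDiff) p).clm_apply
    contDiffOn_const

theorem IsCapillaryImmersion.contDiffOn_chartGradient (hF : IsCapillaryImmersion θ F ν) (p : S)
    (i : Fin 2) : ContDiffOn ℝ 1 (chartGradient F p i) (chartTarget p) := by
  have h := hF.contDiffOn_chartPartial p
  have hD : ContDiffOn ℝ 1 (fun u => (Matrix.gram ℝ (chartPartial F p u)).det) (chartTarget p) := by
    simp_rw [det_gram_fin_two]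
    exact (((h 0).inner ℝ (h 0)).mul ((h 1).inner ℝ (h 1))).sub (((h 0).inner ℝ (h 1)).pow 2)
  have hpos := fun u (hu : u ∈ chartTarget p) => chartPartial_gram_det_pos hF hu
  exact ((hD.sqrt fun u hu => (hpos u hu).ne').inv fun u hu => (Real.sqrt_pos.2 (hpos u hu)).ne').smul
    ((((h (i + 1)).inner ℝ (h (i + 1))).smul (h i)).sub
      (((h i).inner ℝ (h (i + 1))).smul (h (i + 1))))

/-- In coordinates `√g div X = ⟨∂ᵢ X, √g gⁱʲ ∂ⱼ F⟩`. The cofactor form of the inverse metric absorbs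
the determinant into `chartGradient`. -/
theorem IsCapillaryImmersion.sqrt_det_mul_divAlong (hF : IsCapillaryImmersion θ F ν) {p : S}
    {u : E2} (hu : u ∈ chartTarget p) (X : E3 → E3) :
    √(Matrix.gram ℝ (chartPartial F p u)).det *
        divAlong (tangentPlane F hF.immersion ((extChartAt (𝓡∂ 2) p).symm u)).1 X (chartMap F p u) =
      inner ℝ (fderiv ℝ X (chartMap F p u) (chartPartial F p u 0)) (chartGradient F p 0 u) +
      inner ℝ (fderiv ℝ X (chartMap F p u) (chartPartial F p u 1)) (chartGradient F p 1 u) := by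
  have hpos := chartPartial_gram_det_pos hF hu
  have hm := hF.mem_tangentPlane_iff hu
  rw [divAlong_eq_of_basis ((hm _).2 ⟨1, 0, by simp⟩) ((hm _).2 ⟨0, 1, by simp⟩)
    (fun v hv => (hm v).1 hv) (det_gram_fin_two (chartPartial F p u)) hpos.ne' X, mul_add]
  have hs : √(Matrix.gram ℝ (chartPartial F p u)).det * ((Matrix.gram ℝ (chartPartial F p u)).det)⁻¹ =
      (√(Matrix.gram ℝ (chartPartial F p u)).det)⁻¹ := by
    have h2 := Real.sqrt_pos.2 hpos
    have h3 := Real.mul_self_sqrt hpos.le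
    field_simp
    rw [sq, h3]
  rw [← mul_assoc, ← mul_assoc, hs, chartGradient, chartGradient, zero_add,
    show (1 + 1 : Fin 2) = 0 from rfl, inner_smul_right, inner_smul_right,
    real_inner_comm (chartPartial F p u 1) (chartPartial F p u 0),
    real_inner_comm (fderiv ℝ X _ _), real_inner_comm (fderiv ℝ X _ _)]

/-- This converts the boundary term of the divergence theorem in the half-plane into conormal times
length element; the two minus signs cancel. -/
theorem IsCapillaryImmersion.chartGradient_boundary (hF : IsCapillaryImmersion θ F ν)
    (hθ : θ ∈ Set.Ioo 0 Real.pi) {p : S} {u : E2} (hu : u ∈ chartTarget p) (hu0 : u 0 = 0) :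
    chartGradient F p 0 u =
      -(‖chartPartial F p u 1‖ • capillaryConormal θ ν ((extChartAt (𝓡∂ 2) p).symm u)) := by
  have hs : 0 < Real.sin θ := Real.sin_pos_of_mem_Ioo hθ
  have hb := (symm_mem_boundary_iff hu).2 hu0
  have h := (capillary_conormal_formula hs (Real.sin_sq_add_cos_sq θ) (hF.inner_normal_self _)
    (hF.normal_two_and_conormal hθ hb).1 (hF.inner_normal_chartPartial hu 0)
    (hF.inner_normal_chartPartial hu 1) (hF.chartPartial_two hu hu0).1
    (hF.chartPartial_two hu hu0).2).1
  have hpos := Real.sqrt_pos.2 (chartPartial_gram_det_pos hF hu)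
  rw [chartGradient, zero_add, h, ← det_gram_fin_two, smul_neg, smul_smul, ← mul_assoc,
    inv_mul_cancel₀ hpos.ne', one_mul]
  rfl

/-- The localized mean curvature vector of the surface, up to sign, in the chart at `p`. -/
def chartCurvature (F : S → E3) (χ : S → ℝ) (p : S) (u : E2) : E3 :=
  fderivWithin ℝ (fun v => chartMap χ p v • chartGradient F p 0 v) (range (𝓡∂ 2)) u
      (EuclideanSpace.single 0 1) +
    fderivWithin ℝ (fun v => chartMap χ p v • chartGradient F p 1 v) (range (𝓡∂ 2)) u
      (EuclideanSpace.single 1 1)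

theorem IsCapillaryImmersion.contDiffOn_smul_chartGradient (hF : IsCapillaryImmersion θ F ν)
    {χ : S → ℝ} (hχ : ContMDiff (𝓡∂ 2) 𝓘(ℝ, ℝ) 1 χ) (p : S) (i : Fin 2) :
    ContDiffOn ℝ 1 (fun v => chartMap χ p v • chartGradient F p i v) (chartTarget p) :=
  (contDiffOn_chartMap (n := 1) hχ p).smul (hF.contDiffOn_chartGradient p i)

theorem IsCapillaryImmersion.continuousOn_chartCurvature (hF : IsCapillaryImmersion θ F ν)
    {χ : S → ℝ} (hχ : ContMDiff (𝓡∂ 2) 𝓘(ℝ, ℝ) 1 χ) (p : S) :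
    ContinuousOn (chartCurvature F χ p) (chartTarget p) := by
  have h := fun i => (((hF.contDiffOn_smul_chartGradient hχ p i).continuousOn_fderivWithin
    (uniqueDiffOn_chartTarget p) le_rfl).congr
      fun u hu => (fderivWithin_chartTarget hu _).symm).clm_apply
        (continuousOn_const (c := (EuclideanSpace.single i 1 : E2)))
  exact (h 0).add (h 1)

/-- The localized mean curvature vector of the surface, up to sign. -/
def surfaceCurvature (F : S → E3) (χ : S → ℝ) (p : S) : S → E3 :=
  (extChartAt (𝓡∂ 2) p).source.indicator fun q =>
    (√(Matrix.gram ℝ (chartPartial F p (extChartAt (𝓡∂ 2) p q))).det)⁻¹ •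
      chartCurvature F χ p (extChartAt (𝓡∂ 2) p q)

theorem surfaceCurvature_symm (F : S → E3) (χ : S → ℝ) {p : S} {u : E2} (hu : u ∈ chartTarget p) :
    surfaceCurvature F χ p ((extChartAt (𝓡∂ 2) p).symm u) =
      (√(Matrix.gram ℝ (chartPartial F p u)).det)⁻¹ • chartCurvature F χ p u := by
  rw [surfaceCurvature, indicator_of_mem ((extChartAt (𝓡∂ 2) p).map_target hu),
    (extChartAt (𝓡∂ 2) p).right_inv hu]

theorem surfaceCurvature_eq_zero (F : S → E3) {χ : S → ℝ} {p q : S} (hq : q ∉ tsupport χ) :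
    surfaceCurvature F χ p q = 0 := by
  by_cases hqs : q ∈ (extChartAt (𝓡∂ 2) p).source
  · rw [surfaceCurvature, indicator_of_mem hqs]
    have hev : ∀ᶠ v in 𝓝[range (𝓡∂ 2)] (extChartAt (𝓡∂ 2) p q), chartMap χ p v = 0 := by
      have h1 : Tendsto (extChartAt (𝓡∂ 2) p).symm (𝓝[range (𝓡∂ 2)] (extChartAt (𝓡∂ 2) p q)) (𝓝 q) := by
        have := (continuousAt_extChartAt_symm' hqs).tendsto
        rw [(extChartAt (𝓡∂ 2) p).left_inv hqs] at this
        exact this.mono_left nhdsWithin_le_nhds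
      filter_upwards [h1.eventually ((isClosed_tsupport χ).isOpen_compl.mem_nhds hq)] with v hv
      exact (image_eq_zero_of_notMem_tsupport hv : χ ((extChartAt (𝓡∂ 2) p).symm v) = 0)
    have hz : ∀ i, fderivWithin ℝ (fun v => chartMap χ p v • chartGradient F p i v) (range (𝓡∂ 2))
        (extChartAt (𝓡∂ 2) p q) = 0 := by
      intro i
      have hev' : (fun v => chartMap χ p v • chartGradient F p i v)
          =ᶠ[𝓝[range (𝓡∂ 2)] (extChartAt (𝓡∂ 2) p q)] fun _ => 0 := by
        filter_upwards [hev] with v hv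
        rw [hv, zero_smul]
      rw [hev'.fderivWithin_eq_of_mem (chartTarget_subset p ((extChartAt (𝓡∂ 2) p).map_source hqs)),
        fderivWithin_fun_const]
      rfl
    rw [chartCurvature, hz, hz]
    simp
  · rw [surfaceCurvature, indicator_of_notMem hqs]

/-- The gradient fields are `C¹` up to the boundary because `F` is `C²` there, and extension by zero
is harmless since the support of `χ` lies inside the chart. -/
theorem IsCapillaryImmersion.continuous_surfaceCurvature [CompactSpace S] [MeasurableSpace S]
    [BorelSpace S] (hF : IsCapillaryImmersion θ F ν)
    {χ : S → ℝ} (hχ : ContMDiff (𝓡∂ 2) 𝓘(ℝ, ℝ) 1 χ) {p : S}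
    (hs : tsupport χ ⊆ (extChartAt (𝓡∂ 2) p).source) :
    Continuous (surfaceCurvature F χ p) := by
  rw [continuous_iff_continuousAt]
  intro q
  by_cases hq : q ∈ tsupport χ
  · have hsrc : (extChartAt (𝓡∂ 2) p).source ∈ 𝓝 q := (isOpen_extChartAt_source p).mem_nhds (hs hq)
    have h1 : ContinuousOn (fun u => (√(Matrix.gram ℝ (chartPartial F p u)).det)⁻¹ •
        chartCurvature F χ p u) (chartTarget p) :=
      ((continuousOn_sqrt_gram_det hF.contMDiff_one p).inv₀ fun u hu =>
        (Real.sqrt_pos.2 (chartPartial_gram_det_pos hF hu)).ne').smul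
          (hF.continuousOn_chartCurvature hχ p)
    have h2 := (h1.comp (continuousOn_extChartAt p)
      fun x hx => (extChartAt (𝓡∂ 2) p).map_source hx).continuousAt hsrc
    refine h2.congr ?_
    filter_upwards [hsrc] with x hx
    rw [surfaceCurvature, indicator_of_mem hx]
    rfl
  · refine continuousAt_const.congr (f := fun _ => (0 : E3)) ?_
    filter_upwards [(isClosed_tsupport χ).isOpen_compl.mem_nhds hq] with x hx
    exact (surfaceCurvature_eq_zero F hx).symm

end FirstVariation


/-! ### The divergence theorem on the surface. -/

section FirstVariation

variable {S : Type*} [TopologicalSpace S] [ChartedSpace (EuclideanHalfSpace 2) S]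
  [IsManifold (𝓡∂ 2) ∞ S] {F ν : S → E3} {θ : ℝ}
  [CompactSpace S] [MeasurableSpace S] [BorelSpace S]

theorem IsCapillaryImmersion.continuous_divAlong_tangentPlane (hF : IsCapillaryImmersion θ F ν)
    {X : E3 → E3} (hX : ContDiff ℝ 1 X) :
    Continuous fun q => divAlong (tangentPlane F hF.immersion q).1 X (F q) :=
  Continuous.comp (g := fun z : E3 × Grass => divAlong z.2.1 X z.1)
    (f := fun q => (F q, tangentPlane F hF.immersion q)) (continuous_divAlong hX)
    (hF.contMDiff.continuous.prodMk hF.continuous_tangentPlane)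

/-- The first variation of the part of the surface that lies in a chart. -/
theorem IsCapillaryImmersion.integral_div_of_tsupport [Nonempty S] (hF : IsCapillaryImmersion θ F ν)
    (hθ : θ ∈ Set.Ioo 0 Real.pi) {χ : S → ℝ} (hχ : ContMDiff (𝓡∂ 2) 𝓘(ℝ, ℝ) 1 χ) {p : S}
    (hs : tsupport χ ⊆ (extChartAt (𝓡∂ 2) p).source) {X : E3 → E3} (hX : ContDiff ℝ 1 X) :
    ∫ q, (χ q * divAlong (tangentPlane F hF.immersion q).1 X (F q) +
        inner ℝ (X (F q)) (surfaceCurvature F χ p q)) ∂(areaMeasure F) =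
      ∫ q, χ q * inner ℝ (X (F q)) (capillaryConormal θ ν q) ∂(boundaryLength F) := by
  have hc := hF.contMDiff_one
  have hFc : Continuous F := hF.contMDiff.continuous
  have hχc : Continuous χ := hχ.continuous
  have hZc := hF.continuous_surfaceCurvature hχ hs
  have hXF : Continuous fun q => X (F q) := hX.continuous.comp hFc
  set f : S → ℝ := fun q => χ q * divAlong (tangentPlane F hF.immersion q).1 X (F q) +
    inner ℝ (X (F q)) (surfaceCurvature F χ p q) with hf
  have hfc : Continuous f :=
    (hχc.mul (hF.continuous_divAlong_tangentPlane hX)).add (hXF.inner hZc)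
  have hf0 : ∀ q ∉ tsupport χ, f q = 0 := by
    intro q hq
    rw [hf]
    simp only
    rw [surfaceCurvature_eq_zero F hq, image_eq_zero_of_notMem_tsupport hq, zero_mul,
      inner_zero_right, add_zero]
  obtain ⟨hK, hKT, hKn⟩ := isCompact_chart_image_tsupport hs
  set K := extChartAt (𝓡∂ 2) p '' tsupport χ with hKdef
  have hTm := measurableSet_chartTarget p
  have hTr : chartTarget p ⊆ {u : E2 | 0 ≤ u 0} := fun u hu => nonneg_of_mem_chartTarget hu
  set d : E2 → ℝ := (chartTarget p).indicator fun u =>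
    √(Matrix.gram ℝ (chartPartial F p u)).det * f ((extChartAt (𝓡∂ 2) p).symm u) with hd
  set M : Fin 2 → E2 → E3 := fun i v => chartMap χ p v • chartGradient F p i v with hM
  -- The planar field to which the divergence theorem is applied. By the product rule,
  -- differentiating `X` gives `χ √g div X`, and differentiating `M` gives the pairing of `X` with
  -- the localized curvature.
  set w : Fin 2 → E2 → ℝ := fun i => (chartTarget p).indicator fun u =>
    inner ℝ (X (chartMap F p u)) (M i u) with hw
  have hMc : ∀ i, ContDiffOn ℝ 1 (M i) (chartTarget p) :=
    hF.contDiffOn_smul_chartGradient hχ p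
  have hGc : ContDiffOn ℝ 1 (chartMap F p) (chartTarget p) := contDiffOn_chartMap (n := 1) hc p
  have hw0 : ∀ i, ∀ u ∉ K, w i u = 0 := by
    intro i u hu
    by_cases hT : u ∈ chartTarget p
    · have h0 : chartMap χ p u = 0 :=
        (image_eq_zero_of_notMem_tsupport (hKn u hT hu) : χ ((extChartAt (𝓡∂ 2) p).symm u) = 0)
      simp only [hw, hM]
      rw [indicator_of_mem hT, h0, zero_smul, inner_zero_right]
    · exact indicator_of_notMem hT _
  have hd0 : ∀ u ∉ K, d u = 0 := by
    intro u hu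
    by_cases hT : u ∈ chartTarget p
    · rw [hd, indicator_of_mem hT, hf0 _ (hKn u hT hu), mul_zero]
    · exact indicator_of_notMem hT _
  have hwev : ∀ i, ∀ u ∉ K, w i =ᶠ[𝓝 u] fun _ => 0 := fun i u hu => by
    filter_upwards [hK.isClosed.isOpen_compl.mem_nhds hu] with v hv
    exact hw0 i v hv
  have hwT : ∀ i, ContinuousOn (fun u => inner ℝ (X (chartMap F p u)) (M i u) : E2 → ℝ)
      (chartTarget p) := fun i =>
    (hX.continuous.comp_continuousOn hGc.continuousOn).inner (hMc i).continuousOn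
  have hwc : ∀ i, ContinuousOn (w i) {u | 0 ≤ u 0} := by
    intro i u hu
    by_cases hT : u ∈ K
    · have h1 : chartTarget p ∈ 𝓝[{u : E2 | 0 ≤ u 0}] u := by
        rw [← range_halfPlaneModel]
        exact extChartAt_target_mem_nhdsWithin_of_mem (hKT hT)
      refine ((hwT i u (hKT hT)).mono_of_mem_nhdsWithin h1).congr_of_eventuallyEq ?_
        (indicator_of_mem (hKT hT) _)
      filter_upwards [h1] with v hv
      exact indicator_of_mem hv _
    · exact (continuousAt_const.congr (hwev i u hT).symm).continuousWithinAt
  have hder : ∀ i, ∀ u ∈ chartTarget p, 0 < u 0 → HasFDerivAt (w i)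
      ((fderivInnerCLM ℝ (X (chartMap F p u), M i u)).comp
        (((fderiv ℝ X (chartMap F p u)).comp
          (fderivWithin ℝ (chartMap F p) (range (𝓡∂ 2)) u)).prod
            (fderivWithin ℝ (M i) (range (𝓡∂ 2)) u))) u := by
    intro i u hu hpos
    have hTn : chartTarget p ∈ 𝓝 u :=
      mem_of_superset ((isOpen_pos_chartTarget p).mem_nhds ⟨hu, hpos⟩) fun v hv => hv.1
    have h1 : HasFDerivAt (fun v => X (chartMap F p v)) _ u :=
      ((hX.differentiable one_ne_zero) (chartMap F p u)).hasFDerivAt.comp u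
        (hasFDerivAt_chartMap hc hu hpos)
    have h2 : HasFDerivAt (M i) (fderivWithin ℝ (M i) (range (𝓡∂ 2)) u) u := by
      have h3 := ((hMc i).differentiableOn one_ne_zero).differentiableAt hTn
      rw [fderivWithin_of_mem_nhds (range_mem_nhds_of_pos hpos)]
      exact h3.hasFDerivAt
    refine (h1.inner ℝ h2).congr_of_eventuallyEq ?_
    filter_upwards [hTn] with v hv
    exact indicator_of_mem hv _
  have hdiff : ∀ i, ∀ u : E2, 0 < u 0 → DifferentiableAt ℝ (w i) u := by
    intro i u hpos
    by_cases hT : u ∈ K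
    · exact (hder i u (hKT hT) hpos).differentiableAt
    · exact (differentiableAt_const (0 : ℝ)).congr_of_eventuallyEq (hwev i u hT)
  have hdiv : ∀ u : E2, 0 < u 0 → d u = fderiv ℝ (w 0) u (EuclideanSpace.single 0 1) +
      fderiv ℝ (w 1) u (EuclideanSpace.single 1 1) := by
    intro u hpos
    by_cases hT : u ∈ K
    · have hu := hKT hT
      have hsq := Real.sqrt_pos.2 (chartPartial_gram_det_pos hF hu)
      rw [(hder 0 u hu hpos).fderiv, (hder 1 u hu hpos).fderiv, hd, indicator_of_mem hu, hf]
      simp only [ContinuousLinearMap.comp_apply, ContinuousLinearMap.prod_apply,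
        fderivInnerCLM_apply]
      have h1 := hF.sqrt_det_mul_divAlong hu X
      rw [surfaceCurvature_symm F χ hu, inner_smul_right, mul_add, ← mul_assoc, ← mul_assoc,
        mul_inv_cancel₀ hsq.ne', one_mul, mul_comm _ (χ _), mul_assoc]
      change χ _ * (_ * divAlong _ X (chartMap F p u)) + _ = _
      rw [h1, chartCurvature, inner_add_right]
      change _ = inner ℝ _ _ + inner ℝ (fderiv ℝ X _ (chartPartial F p u 0))
        (chartMap χ p u • chartGradient F p 0 u) + (inner ℝ _ _ +
        inner ℝ (fderiv ℝ X _ (chartPartial F p u 1)) (chartMap χ p u • chartGradient F p 1 u))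
      rw [inner_smul_right, inner_smul_right]
      simp only [chartMap, Function.comp_apply, hM]
      ring
    · rw [(hwev 0 u hT).fderiv_eq, (hwev 1 u hT).fderiv_eq, hd0 u hT]
      simp
  have hdint : IntegrableOn d {u | 0 ≤ u 0} := by
    have h1 : ContinuousOn (fun u => √(Matrix.gram ℝ (chartPartial F p u)).det *
        f ((extChartAt (𝓡∂ 2) p).symm u)) (chartTarget p) :=
      (continuousOn_sqrt_gram_det hc p).mul (hfc.comp_continuousOn (continuousOn_chart_symm p))
    have h2 : ContinuousOn d K := (h1.mono hKT).congr fun u hu => indicator_of_mem (hKT hu) _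
    have h3 : IntegrableOn d K := h2.integrableOn_compact hK
    refine Integrable.integrableOn ?_
    refine (integrableOn_iff_integrable_of_support_subset fun u hu => ?_).1 h3
    by_contra hn
    exact hu (hd0 u hn)
  have hmain := integral_halfPlane_divergence hK (hwc 0) (hwc 1) (hdiff 0) (hdiff 1) hdiv hdint
    (hw0 0) (hw0 1)
  rw [integral_areaMeasure_of_support hc hF.immersion p hfc.aestronglyMeasurable
    fun x hx => hf0 x fun h => hx (hs h)]
  rw [hd, setIntegral_indicator hTm, inter_eq_right.2 hTr] at hmain
  have hbc : Continuous fun q => χ q * inner ℝ (X (F q)) (capillaryConormal θ ν q) :=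
    hχc.mul (hXF.inner (continuous_capillaryConormal hF.normal_continuous))
  rw [hmain, integral_boundaryLength_of_support hc hF.immersion p hbc.aestronglyMeasurable
    fun x hx => by rw [image_eq_zero_of_notMem_tsupport fun h => hx (hs h), zero_mul],
    ← integral_indicator (isOpen_boundaryParameters p).measurableSet, ← integral_neg]
  refine integral_congr_ae (Eventually.of_forall fun t => ?_)
  by_cases ht : t ∈ boundaryParameters p
  · have ht' : (!₂[0, t] : E2) ∈ chartTarget p := ht
    simp only [hw, hM]
    rw [indicator_of_mem ht, indicator_of_mem ht', hF.chartGradient_boundary hθ ht' rfl,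
      inner_smul_right, inner_neg_right, inner_smul_right]
    simp only [chartMap, Function.comp_apply]
    ring
  · have ht' : (!₂[0, t] : E2) ∉ chartTarget p := ht
    simp only [hw]
    rw [indicator_of_notMem ht, indicator_of_notMem ht', neg_zero]

/-- The first variation formula for capillary immersions. -/
theorem IsCapillaryImmersion.exists_first_variation [Nonempty S] [T2Space S]
    (hF : IsCapillaryImmersion θ F ν) (hθ : θ ∈ Set.Ioo 0 Real.pi) :
    ∃ Z : S → E3, Continuous Z ∧ ∀ X : E3 → E3, ContDiff ℝ 1 X →
      ∫ q, divAlong (tangentPlane F hF.immersion q).1 X (F q) ∂(areaMeasure F) =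
        - ∫ q, inner ℝ (X (F q)) (Z q) ∂(areaMeasure F) +
        ∫ q, inner ℝ (X (F q)) (capillaryConormal θ ν q) ∂(boundaryLength F) := by
  obtain ⟨t, χ, hχ, hχs, hχ1⟩ := exists_smooth_partition (S := S)
  have hχ' : ∀ p, ContMDiff (𝓡∂ 2) 𝓘(ℝ, ℝ) 1 (χ p) := fun p => (hχ p).of_le (mod_cast le_top)
  have hZ := fun p => hF.continuous_surfaceCurvature (hχ' p) (hχs p)
  -- The localized curvatures contain gradients of the cut-offs, which cancel in the sum because the
  -- cut-offs add up to one; what remains is the mean curvature vector.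
  refine ⟨fun q => ∑ p ∈ t, surfaceCurvature F (χ p) p q, continuous_finsetSum _ fun p _ => hZ p,
    fun X hX => ?_⟩
  have := isFiniteMeasure_areaMeasure hF.contMDiff_one hF.immersion
  have := isFiniteMeasure_boundaryLength hF.contMDiff_one hF.immersion
  have hint : ∀ {μ : Measure S} [IsFiniteMeasure μ] {f : S → ℝ}, Continuous f → Integrable f μ :=
    fun hf => hf.integrable_of_hasCompactSupport (HasCompactSupport.of_compactSpace _)
  have hXF : Continuous fun q => X (F q) := hX.continuous.comp hF.contMDiff.continuous
  have hdc := hF.continuous_divAlong_tangentPlane hX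
  rw [neg_add_eq_sub, eq_sub_iff_add_eq, ← integral_add (hint hdc)
    (hint (hXF.inner (continuous_finsetSum _ fun p _ => hZ p)))]
  have hsum1 : ∀ q, divAlong (tangentPlane F hF.immersion q).1 X (F q) +
      inner ℝ (X (F q)) (∑ p ∈ t, surfaceCurvature F (χ p) p q) =
      ∑ p ∈ t, (χ p q * divAlong (tangentPlane F hF.immersion q).1 X (F q) +
        inner ℝ (X (F q)) (surfaceCurvature F (χ p) p q)) := by
    intro q
    rw [Finset.sum_add_distrib, ← Finset.sum_mul, hχ1, one_mul, inner_sum]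
  have hsum2 : ∀ q, (inner ℝ (X (F q)) (capillaryConormal θ ν q) : ℝ) =
      ∑ p ∈ t, χ p q * inner ℝ (X (F q)) (capillaryConormal θ ν q) := by
    intro q
    rw [← Finset.sum_mul, hχ1, one_mul]
  have hI1 : ∀ p, Continuous fun q =>
      χ p q * divAlong (tangentPlane F hF.immersion q).1 X (F q) +
        inner ℝ (X (F q)) (surfaceCurvature F (χ p) p q) := fun p =>
    ((hχ' p).continuous.mul hdc).add (hXF.inner (hZ p))
  have hI2 : ∀ p, Continuous fun q => χ p q * inner ℝ (X (F q)) (capillaryConormal θ ν q) := fun p =>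
    (hχ' p).continuous.mul (hXF.inner (continuous_capillaryConormal hF.normal_continuous))
  rw [integral_congr_ae (Eventually.of_forall hsum1), integral_congr_ae (Eventually.of_forall hsum2),
    integral_finsetSum _ fun p _ => hint (hI1 p), integral_finsetSum _ fun p _ => hint (hI2 p)]
  exact Finset.sum_congr rfl fun p _ => hF.integral_div_of_tsupport hθ (hχ' p) (hχs p) hX

end FirstVariation


/-! ### The contact pair -/

section ContactPair

/-- Square-integrable fields can be pushed forward along a map. -/
theorem exists_memLp_two_map_inner {α : Type*} [MeasurableSpace α] {μ : Measure α} {F : α → E3}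
    (hF : Measurable F) {Z : α → E3} (hZ : MemLp Z 2 μ) :
    ∃ H : E3 → E3, MemLp H 2 (μ.map F) ∧ ∀ X : E3 → E3, MemLp X 2 (μ.map F) →
      ∫ x, inner ℝ (H x) (X x) ∂(μ.map F) = ∫ q, inner ℝ (X (F q)) (Z q) ∂μ := by
  have hmp : MeasurePreserving F μ (μ.map F) := ⟨hF, rfl⟩
  set T := (Lp.compMeasurePreservingₗᵢ ℝ F hmp : Lp E3 2 (μ.map F) →ₗᵢ[ℝ] Lp E3 2 μ) with hT
  -- Composition with `F` is an `L²` isometry; its adjoint averages `Z` over the sheets above a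
  -- point, as a conditional expectation does.
  set H := ContinuousLinearMap.adjoint T.toContinuousLinearMap (hZ.toLp Z) with hH
  refine ⟨H, Lp.memLp H, fun X hX => ?_⟩
  have h := ContinuousLinearMap.adjoint_inner_left T.toContinuousLinearMap (hX.toLp X) (hZ.toLp Z)
  rw [← hH] at h
  have hTX : T.toContinuousLinearMap (hX.toLp X) = (hX.comp_measurePreserving hmp).toLp _ := rfl
  rw [hTX, L2.inner_def, L2.inner_def] at h
  refine Eq.trans (integral_congr_ae ?_) (h.trans (integral_congr_ae ?_))
  · filter_upwards [hX.coeFn_toLp] with x hx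
    rw [hx]
  · filter_upwards [hZ.coeFn_toLp, (hX.comp_measurePreserving hmp).coeFn_toLp] with q h1 h2
    rw [h1, h2, real_inner_comm]
    rfl

/-- A horizontal vector sees only the horizontal part of the conormal. That part is `cos θ / sin θ`
times the horizontal part of `ν`, hence `cos θ ν̄`. -/
theorem inner_capillaryConormal_of_tangent {S : Type*} {ν : S → E3} {θ : ℝ} {q : S} {x : E3}
    (hx : x 2 = 0) : inner ℝ x (capillaryConormal θ ν q) =
      Real.cos θ * inner ℝ (cross (capillaryTangent θ ν q) vertical) x := by
  simp only [inner_E3, capillaryConormal, capillaryTangent, PiLp.smul_apply, PiLp.sub_apply,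
    smul_eq_mul, vertical_apply_two, vertical_apply_zero, vertical_apply_one, cross_apply_zero,
    cross_apply_one, cross_apply_two, hx]
  ring

variable {S : Type*} [TopologicalSpace S] [ChartedSpace (EuclideanHalfSpace 2) S]
  [IsManifold (𝓡∂ 2) ∞ S] {F ν : S → E3} {θ : ℝ}
  [CompactSpace S] [MeasurableSpace S] [BorelSpace S]

theorem IsCapillaryImmersion.integral_imageVarifold [T2Space S] (hF : IsCapillaryImmersion θ F ν)
    {X : E3 → E3} (hX : ContDiff ℝ 1 X) :
    ∫ z, divAlong z.2.1 X z.1 ∂(imageVarifold F hF.immersion) =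
      ∫ q, divAlong (tangentPlane F hF.immersion q).1 X (F q) ∂(areaMeasure F) := by
  rw [imageVarifold, integral_map hF.measurable_pair.aemeasurable
    (continuous_divAlong hX).aestronglyMeasurable]

/-- Only boundary points reach the plane and they carry no area, which makes the tangency
requirement on `H` vacuous. -/
theorem IsCapillaryImmersion.map_areaMeasure_boundaryPlane [Nonempty S]
    (hF : IsCapillaryImmersion θ F ν) : (areaMeasure F).map F boundaryPlane = 0 := by
  rw [Measure.map_apply hF.contMDiff.continuous.measurable isClosed_boundaryPlane.measurableSet]
  have : F ⁻¹' boundaryPlane = (𝓡∂ 2).boundary S := by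
    ext q
    exact hF.mem_boundaryPlane_iff q
  rw [this]
  exact areaMeasure_boundary hF.contMDiff_one hF.immersion

theorem IsCapillaryImmersion.exists_isContactPair [Nonempty S] [T2Space S]
    (hF : IsCapillaryImmersion θ F ν) (hθ : θ ∈ Set.Ioo 0 Real.pi)
    (hwind : ∀ x ∈ boundaryPlane, x ∉ F '' (𝓡∂ 2).boundary S → 0 ≤ windingNumber F ν x) :
    ∃ H : E3 → E3,
      IsContactPair θ (imageVarifold F hF.immersion) (windingVarifold F ν) H ∧
        MemLp H 2 (varifoldWeight (imageVarifold F hF.immersion)) := by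
  have hFm : Measurable F := hF.contMDiff.continuous.measurable
  have hfin := isFiniteMeasure_areaMeasure hF.contMDiff_one hF.immersion
  have hfinμ : IsFiniteMeasure ((areaMeasure F).map F) := Measure.isFiniteMeasure_map _ F
  obtain ⟨Z, hZ, hvar⟩ := hF.exists_first_variation hθ
  obtain ⟨H, hH, hHX⟩ := exists_memLp_two_map_inner (μ := areaMeasure F) hFm
    (hZ.memLp_of_hasCompactSupport (HasCompactSupport.of_compactSpace Z))
  refine ⟨H, ?_, by rwa [hF.varifoldWeight_eq]⟩
  refine ⟨hF.isRectifiableVarifold, hF.isRectifiableVarifold_winding hθ,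
    hF.support_subset.trans ?_, support_windingVarifold F ν,
    (isCountablyTwoRectifiable_range hF.contMDiff_one hF.immersion).mono hF.support_subset,
    ?_, ?_, fun X hX hXc hXt => ?_⟩
  · rintro _ ⟨q, rfl⟩
    exact hF.nonneg q
  · rw [hF.varifoldWeight_eq]
    -- The total area is finite, so square integrability implies integrability.
    exact hH.mono_exponent one_le_two
  · rw [hF.varifoldWeight_eq]
    filter_upwards [compl_mem_ae_iff.2 hF.map_areaMeasure_boundaryPlane] with x hx hx'
    exact absurd hx' hx
  · rw [hF.integral_imageVarifold hX, hF.integral_div_windingMeasure hθ hwind hX hXc, hvar X hX,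
      hF.varifoldWeight_eq, hHX X (hX.continuous.memLp_of_hasCompactSupport hXc),
      ← integral_const_mul, sub_eq_iff_eq_add, add_right_inj]
    refine integral_congr_ae ?_
    filter_upwards [hF.ae_mem_boundary] with q hq
    exact inner_capillaryConormal_of_tangent (hXt _ (hF.boundary_zero q hq))

end ContactPair

end

theorem mainTheorem9 {S : Type*} [TopologicalSpace S] [T2Space S] [CompactSpace S]
    [ChartedSpace (EuclideanHalfSpace 2) S] [IsManifold (𝓡∂ 2) ∞ S]
    [MeasurableSpace S] [BorelSpace S]
    (hS : ((𝓡∂ 2).boundary S).Nonempty)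
    (θ : ℝ) (hθ : θ ∈ Set.Ioo 0 Real.pi)
    (F ν : S → E3) (hF : IsCapillaryImmersion θ F ν)
    (hwind : ∀ x ∈ boundaryPlane, x ∉ F '' (𝓡∂ 2).boundary S → 0 ≤ windingNumber F ν x) :
    ∃ H : E3 → E3,
      IsContactPair θ (imageVarifold F hF.immersion) (windingVarifold F ν) H ∧
        MemLp H 2 (varifoldWeight (imageVarifold F hF.immersion)) := by
  have : Nonempty S := hS.to_subtype.map Subtype.val
  exact hF.exists_isContactPair hθ hwind
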